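/- **Setting.** Let a group $G$ act on a qudit $\mathbb C^d$ by a unitary representation $U$, and on $N$ qudits by $U(g)^{\otimes N}$. For a finite-dimensional unitary irreducible representation $J$ of $G$ that occurs in $U^{\otimes N}$, let $P_J$ be the orthogonal projector onto the sum of all copies of $J$ in $(\mathbb C^d)^{\otimes N}$, and let $\rho_J=P_J/\operatorname{Tr}P_J$. The maximally mixed invariant state (MMIS) $\rho^N_{\mathrm{inv}}$ is $\rho_J$ for the trivial $J$, i.e. the normalized projector onto the invariant vectors; it exists when $N$ lies in the set $S$ of sizes with a nonzero invariant vector. Let $O=(O_\alpha)$ be a finite multiplet of one-site operators with $U(g)O_\alpha U(g)^\dagger=\sum_\beta R(g)_{\alpha\beta}O_\beta$, $R(g)$ unitary, and put $O^{(2)}_{ij}=\sum_\alpha O_{i,\alpha}O_{j,\alpha}^\dagger$ for sites $i\ne j$. With $F(\rho,\sigma)=\operatorname{Tr}\sqrt{\sqrt\rho\,\sigma\sqrt\rho}$, the fidelity correlator is $F_O(i,j)=F\big(\rho,O^{(2)}_{ij}\rho\,O^{(2)\dagger}_{ij}\big)$ and the linear correlator is $\operatorname{Tr}[\rho\,O^{(2)}_{ij}]$.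 A family of states $\rho_N$, $N\in S$ ($S$ infinite), has *strong-to-weak spontaneous symmetry breaking* (SW-SSB) if every $\rho_N$ is strongly symmetric ($U(g)^{\otimes N}\rho_N=\lambda(g)\rho_N$ with $\lambda:G\to U(1)$ a homomorphism) and some charged multiplet $O$ (one whose span contains no nonzero symmetric operator) has, as $N\to\infty$ in $S$, fidelity correlators bounded below by a positive constant uniformly in $i\neq j$ and linear correlators tending to $0$ uniformly in $i\ne j$; such an $O$ is said to detect SW-SSB. **(1)** For every $\rho_J$ as above, every multiplet $O$ and all $i\neq j$, $$F_O(i,j)=\frac1{\operatorname{Tr}P_J}\operatorname{Tr}\Big[P_J\sqrt{O^{(2)}_{ij}O^{(2)\dagger}_{ij}}\Big]=\operatorname{Tr}\big[\rho_J\,|O^{(2)}_{ij}|\big].$$ It is strictly positive if and only if $O^{(2)}_{ij}$ does not vanish on the sector $J$ (that is, $P_JO^{(2)}_{ij}\ne0$), and it does not depend on the choice of the distinct sites $i,j$. **(2)** Let $G$ be a compact connected Lie group with semisimple Lie algebra $\mathfrak g$, and $U=\mathcal V$ a smooth irreducible unitary representation of dimension $d\ge2$. Then the MMIS of $U$, $N\in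 S$, has SW-SSB. More precisely, let $(X_\alpha)$ be a basis of $\mathfrak g$ orthonormal for the Killing form $B$, $B(X_\alpha,X_\beta)=-\delta_{\alpha\beta}$; write $U(X)$ also for the derived representation of $\mathfrak g$, let $O_\alpha=U(X_\alpha)$, and let $c_J$ be the eigenvalue of the Casimir operator $-\sum_\alpha J(X_\alpha)^2$, which is scalar on $J=\mathcal V$ and on every irreducible $J$ occurring in $\mathcal V^{\otimes2}$. Then $O$ detects SW-SSB of the MMIS; $c_{\mathcal V}>0$; there are constants $0<a\le b$ with $a\le F_O(i,j)\le b$ for all $N\in S$ and all $i\ne j$; and, for all $N\in S$ and $i\ne j$, $$\operatorname{Tr}\big[\rho^N_{\mathrm{inv}}O^{(2)}_{ij}\big]=-\frac{c_{\mathcal V}}{N-1},\qquad \operatorname{Tr}\big[\rho^N_{\mathrm{inv}}O_{i,\alpha}\big]=0 .$$ Moreover, with $J$ running over the inequivalent irreducible representations in $\mathcal V^{\otimes 2}$, $P^{(i,j)}_J$ the projector of the qudits $i,j$ onto their sector $J$, $\mathfrak C^N_J$ the multiplicity of $J$ in $\mathcal V^{\otimes N}$ and $J^*$ the conjugate of $J$,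 one has for every $N$ and $i\neq j$ $$O^{(2)}_{ij}=\sum_J\frac{c_J-2c_{\mathcal V}}2\,P_J^{(i,j)},$$ and for every $N\in S$ and $i\ne j$ $$F_O(i,j)=\sum_J\Big|\frac{c_J-2c_{\mathcal V}}2\Big|\frac{\mathfrak C^2_J\,\mathfrak C^{N-2}_{J^*}}{\mathfrak C^N_{\mathrm{inv}}}.$$ **(3)** For $G=SU(2)$ acting on qubits in its defining representation and $O=(S_x,S_y,S_z)$ the spin operators (half the Pauli matrices), $S$ is the set of even numbers, the MMIS has SW-SSB, detected by $O$, $\operatorname{Tr}[\rho^N_{\mathrm{inv}}\,\mathbf S_i\cdot\mathbf S_j]=-\frac{3}{4(N-1)}$ for all even $N$ and $i\ne j$, and $F_O(i,j)\to\frac38$ as $N\to\infty$ through even $N$, uniformly in $i\neq j$. -/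

import Mathlib

open scoped Matrix ContDiff Manifold

noncomputable section

namespace SWSSB

/-! ### Operators on finite-dimensional Hilbert spaces -/

section Operators

variable {ι : Type*} [Fintype ι] [DecidableEq ι]

/-- The positive square root of a positive semidefinite matrix (spectral functional calculus). -/
def matSqrt (A : Matrix ι ι ℂ) : Matrix ι ι ℂ := cfc Real.sqrt A

/-- The absolute value `|A| = √(A† A)`. -/
def matAbs (A : Matrix ι ι ℂ) : Matrix ι ι ℂ := matSqrt (Aᴴ * A)

/-- The fidelity `F(ρ, σ) = Tr √(√ρ σ √ρ)`. -/
def fidelity (ρ σ : Matrix ι ι ℂ) : ℝ :=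
  (matSqrt (matSqrt ρ * σ * matSqrt ρ)).trace.re

/-- The matrix of the orthogonal projection onto a subspace. -/
def projMatrix (K : Submodule ℂ (EuclideanSpace ℂ ι)) : Matrix ι ι ℂ :=
  Matrix.toEuclideanLin.symm (K.starProjection : EuclideanSpace ℂ ι →ₗ[ℂ] EuclideanSpace ℂ ι)

/-- The maximally mixed state on a (nonzero) subspace: its projector divided by its trace. -/
def maxMixed (K : Submodule ℂ (EuclideanSpace ℂ ι)) : Matrix ι ι ℂ :=
  (projMatrix K).trace⁻¹ • projMatrix K

end Operators

/-! ### Unitary representations and their sectors -/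

section Representations

variable {G : Type*} [Group G] {ι κ : Type*} [Fintype ι] [DecidableEq ι]
  [Fintype κ] [DecidableEq κ]

/-- The linear representation on `ℂ^ι` given by a unitary matrix representation. -/
def toRep (W : G →* Matrix.unitaryGroup ι ℂ) : Representation ℂ G (EuclideanSpace ℂ ι) :=
  ((Matrix.toLpLinAlgEquiv 2 : Matrix ι ι ℂ ≃ₐ[ℂ] Module.End ℂ (EuclideanSpace ℂ ι)) :
      Matrix ι ι ℂ →* Module.End ℂ (EuclideanSpace ℂ ι)).comp
    ((Matrix.unitaryGroup ι ℂ).subtype.comp W)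

lemma toRep_apply (W : G →* Matrix.unitaryGroup ι ℂ) (g : G) :
    toRep W g = Matrix.toEuclideanLin (W g : Matrix ι ι ℂ) := rfl

/-- Irreducibility of a unitary representation. -/
def IsIrrep (W : G →* Matrix.unitaryGroup ι ℂ) : Prop := (toRep W).IsIrreducible

/-- The sector of `W` labelled by `J`: the sum of all copies of `J` inside `W`. -/
def sector (W : G →* Matrix.unitaryGroup ι ℂ) (J : G →* Matrix.unitaryGroup κ ℂ) :
    Submodule ℂ (EuclideanSpace ℂ ι) :=
  ⨆ T : Representation.IntertwiningMap (toRep J) (toRep W), LinearMap.range T.toLinearMap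

/-- The number of times the irreducible representation `J` occurs in `W`. -/
def mult (W : G →* Matrix.unitaryGroup ι ℂ) (J : G →* Matrix.unitaryGroup κ ℂ) : ℕ :=
  Module.finrank ℂ (Representation.IntertwiningMap (toRep J) (toRep W))

/-- The subspace of vectors fixed by the whole group. -/
def invSector (W : G →* Matrix.unitaryGroup ι ℂ) : Submodule ℂ (EuclideanSpace ℂ ι) :=
  (toRep W).invariants

/-- The invariant sector is the sector of the trivial one-dimensional representation. -/
lemma sector_trivial (W : G →* Matrix.unitaryGroup ι ℂ) :
    sector W (1 : G →* Matrix.unitaryGroup (Fin 1) ℂ) = invSector W := by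
  have h1 : ∀ (g : G) (v : EuclideanSpace ℂ (Fin 1)),
      toRep (1 : G →* Matrix.unitaryGroup (Fin 1) ℂ) g v = v := by
    intro g v
    rw [toRep_apply]
    simp
  apply le_antisymm
  · refine iSup_le fun T => ?_
    rintro _ ⟨v, rfl⟩ g
    have := congrArg (fun f => f v) (T.isIntertwining' g)
    simp only [LinearMap.comp_apply, h1] at this
    exact this.symm
  · intro v hv
    let f : EuclideanSpace ℂ (Fin 1) →ₗ[ℂ] EuclideanSpace ℂ ι :=
      { toFun := fun x => x 0 • v
        map_add' := fun x y => by simp [add_smul]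
        map_smul' := fun c x => by simp [mul_smul] }
    let T : Representation.IntertwiningMap
        (toRep (1 : G →* Matrix.unitaryGroup (Fin 1) ℂ)) (toRep W) :=
      { f with
        isIntertwining' := fun g => by
          ext1 x
          change f _ = toRep W g (x 0 • v)
          rw [h1, map_smul, hv g]
          rfl }
    refine (le_iSup (fun T : Representation.IntertwiningMap
        (toRep (1 : G →* Matrix.unitaryGroup (Fin 1) ℂ)) (toRep W) =>
        LinearMap.range T.toLinearMap) T) ⟨EuclideanSpace.single 0 1, ?_⟩
    change (EuclideanSpace.single (0 : Fin 1) (1 : ℂ)) 0 • v = v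
    simp

/-- The complex conjugate (dual) representation. -/
def conjRep (J : G →* Matrix.unitaryGroup κ ℂ) : G →* Matrix.unitaryGroup κ ℂ where
  toFun g := ⟨(J g : Matrix κ κ ℂ).map star, by
    have h := Matrix.mem_unitaryGroup_iff.mp (J g).2
    rw [Matrix.mem_unitaryGroup_iff]
    have h2 := congrArg (fun M : Matrix κ κ ℂ => M.map (starRingEnd ℂ)) h
    simp only [Matrix.map_mul] at h2
    rw [Matrix.map_one _ (map_zero _) (map_one _)] at h2
    exact h2⟩
  map_one' := by
    apply Subtype.ext
    simp [Matrix.map_one]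
  map_mul' g h := by
    apply Subtype.ext
    change (((J (g * h) : Matrix.unitaryGroup κ ℂ) : Matrix κ κ ℂ).map (starRingEnd ℂ)) = _
    rw [map_mul]
    exact Matrix.map_mul

/-- The family `J` lists the irreducible representations occurring in `W`, each equivalence class
exactly once. -/
structure ListsIrreps (W : G →* Matrix.unitaryGroup ι ℂ) {K : Type*} (m : K → ℕ)
    (J : ∀ k, G →* Matrix.unitaryGroup (Fin (m k)) ℂ) : Prop where
  irrep : ∀ k, IsIrrep (J k)
  occurs : ∀ k, sector W (J k) ≠ ⊥
  inequivalent : ∀ k l, Nonempty (Representation.Equiv (toRep (J k)) (toRep (J l))) → k = l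
  complete : ∀ (m' : ℕ) (J' : G →* Matrix.unitaryGroup (Fin m') ℂ), IsIrrep J' →
    sector W J' ≠ ⊥ → ∃ k, Nonempty (Representation.Equiv (toRep J') (toRep (J k)))

end Representations

/-! ### Systems of `N` qudits. The Hilbert space `(ℂ^d)^{⊗N}` has the orthonormal basis
`Fin N → Fin d` of product vectors. -/

section Qudits

variable {d : ℕ}

/-- The operator `A ⊗ ⋯ ⊗ A` on `N` qudits. -/
def tensorPow (N : ℕ) (A : Matrix (Fin d) (Fin d) ℂ) :
    Matrix (Fin N → Fin d) (Fin N → Fin d) ℂ :=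
  Matrix.of fun s t => ∏ i, A (s i) (t i)

lemma tensorPow_one (N : ℕ) : tensorPow N (1 : Matrix (Fin d) (Fin d) ℂ) = 1 := by
  ext s t
  simp only [tensorPow, Matrix.of_apply, Matrix.one_apply]
  by_cases h : s = t
  · simp [h]
  · obtain ⟨i, hi⟩ := Function.ne_iff.mp h
    rw [if_neg h]
    exact Finset.prod_eq_zero (Finset.mem_univ i) (if_neg hi)

lemma tensorPow_mul (N : ℕ) (A B : Matrix (Fin d) (Fin d) ℂ) :
    tensorPow N (A * B) = tensorPow N A * tensorPow N B := by
  ext s t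
  simp only [tensorPow, Matrix.of_apply, Matrix.mul_apply, Finset.prod_univ_sum,
    Fintype.piFinset_univ, Finset.prod_mul_distrib]

lemma tensorPow_star (N : ℕ) (A : Matrix (Fin d) (Fin d) ℂ) :
    tensorPow N (star A) = star (tensorPow N A) := by
  ext s t
  simp [tensorPow, Matrix.star_apply]

/-- The on-site representation `U(g)^{⊗N}` on `N` qudits. -/
def tensorRep {G : Type*} [Group G] (U : G →* Matrix.unitaryGroup (Fin d) ℂ) (N : ℕ) :
    G →* Matrix.unitaryGroup (Fin N → Fin d) ℂ where
  toFun g := ⟨tensorPow N (U g), by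
    rw [Matrix.mem_unitaryGroup_iff, ← tensorPow_star, ← tensorPow_mul,
      Matrix.mem_unitaryGroup_iff.mp (U g).2, tensorPow_one]⟩
  map_one' := Subtype.ext (by simp [tensorPow_one])
  map_mul' g h := Subtype.ext (by simp [tensorPow_mul])

/-- The one-site operator `A` acting on site `i`. -/
def siteOp {N : ℕ} (i : Fin N) (A : Matrix (Fin d) (Fin d) ℂ) :
    Matrix (Fin N → Fin d) (Fin N → Fin d) ℂ :=
  Matrix.of fun s t => if ∀ k, k ≠ i → s k = t k then A (s i) (t i) else 0

/-- The two-site operator `B` acting on the pair of distinct sites `(i, j)`. -/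
def pairOp {N : ℕ} (i j : Fin N) (B : Matrix (Fin 2 → Fin d) (Fin 2 → Fin d) ℂ) :
    Matrix (Fin N → Fin d) (Fin N → Fin d) ℂ :=
  Matrix.of fun s t =>
    if ∀ k, k ≠ i → k ≠ j → s k = t k then B ![s i, s j] ![t i, t j] else 0

/-- The quadratic operator `O^{(2)}_{ij} = ∑_α O_{i,α} O_{j,α}†`. -/
def quadOp {N : ℕ} {A : Type*} [Fintype A] (O : A → Matrix (Fin d) (Fin d) ℂ) (i j : Fin N) :
    Matrix (Fin N → Fin d) (Fin N → Fin d) ℂ :=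
  ∑ α, siteOp i (O α) * siteOp j (O α)ᴴ

/-- The fidelity correlator `F(ρ, O^{(2)}_{ij} ρ O^{(2)}_{ij}†)`. -/
def fidelityCorr {N : ℕ} {A : Type*} [Fintype A] (ρ : Matrix (Fin N → Fin d) (Fin N → Fin d) ℂ)
    (O : A → Matrix (Fin d) (Fin d) ℂ) (i j : Fin N) : ℝ :=
  fidelity ρ (quadOp O i j * ρ * (quadOp O i j)ᴴ)

/-- The linear correlator `Tr[ρ O^{(2)}_{ij}]`. -/
def linearCorr {N : ℕ} {A : Type*} [Fintype A] (ρ : Matrix (Fin N → Fin d) (Fin N → Fin d) ℂ)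
    (O : A → Matrix (Fin d) (Fin d) ℂ) (i j : Fin N) : ℂ :=
  (ρ * quadOp O i j).trace

variable {G : Type*} [Group G]

/-- The one-site operators `O_α` transform among themselves by unitary matrices:
`U(g) O_α U(g)† = ∑_β R(g)_{αβ} O_β`. -/
def IsMultiplet {A : Type*} [Fintype A] [DecidableEq A] (U : G →* Matrix.unitaryGroup (Fin d) ℂ)
    (O : A → Matrix (Fin d) (Fin d) ℂ) : Prop :=
  ∃ R : G → Matrix.unitaryGroup A ℂ, ∀ g α,
    (U g : Matrix (Fin d) (Fin d) ℂ) * O α * (U g : Matrix (Fin d) (Fin d) ℂ)ᴴ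
      = ∑ β, (R g : Matrix A A ℂ) α β • O β

/-- A multiplet is charged if no nonzero combination of its members is symmetric. -/
def IsCharged {A : Type*} (U : G →* Matrix.unitaryGroup (Fin d) ℂ)
    (O : A → Matrix (Fin d) (Fin d) ℂ) : Prop :=
  ∀ B ∈ Submodule.span ℂ (Set.range O),
    (∀ g, (U g : Matrix (Fin d) (Fin d) ℂ) * B * (U g : Matrix (Fin d) (Fin d) ℂ)ᴴ = B) → B = 0

/-- The maximally mixed state `ρ_J` of the sector `J` of `N` qudits. -/
def sectorState (U : G →* Matrix.unitaryGroup (Fin d) ℂ) (N : ℕ) {κ : Type*} [Fintype κ]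
    [DecidableEq κ] (J : G →* Matrix.unitaryGroup κ ℂ) :
    Matrix (Fin N → Fin d) (Fin N → Fin d) ℂ :=
  maxMixed (sector (tensorRep U N) J)

/-- The maximally mixed invariant state (MMIS) of `N` qudits. -/
def mmis (U : G →* Matrix.unitaryGroup (Fin d) ℂ) (N : ℕ) :
    Matrix (Fin N → Fin d) (Fin N → Fin d) ℂ :=
  maxMixed (invSector (tensorRep U N))

lemma mmis_eq_sectorState (U : G →* Matrix.unitaryGroup (Fin d) ℂ) (N : ℕ) :
    mmis U N = sectorState U N (1 : G →* Matrix.unitaryGroup (Fin 1) ℂ) := by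
  rw [mmis, sectorState, sector_trivial]

/-- The system sizes for which there are invariant states, so that the MMIS exists. -/
def mmisSizes (U : G →* Matrix.unitaryGroup (Fin d) ℂ) : Set ℕ :=
  {N | invSector (tensorRep U N) ≠ ⊥}

/-- `ρ` is strongly symmetric: `U(g) ρ = λ(g) ρ` for a `U(1)`-valued representation `λ`. -/
def IsStronglySymmetric {ι : Type*} [Fintype ι] [DecidableEq ι]
    (W : G →* Matrix.unitaryGroup ι ℂ) (ρ : Matrix ι ι ℂ) : Prop :=
  ∃ χ : G →* Circle, ∀ g, (W g : Matrix ι ι ℂ) * ρ = (χ g : ℂ) • ρ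

open scoped ComplexOrder in
/-- The local multiplet `O` detects strong-to-weak spontaneous symmetry breaking of the family
of states `ρ N`, `N ∈ S`: the states are strongly symmetric, `O` is charged, the fidelity
correlator of `O` stays bounded away from zero between arbitrary distinct sites as `N → ∞`, while
the linear correlator vanishes. -/
structure DetectsSWSSB {A : Type*} [Fintype A] [DecidableEq A]
    (U : G →* Matrix.unitaryGroup (Fin d) ℂ) (S : Set ℕ)
    (ρ : ∀ N : ℕ, Matrix (Fin N → Fin d) (Fin N → Fin d) ℂ)
    (O : A → Matrix (Fin d) (Fin d) ℂ) : Prop where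
  sizes_infinite : S.Infinite
  state : ∀ N ∈ S, (ρ N).PosSemidef ∧ (ρ N).trace = 1
  strong : ∀ N ∈ S, IsStronglySymmetric (tensorRep U N) (ρ N)
  multiplet : IsMultiplet U O
  charged : IsCharged U O
  fidelity_long_range : ∃ a : ℝ, 0 < a ∧ ∃ N₀, ∀ N ∈ S, N₀ ≤ N → ∀ i j : Fin N, i ≠ j →
    a ≤ fidelityCorr (ρ N) O i j
  linear_decay : ∀ ε : ℝ, 0 < ε → ∃ N₀, ∀ N ∈ S, N₀ ≤ N → ∀ i j : Fin N, i ≠ j →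
    ‖linearCorr (ρ N) O i j‖ < ε

/-- Strong-to-weak spontaneous symmetry breaking. -/
def HasSWSSB (U : G →* Matrix.unitaryGroup (Fin d) ℂ) (S : Set ℕ)
    (ρ : ∀ N : ℕ, Matrix (Fin N → Fin d) (Fin N → Fin d) ℂ) : Prop :=
  ∃ (r : ℕ) (O : Fin r → Matrix (Fin d) (Fin d) ℂ), DetectsSWSSB U S ρ O

end Qudits

/-! ### Lie groups: infinitesimal generators and Casimir elements -/

section LieGroups

instance instLieGroupMinSmoothness {n : ℕ} {G : Type*} [TopologicalSpace G]
    [ChartedSpace (EuclideanSpace ℝ (Fin n)) G] [Group G]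
    [LieGroup 𝓘(ℝ, EuclideanSpace ℝ (Fin n)) ∞ G] :
    LieGroup 𝓘(ℝ, EuclideanSpace ℝ (Fin n)) (minSmoothness ℝ 3) G :=
  LieGroup.of_le (n := ∞) (by
    rw [minSmoothness_of_isRCLikeNormedField]
    exact ENat.LEInfty.out)

variable {n : ℕ} {G : Type*} [TopologicalSpace G] [ChartedSpace (EuclideanSpace ℝ (Fin n)) G]
  [Group G] {m : ℕ}

/-- Smoothness of a unitary representation of a Lie group. -/
def IsSmoothRep (U : G →* Matrix.unitaryGroup (Fin m) ℂ) : Prop :=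
  ∀ a b, ContMDiff 𝓘(ℝ, EuclideanSpace ℝ (Fin n)) 𝓘(ℝ, ℂ) ∞
    (fun g : G => (U g : Matrix (Fin m) (Fin m) ℂ) a b)

/-- The representation of the Lie algebra: the derivative of `U` at the identity, applied to the
tangent vector `X`. -/
def generator (U : G →* Matrix.unitaryGroup (Fin m) ℂ)
    (X : GroupLieAlgebra 𝓘(ℝ, EuclideanSpace ℝ (Fin n)) G) : Matrix (Fin m) (Fin m) ℂ :=
  Matrix.of fun a b => mfderiv 𝓘(ℝ, EuclideanSpace ℝ (Fin n)) 𝓘(ℝ, ℂ)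
    (fun g : G => (U g : Matrix (Fin m) (Fin m) ℂ) a b) 1 X

/-- The representation of the quadratic Casimir element, `-∑_α U(X_α)²`. -/
def casimirOp {A : Type*} [Fintype A]
    (X : A → GroupLieAlgebra 𝓘(ℝ, EuclideanSpace ℝ (Fin n)) G)
    (U : G →* Matrix.unitaryGroup (Fin m) ℂ) : Matrix (Fin m) (Fin m) ℂ :=
  -∑ α, generator U (X α) * generator U (X α)

/-- The Casimir eigenvalue of an irreducible representation, as the normalized trace of the
(scalar) Casimir operator. -/
def casimirValue {A : Type*} [Fintype A]
    (X : A → GroupLieAlgebra 𝓘(ℝ, EuclideanSpace ℝ (Fin n)) G)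
    (U : G →* Matrix.unitaryGroup (Fin m) ℂ) : ℝ :=
  (casimirOp X U).trace.re / m

/-- A basis of the Lie algebra that is orthonormal for the Killing form `B`. For a compact semisimple
Lie group `B` is negative definite, so this means `B(X_α, X_β) = -δ_{αβ}`. -/
def IsKillingOrthonormal [LieGroup 𝓘(ℝ, EuclideanSpace ℝ (Fin n)) ∞ G] {A : Type*} [DecidableEq A]
    (X : Module.Basis A ℝ (GroupLieAlgebra 𝓘(ℝ, EuclideanSpace ℝ (Fin n)) G)) : Prop :=
  ∀ α β, killingForm ℝ (GroupLieAlgebra 𝓘(ℝ, EuclideanSpace ℝ (Fin n)) G) (X α) (X β)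
    = if α = β then -1 else 0

end LieGroups

/-! ### Spin-1/2 -/

/-- The defining representation of `SU(2)` on a qubit. -/
def qubitRep : Matrix.specialUnitaryGroup (Fin 2) ℂ →* Matrix.unitaryGroup (Fin 2) ℂ :=
  Submonoid.inclusion Matrix.specialUnitaryGroup_le_unitaryGroup

/-- The spin operators `S_x, S_y, S_z` (half the Pauli matrices). -/
def spin : Fin 3 → Matrix (Fin 2) (Fin 2) ℂ :=
  ![!![0, 1 / 2; 1 / 2, 0], !![0, -Complex.I / 2; Complex.I / 2, 0], !![1 / 2, 0; 0, -1 / 2]]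

end SWSSB

end

noncomputable section

namespace SWSSB

set_option linter.unusedSectionVars false

/-! ### Square roots and absolute values of matrices. -/

section MatrixCalculus

open scoped ComplexOrder MatrixOrder

variable {ι κ : Type*} [Fintype ι] [DecidableEq ι] [Fintype κ] [DecidableEq κ]

/-! The fidelity formula rests on symmetry. For a multiplet, Q = `quadOp O i j` commutes with the
group action, hence with the projector P of a sector. Since √ρ is a multiple of P, the nested square
root in the fidelity collapses to a multiple of P√(QQ†) (`fidelity_maxMixed`). Permutations of the
sites also commute with the group action, so P is permutation invariant: the correlator does not
depend on the pair, and exchanging i and j turns Q into Q†, hence √(QQ†) into |Q|.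

For the MMIS ρ of a Lie group, differentiating the group action shows that the collective generators
T_α = ∑ᵢ O_{i,α} annihilate the invariant vectors. By Schur's lemma ∑ O_α O_α† = c. Expanding 0 = ∑
Tr ρ T_α T_α† over pairs of sites gives Nc + N(N-1) Tr ρQ = 0, which is the linear correlator
(`linearCorr_eq`).

The lower bound on the fidelity correlator comes from the second moment (`trace_quadOp_sq_ge`). Put
B_{αβ} = O_α O_β. Then Q² = ∑ B_{αβ} B_{αβ} with one factor on each site, so N(N-1) Tr ρQ² is the
sum of Tr ρ(∑ᵢ B_{αβ})² up to a one-site term of order N. All these terms are nonnegative, because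
the total of a commutator annihilates ρ, and the diagonal ones are bounded below by squares of means
which add up to -cN. By Cauchy-Schwarz the sum is at least c²N² divided by the number of generators,
so Tr ρQ² stays away from 0. Since |Q| is a fixed two-site operator, |Q|² ≤ K|Q| with K independent
of N, and the bound passes to Tr ρ|Q| (`exists_trace_matAbs_bounds`).

Lie theory supplies the rest. A derived representation is a Lie homomorphism (`generator_lie`)
intertwining the adjoint action (`generator_adMap`), which preserves the Killing form; so the
generators form a multiplet. A semisimple Lie algebra is spanned by brackets, so generators are
traceless, which makes them charged, and on a connected group the determinant is 1; hence totally
antisymmetric states of d qudits are invariant and infinitely many sizes occur. The pair Casimir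
equals 2c + 2Q, which diagonalizes Q on the sectors of two qudits, and the weight of each sector in
ρ is a product of multiplicities (`trace_invSector_prodRep_mul`).

For qubits Q is affine in the swap operator, so |Q| is affine in Q, and the fidelity correlator
follows exactly from the linear one. -/

lemma matSqrt_eq_sqrt {A : Matrix ι ι ℂ} (hA : A.PosSemidef) : matSqrt A = CFC.sqrt A := by
  rw [matSqrt, CFC.sqrt_eq_real_sqrt A hA.nonneg, cfcₙ_eq_cfc]

lemma matSqrt_posSemidef {A : Matrix ι ι ℂ} (hA : A.PosSemidef) : (matSqrt A).PosSemidef := by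
  rw [matSqrt_eq_sqrt hA]
  exact Matrix.nonneg_iff_posSemidef.mp (CFC.sqrt_nonneg A)

lemma matSqrt_mul_self {A : Matrix ι ι ℂ} (hA : A.PosSemidef) : matSqrt A * matSqrt A = A := by
  rw [matSqrt_eq_sqrt hA]
  exact CFC.sqrt_mul_sqrt_self A hA.nonneg

lemma matSqrt_unique {A M : Matrix ι ι ℂ} (hM : M.PosSemidef) (h : M * M = A) :
    matSqrt A = M := by
  have hA : A.PosSemidef := by
    have := Matrix.posSemidef_conjTranspose_mul_self M
    rwa [hM.isHermitian.eq, h] at this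
  rw [matSqrt_eq_sqrt hA]
  exact CFC.sqrt_unique h hM.nonneg

lemma commute_matSqrt {A B : Matrix ι ι ℂ} (h : Commute A B) : Commute (matSqrt A) B :=
  Commute.cfc_real h Real.sqrt

lemma matAbs_posSemidef (A : Matrix ι ι ℂ) : (matAbs A).PosSemidef :=
  matSqrt_posSemidef (Matrix.posSemidef_conjTranspose_mul_self A)

lemma matAbs_mul_self (A : Matrix ι ι ℂ) : matAbs A * matAbs A = Aᴴ * A :=
  matSqrt_mul_self (Matrix.posSemidef_conjTranspose_mul_self A)

lemma matSqrt_submatrix {A : Matrix ι ι ℂ} (hA : A.PosSemidef) (e : κ ≃ ι) :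
    matSqrt (A.submatrix e e) = (matSqrt A).submatrix e e := by
  refine matSqrt_unique ((matSqrt_posSemidef hA).submatrix e) ?_
  rw [Matrix.submatrix_mul_equiv, matSqrt_mul_self hA]

/-- The product equals √A B √A, because √A commutes with whatever commutes with A. -/
lemma posSemidef_mul_of_commute {A B : Matrix ι ι ℂ} (hA : A.PosSemidef) (hB : B.PosSemidef)
    (h : Commute A B) : (A * B).PosSemidef := by
  have h1 : A * B = (matSqrt A)ᴴ * B * matSqrt A := by
    rw [(matSqrt_posSemidef hA).isHermitian.eq]
    have : Commute (matSqrt A) B := commute_matSqrt h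
    rw [this.eq, mul_assoc, matSqrt_mul_self hA, h.eq]
  rw [h1]
  exact hB.conjTranspose_mul_mul_same _

lemma trace_mul_posSemidef {A B : Matrix ι ι ℂ} (hA : A.PosSemidef) (hB : B.PosSemidef) :
    0 ≤ (A * B).trace := by
  have h := (hB.conjTranspose_mul_mul_same (matSqrt A)).trace_nonneg
  rwa [(matSqrt_posSemidef hA).isHermitian.eq, Matrix.trace_mul_comm, ← mul_assoc,
    matSqrt_mul_self hA] at h

/-- The trace is the squared Hilbert-Schmidt norm of √B P. -/
lemma trace_mul_posSemidef_eq_zero_iff {P B : Matrix ι ι ℂ} (hP : P.IsHermitian) (hPP : P * P = P)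
    (hB : B.PosSemidef) : (P * B).trace = 0 ↔ P * B = 0 := by
  constructor
  · intro h
    have h1 : (P * B).trace = ((matSqrt B * P)ᴴ * (matSqrt B * P)).trace := by
      rw [Matrix.conjTranspose_mul, hP.eq, (matSqrt_posSemidef hB).isHermitian.eq, mul_assoc,
        ← mul_assoc (matSqrt B), matSqrt_mul_self hB, Matrix.trace_mul_comm P,
        Matrix.trace_mul_comm P, Matrix.mul_assoc, hPP]
    rw [h1, (Matrix.posSemidef_conjTranspose_mul_self _).trace_eq_zero_iff,
      Matrix.conjTranspose_mul_self_eq_zero] at h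
    have h2 : P * matSqrt B = 0 := by
      have := congrArg Matrix.conjTranspose h
      rwa [Matrix.conjTranspose_mul, hP.eq, (matSqrt_posSemidef hB).isHermitian.eq,
        Matrix.conjTranspose_zero] at this
    rw [← matSqrt_mul_self hB, ← mul_assoc, h2, zero_mul]
  · intro h
    rw [h, Matrix.trace_zero]

open scoped Matrix.Norms.L2Operator in
lemma exists_smul_one_sub_posSemidef {A : Matrix ι ι ℂ} (hA : A.IsHermitian) :
    ∃ K : ℝ, 0 < K ∧ ((K : ℂ) • (1 : Matrix ι ι ℂ) - A).PosSemidef := by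
  -- The summand 1 keeps the constant positive even for A = 0.
  refine ⟨‖A‖ + 1, by positivity, ?_⟩
  have h1 : A ≤ algebraMap ℝ (Matrix ι ι ℂ) ‖A‖ :=
    IsSelfAdjoint.le_algebraMap_norm_self hA.isSelfAdjoint
  have h2 : (((‖A‖ + 1 : ℝ) : ℂ) • (1 : Matrix ι ι ℂ) - A)
      = (algebraMap ℝ (Matrix ι ι ℂ) ‖A‖ - A) + 1 := by
    rw [Algebra.algebraMap_eq_smul_one, Complex.ofReal_add, add_smul, Complex.ofReal_one, one_smul,
      Complex.coe_smul]
    abel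
  rw [h2]
  exact (Matrix.le_iff.mp h1).add Matrix.PosSemidef.one

/-- Applied to A = |Q| this reads Q†Q ≤ K|Q|, which turns a lower bound on a second moment into one
on the mean of |Q|. -/
lemma exists_smul_sub_mul_self_posSemidef {A : Matrix ι ι ℂ} (hA : A.PosSemidef) :
    ∃ K : ℝ, 0 < K ∧ ((K : ℂ) • A - A * A).PosSemidef := by
  obtain ⟨K, hK, h⟩ := exists_smul_one_sub_posSemidef hA.isHermitian
  refine ⟨K, hK, ?_⟩
  have h1 : (K : ℂ) • A - A * A = A * ((K : ℂ) • (1 : Matrix ι ι ℂ) - A) := by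
    rw [mul_sub, mul_smul_comm, mul_one]
  rw [h1]
  refine posSemidef_mul_of_commute hA h ?_
  exact ((Commute.one_right A).smul_right _).sub_right (Commute.refl A)

lemma trace_im_of_isHermitian_mul {A B : Matrix ι ι ℂ} (hA : A.IsHermitian) (hB : B.IsHermitian) :
    ((A * B).trace.re : ℂ) = (A * B).trace := by
  apply Complex.conj_eq_iff_re.mp
  rw [starRingEnd_apply, ← Matrix.trace_conjTranspose, Matrix.conjTranspose_mul, hA.eq, hB.eq,
    Matrix.trace_mul_comm]

end MatrixCalculus

/-! ### Orthogonal projectors, and the fidelity of maximally mixed states. -/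

section Projections

open scoped ComplexOrder MatrixOrder

variable {ι κ : Type*} [Fintype ι] [DecidableEq ι] [Fintype κ] [DecidableEq κ]
  (K : Submodule ℂ (EuclideanSpace ℂ ι))

lemma toEuclideanLin_projMatrix :
    Matrix.toEuclideanLin (projMatrix K)
      = (K.starProjection : EuclideanSpace ℂ ι →ₗ[ℂ] EuclideanSpace ℂ ι) := by
  rw [projMatrix, LinearEquiv.apply_symm_apply]

lemma toEuclideanLin_mul (A : Matrix ι κ ℂ) (B : Matrix κ ι ℂ) :
    Matrix.toEuclideanLin (A * B) = Matrix.toEuclideanLin A ∘ₗ Matrix.toEuclideanLin B := by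
  rw [Matrix.toLpLin_mul_same]

lemma toEuclideanLin_mul_apply {μ : Type*} [Fintype μ] [DecidableEq μ] (A : Matrix ι κ ℂ)
    (B : Matrix κ μ ℂ) (v : EuclideanSpace ℂ μ) :
    Matrix.toEuclideanLin (A * B) v = Matrix.toEuclideanLin A (Matrix.toEuclideanLin B v) := by
  rw [Matrix.toLpLin_mul_same]
  rfl

lemma inner_toEuclideanLin (A : Matrix ι κ ℂ) (v : EuclideanSpace ℂ κ) (w : EuclideanSpace ℂ ι) :
    inner ℂ (Matrix.toEuclideanLin A v) w = inner ℂ v (Matrix.toEuclideanLin Aᴴ w) := by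
  rw [Matrix.toEuclideanLin_conjTranspose_eq_adjoint, LinearMap.adjoint_inner_right]

lemma projMatrix_isHermitian : (projMatrix K).IsHermitian := by
  rw [← Matrix.isSymmetric_toEuclideanLin_iff, toEuclideanLin_projMatrix]
  exact K.starProjection_isSymmetric

lemma projMatrix_mul_self : projMatrix K * projMatrix K = projMatrix K := by
  apply Matrix.toEuclideanLin.injective
  rw [toEuclideanLin_mul, toEuclideanLin_projMatrix]
  ext1 v
  exact Submodule.starProjection_eq_self_iff.mpr (Submodule.starProjection_apply_mem K v)

lemma projMatrix_posSemidef : (projMatrix K).PosSemidef := by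
  have := Matrix.posSemidef_conjTranspose_mul_self (projMatrix K)
  rwa [(projMatrix_isHermitian K).eq, projMatrix_mul_self] at this

lemma projMatrix_apply_eq_iff {v : EuclideanSpace ℂ ι} :
    Matrix.toEuclideanLin (projMatrix K) v = v ↔ v ∈ K := by
  rw [toEuclideanLin_projMatrix]
  exact Submodule.starProjection_eq_self_iff

lemma projMatrix_apply_mem (v : EuclideanSpace ℂ ι) :
    Matrix.toEuclideanLin (projMatrix K) v ∈ K := by
  rw [toEuclideanLin_projMatrix]
  exact Submodule.starProjection_apply_mem K v

lemma trace_eq_trace_toEuclideanLin (A : Matrix ι ι ℂ) :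
    A.trace = LinearMap.trace ℂ _ (Matrix.toEuclideanLin A) := by
  exact (Matrix.trace_toLin_eq A (PiLp.basisFun 2 ℂ ι)).symm

lemma trace_projMatrix : (projMatrix K).trace = Module.finrank ℂ K := by
  rw [trace_eq_trace_toEuclideanLin]
  apply LinearMap.IsProj.trace
  exact ⟨projMatrix_apply_mem K, fun v hv => (projMatrix_apply_eq_iff K).mpr hv⟩

lemma trace_projMatrix_ne_zero {K : Submodule ℂ (EuclideanSpace ℂ ι)} (hK : K ≠ ⊥) :
    (projMatrix K).trace ≠ 0 := by
  rw [trace_projMatrix]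
  simpa [Submodule.finrank_eq_zero] using hK

/-- A Hermitian matrix with values in `K` that fixes the vectors of `K` is the projector onto `K`. -/
lemma projMatrix_eq_of_isHermitian {P : Matrix ι ι ℂ} (hP : P.IsHermitian)
    (h1 : ∀ v ∈ K, Matrix.toEuclideanLin P v = v)
    (h2 : ∀ v, Matrix.toEuclideanLin P v ∈ K) : projMatrix K = P := by
  have hPQ : P * projMatrix K = projMatrix K := by
    apply Matrix.toEuclideanLin.injective
    ext1 v
    rw [toEuclideanLin_mul]
    exact h1 _ (projMatrix_apply_mem K v)
  have hQP : projMatrix K * P = P := by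
    apply Matrix.toEuclideanLin.injective
    ext1 v
    rw [toEuclideanLin_mul]
    exact (projMatrix_apply_eq_iff K).mpr (h2 v)
  have := congrArg Matrix.conjTranspose hPQ
  rw [Matrix.conjTranspose_mul, hP.eq, (projMatrix_isHermitian K).eq, hQP] at this
  exact this.symm

lemma mul_projMatrix_eq_iff {A : Matrix κ ι ℂ} {B : Matrix κ ι ℂ} :
    A * projMatrix K = B * projMatrix K
      ↔ ∀ v ∈ K, Matrix.toEuclideanLin A v = Matrix.toEuclideanLin B v := by
  constructor
  · intro h v hv
    rw [← (projMatrix_apply_eq_iff K).mpr hv, ← toEuclideanLin_mul_apply, h,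
      toEuclideanLin_mul_apply]
  · intro h
    apply Matrix.toEuclideanLin.injective
    ext1 v
    rw [toEuclideanLin_mul_apply, toEuclideanLin_mul_apply]
    exact h _ (projMatrix_apply_mem K v)

/-- Invariance under A gives PAP = AP; invariance under A†, after taking adjoints, gives PAP = PA.
-/
lemma projMatrix_commute {A : Matrix ι ι ℂ}
    (h1 : ∀ v ∈ K, Matrix.toEuclideanLin A v ∈ K)
    (h2 : ∀ v ∈ K, Matrix.toEuclideanLin Aᴴ v ∈ K) : Commute (projMatrix K) A := by
  have key : ∀ B : Matrix ι ι ℂ, (∀ v ∈ K, Matrix.toEuclideanLin B v ∈ K) →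
      projMatrix K * B * projMatrix K = B * projMatrix K := by
    intro B hB
    refine (mul_projMatrix_eq_iff K).mpr fun v hv => ?_
    rw [toEuclideanLin_mul_apply]
    exact (projMatrix_apply_eq_iff K).mpr (hB v hv)
  have e1 := key A h1
  have e2 := congrArg Matrix.conjTranspose (key _ h2)
  simp only [Matrix.conjTranspose_mul, Matrix.conjTranspose_conjTranspose,
    (projMatrix_isHermitian K).eq] at e2
  change _ = _
  rw [← e2, ← mul_assoc, e1]

lemma maxMixed_posSemidef : (maxMixed K).PosSemidef := by
  refine (projMatrix_posSemidef K).smul ?_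
  rw [inv_nonneg]
  exact (projMatrix_posSemidef K).trace_nonneg

lemma maxMixed_trace {K : Submodule ℂ (EuclideanSpace ℂ ι)} (hK : K ≠ ⊥) :
    (maxMixed K).trace = 1 := by
  rw [maxMixed, Matrix.trace_smul, smul_eq_mul, inv_mul_cancel₀ (trace_projMatrix_ne_zero hK)]

/-- The fidelity of a maximally mixed state on `K` with its image under an operator preserving
`K`. -/
lemma fidelity_maxMixed {A : Matrix ι ι ℂ} (hA : Commute (projMatrix K) A) :
    (fidelity (maxMixed K) (A * maxMixed K * Aᴴ) : ℂ)
      = (projMatrix K).trace⁻¹ * (projMatrix K * matSqrt (A * Aᴴ)).trace := by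
  set P := projMatrix K with hP
  set t := P.trace with ht
  have hH : P.IsHermitian := projMatrix_isHermitian K
  have hPP : P * P = P := projMatrix_mul_self K
  have hps : P.PosSemidef := projMatrix_posSemidef K
  have ht0 : 0 ≤ t⁻¹ := by rw [inv_nonneg]; exact hps.trace_nonneg
  -- The normalization is a nonnegative real r, so that √ρ = √r P.
  obtain ⟨r, hr, hrt⟩ : ∃ r : ℝ, 0 ≤ r ∧ (r : ℂ) = t⁻¹ :=
    ⟨(t⁻¹).re, (Complex.nonneg_iff.mp ht0).1, Complex.conj_eq_iff_re.mp
      (Complex.conj_eq_iff_im.mpr (Complex.nonneg_iff.mp ht0).2.symm)⟩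
  have hs : matSqrt (maxMixed K) = ((Real.sqrt r : ℝ) : ℂ) • P := by
    refine matSqrt_unique (hps.smul (by exact_mod_cast Real.sqrt_nonneg r)) ?_
    rw [smul_mul_smul_comm, hPP, maxMixed, ← hP, ← ht, ← hrt, ← Complex.ofReal_mul,
      Real.mul_self_sqrt hr]
  have hA' : Commute P Aᴴ := by
    have := congrArg Matrix.conjTranspose hA.eq
    rw [Matrix.conjTranspose_mul, Matrix.conjTranspose_mul, hH.eq] at this
    exact this.symm
  have hAA : Commute (A * Aᴴ) P := (hA.mul_right hA').symm
  have hS := matSqrt_posSemidef (Matrix.posSemidef_self_mul_conjTranspose A)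
  have hSP : Commute P (matSqrt (A * Aᴴ)) := (commute_matSqrt hAA).symm
  -- The candidate rP√(AA†) is positive, as a product of commuting positive factors, and its square
  -- is r²P(AA†) = √ρ (AρA†) √ρ.
  have h2 : matSqrt (matSqrt (maxMixed K) * (A * maxMixed K * Aᴴ) * matSqrt (maxMixed K))
      = (r : ℂ) • (P * matSqrt (A * Aᴴ)) := by
    refine matSqrt_unique ((posSemidef_mul_of_commute hps hS hSP).smul (by exact_mod_cast hr)) ?_
    rw [hs, maxMixed, ← hP, ← ht, ← hrt]
    simp only [smul_mul_assoc, mul_smul_comm, smul_smul]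
    congr 1
    · have := Real.mul_self_sqrt hr
      rw [← Complex.ofReal_mul, ← Complex.ofReal_mul, ← Complex.ofReal_mul]
      congr 1
      linear_combination (-r) * this
    · calc P * matSqrt (A * Aᴴ) * (P * matSqrt (A * Aᴴ))
          = P * P * (matSqrt (A * Aᴴ) * matSqrt (A * Aᴴ)) := hSP.symm.mul_mul_mul_comm _ _
        _ = P * (A * Aᴴ) := by
          rw [hPP, matSqrt_mul_self (Matrix.posSemidef_self_mul_conjTranspose A)]
        _ = P * (A * P * Aᴴ) * P := by
          rw [mul_assoc P (A * P * Aᴴ) P, mul_assoc (A * P), ← hA'.eq, mul_assoc A,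
            ← mul_assoc P P, hPP, ← mul_assoc A P, ← hA.eq, mul_assoc P A, ← mul_assoc P P, hPP]
  rw [fidelity, h2, Matrix.trace_smul, smul_eq_mul, ← hrt]
  have := trace_im_of_isHermitian_mul hH hS.isHermitian
  rw [← this, ← Complex.ofReal_mul, Complex.ofReal_re]

end Projections

/-! ### Product operators, one-site operators and collective operators. -/

section TensorAlgebra

open scoped ComplexOrder MatrixOrder Kronecker

variable {d N : ℕ}

/-- The product operator `⨂ᵢ Aᵢ` on `N` qudits. -/
def tensorFam : (Fin N → Matrix (Fin d) (Fin d) ℂ) →* Matrix (Fin N → Fin d) (Fin N → Fin d) ℂ where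
  toFun A := Matrix.of fun s t => ∏ i, A i (s i) (t i)
  map_one' := tensorPow_one N
  map_mul' A B := by
    ext s t
    simp only [Matrix.of_apply, Matrix.mul_apply, Finset.prod_univ_sum, Pi.mul_apply,
      Fintype.piFinset_univ, Finset.prod_mul_distrib]

lemma tensorFam_apply (A : Fin N → Matrix (Fin d) (Fin d) ℂ) (s t : Fin N → Fin d) :
    tensorFam A s t = ∏ i, A i (s i) (t i) := rfl

lemma tensorPow_eq_tensorFam (A : Matrix (Fin d) (Fin d) ℂ) :
    tensorPow N A = tensorFam fun _ => A := rfl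

lemma tensorFam_conjTranspose (A : Fin N → Matrix (Fin d) (Fin d) ℂ) :
    (tensorFam A)ᴴ = tensorFam fun i => (A i)ᴴ := by
  ext s t
  simp [tensorFam_apply, Matrix.conjTranspose_apply]

lemma siteOp_eq_tensorFam (i : Fin N) (A : Matrix (Fin d) (Fin d) ℂ) :
    siteOp i A = tensorFam (Pi.mulSingle i A) := by
  ext s t
  rw [tensorFam_apply, siteOp, Matrix.of_apply, Fintype.prod_eq_mul_prod_compl i,
    Pi.mulSingle_eq_same]
  have h : ∀ k ∈ ({i} : Finset (Fin N))ᶜ,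
      Pi.mulSingle (M := fun _ => Matrix (Fin d) (Fin d) ℂ) i A k (s k) (t k)
        = if s k = t k then 1 else 0 := by
    intro k hk
    rw [Pi.mulSingle_eq_of_ne (by simpa using hk), Matrix.one_apply]
  rw [Finset.prod_congr rfl h, Finset.prod_ite_zero]
  simp

lemma siteOp_mul (i : Fin N) (A B : Matrix (Fin d) (Fin d) ℂ) :
    siteOp i (A * B) = siteOp i A * siteOp i B := by
  simp only [siteOp_eq_tensorFam, Pi.mulSingle_mul, map_mul]

lemma siteOp_one (i : Fin N) : siteOp i (1 : Matrix (Fin d) (Fin d) ℂ) = 1 := by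
  rw [siteOp_eq_tensorFam, Pi.mulSingle_one, map_one]

lemma siteOp_conjTranspose (i : Fin N) (A : Matrix (Fin d) (Fin d) ℂ) :
    (siteOp i A)ᴴ = siteOp i Aᴴ := by
  rw [siteOp_eq_tensorFam, siteOp_eq_tensorFam, tensorFam_conjTranspose]
  congr 1
  ext1 k
  by_cases h : k = i
  · subst h
    simp
  · simp [Pi.mulSingle_eq_of_ne h]

lemma siteOp_commute {i j : Fin N} (h : i ≠ j) (A B : Matrix (Fin d) (Fin d) ℂ) :
    Commute (siteOp i A) (siteOp j B) := by
  rw [siteOp_eq_tensorFam, siteOp_eq_tensorFam]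
  have := Pi.mulSingle_commute (f := fun _ : Fin N => Matrix (Fin d) (Fin d) ℂ) h A B
  change _ = _
  rw [← map_mul, ← map_mul, this.eq]

/-- The embedding of the one-site operators as a linear map. -/
def siteLin (i : Fin N) :
    Matrix (Fin d) (Fin d) ℂ →ₗ[ℂ] Matrix (Fin N → Fin d) (Fin N → Fin d) ℂ where
  toFun := siteOp i
  map_add' A B := by
    ext s t
    simp only [siteOp, Matrix.of_apply, Matrix.add_apply]
    split_ifs <;> simp
  map_smul' c A := by
    ext s t
    simp only [siteOp, Matrix.of_apply, Matrix.smul_apply, RingHom.id_apply]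
    split_ifs <;> simp

lemma siteOp_sum {α : Type*} (i : Fin N) (s : Finset α) (A : α → Matrix (Fin d) (Fin d) ℂ) :
    siteOp i (∑ a ∈ s, A a) = ∑ a ∈ s, siteOp i (A a) :=
  map_sum (siteLin i) A s

lemma siteOp_smul (i : Fin N) (c : ℂ) (A : Matrix (Fin d) (Fin d) ℂ) :
    siteOp i (c • A) = c • siteOp i A :=
  map_smul (siteLin i) c A

lemma siteOp_sub (i : Fin N) (A B : Matrix (Fin d) (Fin d) ℂ) :
    siteOp i (A - B) = siteOp i A - siteOp i B :=
  map_sub (siteLin i) A B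

lemma siteOp_neg (i : Fin N) (A : Matrix (Fin d) (Fin d) ℂ) :
    siteOp i (-A) = -siteOp i A :=
  map_neg (siteLin i) A

lemma tensorPow_mul_siteOp (i : Fin N) {V A B : Matrix (Fin d) (Fin d) ℂ} (h : V * A = B * V) :
    tensorPow N V * siteOp i A = siteOp i B * tensorPow N V := by
  rw [tensorPow_eq_tensorFam, siteOp_eq_tensorFam, siteOp_eq_tensorFam, ← map_mul, ← map_mul]
  congr 1
  ext1 k
  by_cases hk : k = i
  · subst hk
    simpa using h
  · simp [Pi.mulSingle_eq_of_ne hk]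

lemma siteOp_posSemidef (i : Fin N) {A : Matrix (Fin d) (Fin d) ℂ} (hA : A.PosSemidef) :
    (siteOp i A).PosSemidef := by
  have h := Matrix.posSemidef_conjTranspose_mul_self (siteOp i (matSqrt A))
  rwa [siteOp_conjTranspose, (matSqrt_posSemidef hA).isHermitian.eq, ← siteOp_mul,
    matSqrt_mul_self hA] at h

/-- The collective operator `∑ᵢ Aᵢ`. -/
def totalOp (N : ℕ) (A : Matrix (Fin d) (Fin d) ℂ) :
    Matrix (Fin N → Fin d) (Fin N → Fin d) ℂ := ∑ i, siteOp i A

lemma totalOp_conjTranspose (A : Matrix (Fin d) (Fin d) ℂ) :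
    (totalOp N A)ᴴ = totalOp N Aᴴ := by
  simp only [totalOp, Matrix.conjTranspose_sum, siteOp_conjTranspose]

lemma totalOp_smul (c : ℂ) (A : Matrix (Fin d) (Fin d) ℂ) :
    totalOp N (c • A) = c • totalOp N A := by
  simp only [totalOp, siteOp_smul, Finset.smul_sum]

lemma totalOp_neg (A : Matrix (Fin d) (Fin d) ℂ) :
    totalOp N (-A) = -totalOp N A := by
  simp only [totalOp, siteOp_neg, Finset.sum_neg_distrib]

lemma totalOp_sub (A B : Matrix (Fin d) (Fin d) ℂ) :
    totalOp N (A - B) = totalOp N A - totalOp N B := by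
  simp only [totalOp, siteOp_sub, Finset.sum_sub_distrib]

lemma totalOp_sum {α : Type*} (s : Finset α) (A : α → Matrix (Fin d) (Fin d) ℂ) :
    totalOp N (∑ a ∈ s, A a) = ∑ a ∈ s, totalOp N (A a) := by
  simp only [totalOp, siteOp_sum]
  exact Finset.sum_comm

lemma totalOp_one : totalOp N (1 : Matrix (Fin d) (Fin d) ℂ) = (N : ℂ) • 1 := by
  simp only [totalOp, siteOp_one, Finset.sum_const, Finset.card_univ, Fintype.card_fin]
  rw [Nat.cast_smul_eq_nsmul]

/-- Operators on different sites commute, so only the terms with equal sites survive. -/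
lemma totalOp_commutator (A B : Matrix (Fin d) (Fin d) ℂ) :
    totalOp N A * totalOp N B - totalOp N B * totalOp N A = totalOp N (A * B - B * A) := by
  have h : ∀ i : Fin N, ∑ j, (siteOp i A * siteOp j B - siteOp j B * siteOp i A)
      = siteOp i (A * B - B * A) := by
    intro i
    rw [Finset.sum_eq_single i]
    · rw [siteOp_sub, siteOp_mul, siteOp_mul]
    · intro j _ hj
      rw [(siteOp_commute hj.symm A B).eq, sub_self]
    · simp
  simp only [totalOp, Finset.sum_mul_sum]
  rw [Finset.sum_comm (f := fun i j => siteOp i B * siteOp j A), ← Finset.sum_sub_distrib]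
  refine Finset.sum_congr rfl fun i _ => ?_
  rw [← Finset.sum_sub_distrib, h]

lemma totalOp_mul_totalOp (A B : Matrix (Fin d) (Fin d) ℂ) :
    totalOp N A * totalOp N B
      = totalOp N (A * B) + ∑ i, ∑ j ∈ Finset.univ.erase i, siteOp i A * siteOp j B := by
  simp only [totalOp, Finset.sum_mul_sum]
  rw [← Finset.sum_add_distrib]
  refine Finset.sum_congr rfl fun i _ => ?_
  rw [← Finset.add_sum_erase _ _ (Finset.mem_univ i), siteOp_mul]

end TensorAlgebra

/-! ### Permutations of the sites. -/

section Permutations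

variable {d N : ℕ}

/-- The action of a permutation of the sites on the product basis. -/
def siteEquiv (d : ℕ) (σ : Equiv.Perm (Fin N)) : (Fin N → Fin d) ≃ (Fin N → Fin d) :=
  Equiv.arrowCongr σ (Equiv.refl _)

lemma siteEquiv_apply (σ : Equiv.Perm (Fin N)) (s : Fin N → Fin d) (i : Fin N) :
    siteEquiv d σ s i = s (σ.symm i) := rfl

lemma tensorPow_submatrix (σ : Equiv.Perm (Fin N)) (A : Matrix (Fin d) (Fin d) ℂ) :
    (tensorPow N A).submatrix (siteEquiv d σ) (siteEquiv d σ) = tensorPow N A := by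
  ext s t
  simp only [tensorPow, Matrix.submatrix_apply, Matrix.of_apply, siteEquiv_apply]
  exact Equiv.prod_comp σ.symm fun i => A (s i) (t i)

lemma siteOp_submatrix (σ : Equiv.Perm (Fin N)) (i : Fin N) (A : Matrix (Fin d) (Fin d) ℂ) :
    (siteOp (σ i) A).submatrix (siteEquiv d σ) (siteEquiv d σ) = siteOp i A := by
  ext s t
  simp only [siteOp, Matrix.submatrix_apply, Matrix.of_apply, siteEquiv_apply,
    Equiv.symm_apply_apply]
  congr 1
  refine propext ⟨fun h k hk => ?_, fun h k hk => h _ fun h' => hk (by simp [← h'])⟩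
  have := h (σ k) fun h' => hk (σ.injective h')
  simpa using this

lemma quadOp_submatrix {A : Type*} [Fintype A] (σ : Equiv.Perm (Fin N))
    (O : A → Matrix (Fin d) (Fin d) ℂ) (i j : Fin N) :
    (quadOp O (σ i) (σ j)).submatrix (siteEquiv d σ) (siteEquiv d σ) = quadOp O i j := by
  have h : (quadOp O (σ i) (σ j)).submatrix (siteEquiv d σ) (siteEquiv d σ)
      = ∑ α, (siteOp (σ i) (O α) * siteOp (σ j) (O α)ᴴ).submatrix (siteEquiv d σ)
        (siteEquiv d σ) := by
    ext s t
    simp [quadOp, Matrix.sum_apply]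
  rw [h]
  refine Finset.sum_congr rfl fun α _ => ?_
  rw [← Matrix.submatrix_mul_equiv _ _ _ (siteEquiv d σ), siteOp_submatrix, siteOp_submatrix]

lemma trace_submatrix_equiv {ι κ : Type*} [Fintype ι] [Fintype κ] (e : κ ≃ ι)
    (A : Matrix ι ι ℂ) : (A.submatrix e e).trace = A.trace := by
  simp only [Matrix.trace, Matrix.diag, Matrix.submatrix_apply]
  exact Equiv.sum_comp e fun i => A i i

lemma exists_perm_map_pair {i j k l : Fin N} (h : i ≠ j) (h' : k ≠ l) :
    ∃ σ : Equiv.Perm (Fin N), σ i = k ∧ σ j = l := by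
  -- The first swap sends i to k; the second sends the image of j to l and fixes k, which differs
  -- from both.
  refine ⟨(Equiv.swap i k).trans (Equiv.swap ((Equiv.swap i k) j) l), ?_, ?_⟩
  · simp only [Equiv.trans_apply, Equiv.swap_apply_left]
    refine Equiv.swap_apply_of_ne_of_ne (fun hk => h ?_) h'
    apply (Equiv.swap i k).injective
    rw [Equiv.swap_apply_left]
    exact hk
  · simp

end Permutations

/-! ### Splitting two sites off from the others. -/

section Pairs

open scoped ComplexOrder MatrixOrder Kronecker

variable {d N : ℕ}

/-- An enumeration of the sites that starts with `i` and `j`. -/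
def pairIndex {i j : Fin N} (h : i ≠ j) : Fin 2 ⊕ Fin (N - 2) ≃ Fin N :=
  have hf : Function.Injective ![i, j] := by
    intro a b
    fin_cases a <;> fin_cases b <;> simp [h, h.symm]
  have hc : Fintype.card ((Set.range ![i, j])ᶜ : Set (Fin N)) = N - 2 := by
    classical
    rw [Fintype.card_compl_set, Set.card_range_of_injective hf]
    simp
  (Equiv.sumCongr (Equiv.ofInjective _ hf) (Fintype.equivFinOfCardEq hc).symm).trans
    (Equiv.Set.sumCompl _)

lemma pairIndex_inl {i j : Fin N} (h : i ≠ j) (a : Fin 2) : pairIndex h (Sum.inl a) = ![i, j] a := by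
  simp only [pairIndex, Equiv.trans_apply, Equiv.sumCongr_apply, Sum.map_inl]
  rfl

/-- The product basis of `N` qudits as the product basis of two qudits and the remaining ones. -/
def pairEquiv (d : ℕ) {i j : Fin N} (h : i ≠ j) :
    (Fin N → Fin d) ≃ (Fin 2 → Fin d) × (Fin (N - 2) → Fin d) :=
  (Equiv.arrowCongr (pairIndex h).symm (Equiv.refl _)).trans
    (Equiv.sumArrowEquivProdArrow _ _ _)

lemma pairEquiv_fst {i j : Fin N} (h : i ≠ j) (s : Fin N → Fin d) :
    (pairEquiv d h s).1 = ![s i, s j] := by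
  ext1 a
  change s (pairIndex h (Sum.inl a)) = _
  rw [pairIndex_inl]
  fin_cases a <;> rfl

lemma pairOp_eq_kronecker {i j : Fin N} (h : i ≠ j)
    (B : Matrix (Fin 2 → Fin d) (Fin 2 → Fin d) ℂ) :
    pairOp i j B = (B ⊗ₖ (1 : Matrix (Fin (N - 2) → Fin d) (Fin (N - 2) → Fin d) ℂ)).submatrix
      (pairEquiv d h) (pairEquiv d h) := by
  ext s t
  simp only [pairOp, Matrix.of_apply, Matrix.submatrix_apply, Matrix.kroneckerMap_apply,
    Matrix.one_apply, mul_ite, mul_one, mul_zero, pairEquiv_fst]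
  congr 1
  refine propext ⟨fun H => ?_, fun H k hi hj => ?_⟩
  · ext1 b
    have hb : ∀ a, pairIndex h (Sum.inr b) ≠ ![i, j] a := by
      intro a ha
      rw [← pairIndex_inl h] at ha
      simpa using (pairIndex h).injective ha
    exact H _ (hb 0) (hb 1)
  · obtain ⟨x, rfl⟩ := (pairIndex h).surjective k
    rcases x with a | b
    · rw [pairIndex_inl] at hi hj
      fin_cases a
      · exact absurd rfl hi
      · exact absurd rfl hj
    · exact congrFun H b

lemma tensorPow_eq_kronecker {i j : Fin N} (h : i ≠ j) (A : Matrix (Fin d) (Fin d) ℂ) :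
    tensorPow N A = (tensorPow 2 A ⊗ₖ tensorPow (N - 2) A).submatrix
      (pairEquiv d h) (pairEquiv d h) := by
  ext s t
  simp only [tensorPow, Matrix.of_apply, Matrix.submatrix_apply, Matrix.kroneckerMap_apply]
  rw [← Equiv.prod_comp (pairIndex h), Fintype.prod_sum_type]
  rfl

/-- The embedding of the two-site operators as a homomorphism of algebras. -/
def pairAlg {i j : Fin N} (h : i ≠ j) : Matrix (Fin 2 → Fin d) (Fin 2 → Fin d) ℂ →ₐ[ℂ]
    Matrix (Fin N → Fin d) (Fin N → Fin d) ℂ :=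
  AlgHom.ofLinearMap
    { toFun := fun B => pairOp i j B
      map_add' := fun A B => by
        ext s t
        simp only [pairOp, Matrix.of_apply, Matrix.add_apply]
        split_ifs <;> simp
      map_smul' := fun c A => by
        ext s t
        simp only [pairOp, Matrix.of_apply, Matrix.smul_apply, RingHom.id_apply]
        split_ifs <;> simp }
    (by
      change pairOp i j 1 = 1
      rw [pairOp_eq_kronecker h, Matrix.one_kronecker_one, Matrix.submatrix_one_equiv])
    (fun A B => by
      change pairOp i j (A * B) = pairOp i j A * pairOp i j B
      rw [pairOp_eq_kronecker h, pairOp_eq_kronecker h, pairOp_eq_kronecker h,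
        Matrix.submatrix_mul_equiv, ← Matrix.mul_kronecker_mul, one_mul])

lemma pairAlg_apply {i j : Fin N} (h : i ≠ j) (B : Matrix (Fin 2 → Fin d) (Fin 2 → Fin d) ℂ) :
    pairAlg h B = pairOp i j B := rfl

lemma pairAlg_conjTranspose {i j : Fin N} (h : i ≠ j)
    (B : Matrix (Fin 2 → Fin d) (Fin 2 → Fin d) ℂ) : (pairAlg h B)ᴴ = pairAlg h Bᴴ := by
  rw [pairAlg_apply, pairAlg_apply, pairOp_eq_kronecker h, pairOp_eq_kronecker h,
    Matrix.conjTranspose_submatrix, Matrix.conjTranspose_kronecker, Matrix.conjTranspose_one]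

lemma pairAlg_posSemidef {i j : Fin N} (h : i ≠ j)
    {B : Matrix (Fin 2 → Fin d) (Fin 2 → Fin d) ℂ} (hB : B.PosSemidef) :
    (pairAlg h B).PosSemidef := by
  have h' := Matrix.posSemidef_conjTranspose_mul_self (pairAlg h (matSqrt B))
  rwa [pairAlg_conjTranspose, (matSqrt_posSemidef hB).isHermitian.eq, ← map_mul,
    matSqrt_mul_self hB] at h'

/-- The embedding is a *-homomorphism preserving positivity, so it commutes with absolute values.
Constants attached to |Q| can therefore be found on two qudits, once for all N. -/
lemma matAbs_pairAlg {i j : Fin N} (h : i ≠ j) (B : Matrix (Fin 2 → Fin d) (Fin 2 → Fin d) ℂ) :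
    matAbs (pairAlg h B) = pairAlg h (matAbs B) := by
  refine matSqrt_unique (pairAlg_posSemidef h (matAbs_posSemidef B)) ?_
  rw [← map_mul, matAbs_mul_self, pairAlg_conjTranspose, map_mul]

lemma pairAlg_siteOp_zero {i j : Fin N} (h : i ≠ j) (A : Matrix (Fin d) (Fin d) ℂ) :
    pairAlg h (siteOp 0 A) = siteOp i A := by
  rw [pairAlg_apply]
  ext s t
  simp only [pairOp, siteOp, Matrix.of_apply, Fin.forall_fin_two, Matrix.cons_val_zero,
    Matrix.cons_val_one, ne_eq, not_true_eq_false, false_imp_iff, true_and, Fin.one_eq_zero_iff,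
    OfNat.ofNat_ne_one, not_false_eq_true, true_imp_iff]
  by_cases H : ∀ k, ¬k = i → s k = t k
  · rw [if_pos H, if_pos fun k hk _ => H k hk]
    exact if_pos (H j h.symm)
  · by_cases H1 : ∀ k, ¬k = i → ¬k = j → s k = t k
    · rw [if_neg H, if_pos H1]
      refine (if_neg fun H2 => H fun k hk => ?_)
      by_cases hj : k = j
      · rw [hj, H2]
      · exact H1 k hk hj
    · rw [if_neg H, if_neg H1]

lemma pairAlg_siteOp_one {i j : Fin N} (h : i ≠ j) (A : Matrix (Fin d) (Fin d) ℂ) :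
    pairAlg h (siteOp 1 A) = siteOp j A := by
  rw [pairAlg_apply]
  ext s t
  simp only [pairOp, siteOp, Matrix.of_apply, Fin.forall_fin_two, Matrix.cons_val_zero,
    Matrix.cons_val_one, ne_eq, not_true_eq_false, false_imp_iff, and_true, zero_ne_one,
    not_false_eq_true, true_imp_iff]
  by_cases H : ∀ k, ¬k = j → s k = t k
  · rw [if_pos H, if_pos fun k _ hk => H k hk]
    exact if_pos (H i h)
  · by_cases H1 : ∀ k, ¬k = i → ¬k = j → s k = t k
    · rw [if_neg H, if_pos H1]
      refine (if_neg fun H2 => H fun k hk => ?_)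
      by_cases hi : k = i
      · rw [hi, H2]
      · exact H1 k hi hk
    · rw [if_neg H, if_neg H1]

lemma pairAlg_quadOp {A : Type*} [Fintype A] {i j : Fin N} (h : i ≠ j)
    (O : A → Matrix (Fin d) (Fin d) ℂ) :
    pairAlg h (quadOp O 0 1) = quadOp O i j := by
  simp only [quadOp, map_sum, map_mul, pairAlg_siteOp_zero, pairAlg_siteOp_one]

end Pairs

/-! ### Projectors of sectors, their symmetries and the fidelity correlator. -/

section Sectors

open scoped ComplexOrder MatrixOrder

variable {G : Type*} [Group G] {ι κ : Type*} [Fintype ι] [DecidableEq ι]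
  [Fintype κ] [DecidableEq κ]

lemma coe_map_inv (W : G →* Matrix.unitaryGroup ι ℂ) (g : G) :
    ((W g⁻¹ : Matrix.unitaryGroup ι ℂ) : Matrix ι ι ℂ) = (W g : Matrix ι ι ℂ)ᴴ := by
  rw [map_inv]
  rfl

lemma coe_mul_conjTranspose (V : Matrix.unitaryGroup ι ℂ) :
    (V : Matrix ι ι ℂ) * (V : Matrix ι ι ℂ)ᴴ = 1 :=
  Matrix.mem_unitaryGroup_iff.mp V.2

lemma conjTranspose_mul_coe (V : Matrix.unitaryGroup ι ℂ) :
    (V : Matrix ι ι ℂ)ᴴ * (V : Matrix ι ι ℂ) = 1 :=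
  Matrix.mem_unitaryGroup_iff'.mp V.2

lemma commute_conjTranspose_rep {W : G →* Matrix.unitaryGroup ι ℂ} {A : Matrix ι ι ℂ}
    (h : ∀ g, Commute A (W g)) (g : G) : Commute Aᴴ (W g : Matrix ι ι ℂ) := by
  have := congrArg Matrix.conjTranspose (h g⁻¹).eq
  rw [Matrix.conjTranspose_mul, Matrix.conjTranspose_mul, coe_map_inv,
    Matrix.conjTranspose_conjTranspose] at this
  exact this.symm

/-- The intertwining map given by an intertwining matrix. -/
def intertwiner {W : G →* Matrix.unitaryGroup ι ℂ} {J : G →* Matrix.unitaryGroup κ ℂ}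
    (T : Matrix ι κ ℂ) (h : ∀ g, T * (J g : Matrix κ κ ℂ) = (W g : Matrix ι ι ℂ) * T) :
    Representation.IntertwiningMap (toRep J) (toRep W) :=
  { Matrix.toEuclideanLin T with
    isIntertwining' := fun g => by
      rw [toRep_apply, toRep_apply]
      have := congrArg Matrix.toEuclideanLin (h g)
      rwa [Matrix.toLpLin_mul_same, Matrix.toLpLin_mul_same] at this }

lemma intertwiner_toLinearMap {W : G →* Matrix.unitaryGroup ι ℂ} {J : G →* Matrix.unitaryGroup κ ℂ}
    (T : Matrix ι κ ℂ) (h : ∀ g, T * (J g : Matrix κ κ ℂ) = (W g : Matrix ι ι ℂ) * T) :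
    (intertwiner T h).toLinearMap = Matrix.toEuclideanLin T := rfl

/-- The matrix of an intertwining map. -/
def intertwinerMatrix {W : G →* Matrix.unitaryGroup ι ℂ} {J : G →* Matrix.unitaryGroup κ ℂ}
    (T : Representation.IntertwiningMap (toRep J) (toRep W)) : Matrix ι κ ℂ :=
  Matrix.toEuclideanLin.symm T.toLinearMap

lemma toEuclideanLin_intertwinerMatrix {W : G →* Matrix.unitaryGroup ι ℂ}
    {J : G →* Matrix.unitaryGroup κ ℂ}
    (T : Representation.IntertwiningMap (toRep J) (toRep W)) :
    Matrix.toEuclideanLin (intertwinerMatrix T) = T.toLinearMap :=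
  LinearEquiv.apply_symm_apply _ _

lemma intertwinerMatrix_mul {W : G →* Matrix.unitaryGroup ι ℂ} {J : G →* Matrix.unitaryGroup κ ℂ}
    (T : Representation.IntertwiningMap (toRep J) (toRep W)) (g : G) :
    intertwinerMatrix T * (J g : Matrix κ κ ℂ) = (W g : Matrix ι ι ℂ) * intertwinerMatrix T := by
  apply Matrix.toEuclideanLin.injective
  rw [Matrix.toLpLin_mul_same, Matrix.toLpLin_mul_same, toEuclideanLin_intertwinerMatrix]
  exact T.isIntertwining' g

/-- Composing a copy of J with an operator that commutes with the group gives another intertwiner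
from J. -/
lemma apply_mem_sector {W : G →* Matrix.unitaryGroup ι ℂ} (J : G →* Matrix.unitaryGroup κ ℂ)
    {A : Matrix ι ι ℂ} (h : ∀ g, Commute A (W g)) {v : EuclideanSpace ℂ ι} (hv : v ∈ sector W J) :
    Matrix.toEuclideanLin A v ∈ sector W J := by
  suffices h' : sector W J ≤ (sector W J).comap (Matrix.toEuclideanLin A) from h' hv
  refine iSup_le fun T => ?_
  rintro _ ⟨x, rfl⟩
  rw [Submodule.mem_comap]
  have hT : ∀ g, A * intertwinerMatrix T * (J g : Matrix κ κ ℂ)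
      = (W g : Matrix ι ι ℂ) * (A * intertwinerMatrix T) := by
    intro g
    rw [Matrix.mul_assoc, intertwinerMatrix_mul, ← Matrix.mul_assoc, (h g).eq, Matrix.mul_assoc]
  refine (le_iSup (fun T : Representation.IntertwiningMap (toRep J) (toRep W) =>
    LinearMap.range T.toLinearMap) (intertwiner _ hT)) ⟨x, ?_⟩
  rw [intertwiner_toLinearMap, toEuclideanLin_mul_apply, toEuclideanLin_intertwinerMatrix]

/-- The projector of a sector commutes with the commutant of the representation. -/
lemma sector_commute {W : G →* Matrix.unitaryGroup ι ℂ} (J : G →* Matrix.unitaryGroup κ ℂ)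
    {A : Matrix ι ι ℂ} (h : ∀ g, Commute A (W g)) : Commute (projMatrix (sector W J)) A :=
  projMatrix_commute _ (fun _ hv => apply_mem_sector J h hv)
    fun _ hv => apply_mem_sector J (commute_conjTranspose_rep h) hv

lemma mem_invSector_iff {W : G →* Matrix.unitaryGroup ι ℂ} {v : EuclideanSpace ℂ ι} :
    v ∈ invSector W ↔ ∀ g, Matrix.toEuclideanLin (W g : Matrix ι ι ℂ) v = v := Iff.rfl

lemma rep_mul_invSector (W : G →* Matrix.unitaryGroup ι ℂ) (g : G) :
    (W g : Matrix ι ι ℂ) * projMatrix (invSector W) = projMatrix (invSector W) := by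
  have := (mul_projMatrix_eq_iff (invSector W) (A := (W g : Matrix ι ι ℂ)) (B := 1)).mpr
    fun v hv => by
      rw [mem_invSector_iff.mp hv]
      simp
  rwa [one_mul] at this

lemma maxMixed_invSector_strong (W : G →* Matrix.unitaryGroup ι ℂ) :
    IsStronglySymmetric W (maxMixed (invSector W)) := by
  refine ⟨1, fun g => ?_⟩
  rw [maxMixed, mul_smul_comm, rep_mul_invSector]
  simp

variable {d N : ℕ}

lemma coe_tensorRep (U : G →* Matrix.unitaryGroup (Fin d) ℂ) (g : G) :
    ((tensorRep U N g : Matrix.unitaryGroup (Fin N → Fin d) ℂ)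
      : Matrix (Fin N → Fin d) (Fin N → Fin d) ℂ) = tensorPow N (U g : Matrix _ _ ℂ) := rfl

/-- Here `(1 : Matrix ι ι ℂ).submatrix e id` is the permutation matrix of `e`, and relabelling both
indices is conjugation by it. -/
lemma submatrix_eq_of_commute {e : ι ≃ ι} {M : Matrix ι ι ℂ}
    (h : Commute M ((1 : Matrix ι ι ℂ).submatrix e id)) : M.submatrix e e = M := by
  have h1 : (1 : Matrix ι ι ℂ).submatrix e id * M = M.submatrix e id := by
    ext s t
    simp [Matrix.mul_apply, Matrix.one_apply]
  have h2 : M * (1 : Matrix ι ι ℂ).submatrix e id = M.submatrix id e.symm := by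
    ext s t
    simp only [Matrix.mul_apply, Matrix.submatrix_apply, Matrix.one_apply, id]
    rw [Finset.sum_eq_single (e.symm t)]
    · simp
    · intro b _ hb
      rw [if_neg, mul_zero]
      exact fun h' => hb (by simp [← h'])
    · simp
  have h3 := h.eq
  rw [h1, h2] at h3
  ext s t
  have := congrFun (congrFun h3 s) (e t)
  simp only [Matrix.submatrix_apply, Equiv.symm_apply_apply, id] at this
  exact this.symm

lemma commute_of_submatrix_eq {e : ι ≃ ι} {M : Matrix ι ι ℂ} (h : M.submatrix e e = M) :
    Commute ((1 : Matrix ι ι ℂ).submatrix e id) M := by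
  have h1 : (1 : Matrix ι ι ℂ).submatrix e id * M = M.submatrix e id := by
    ext s t
    simp [Matrix.mul_apply, Matrix.one_apply]
  have h2 : M * (1 : Matrix ι ι ℂ).submatrix e id = M.submatrix id e.symm := by
    ext s t
    simp only [Matrix.mul_apply, Matrix.submatrix_apply, Matrix.one_apply, id]
    rw [Finset.sum_eq_single (e.symm t)]
    · simp
    · intro b _ hb
      rw [if_neg, mul_zero]
      exact fun h' => hb (by simp [← h'])
    · simp
  change _ = _
  rw [h1, h2]
  ext s t
  have := congrFun (congrFun h s) (e.symm t)
  simpa using this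

/-- Site permutations fix every `tensorPow N A`, so they lie in the commutant of the representation
and hence commute with the sector projector. -/
lemma projMatrix_sector_submatrix (U : G →* Matrix.unitaryGroup (Fin d) ℂ)
    (J : G →* Matrix.unitaryGroup κ ℂ) (σ : Equiv.Perm (Fin N)) :
    (projMatrix (sector (tensorRep U N) J)).submatrix (siteEquiv d σ) (siteEquiv d σ)
      = projMatrix (sector (tensorRep U N) J) :=
  submatrix_eq_of_commute (sector_commute J fun _ =>
    commute_of_submatrix_eq (tensorPow_submatrix σ _))

lemma sectorState_submatrix (U : G →* Matrix.unitaryGroup (Fin d) ℂ)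
    (J : G →* Matrix.unitaryGroup κ ℂ) (σ : Equiv.Perm (Fin N)) :
    (sectorState U N J).submatrix (siteEquiv d σ) (siteEquiv d σ) = sectorState U N J := by
  rw [sectorState, maxMixed, Matrix.submatrix_smul, Pi.smul_apply, Pi.smul_apply,
    projMatrix_sector_submatrix]

lemma mmis_submatrix (U : G →* Matrix.unitaryGroup (Fin d) ℂ) (σ : Equiv.Perm (Fin N)) :
    (mmis U N).submatrix (siteEquiv d σ) (siteEquiv d σ) = mmis U N := by
  rw [mmis_eq_sectorState, sectorState_submatrix]

/-- The quadratic operator of a multiplet is symmetric. -/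
lemma quadOp_commute {A : Type*} [Fintype A] [DecidableEq A]
    {U : G →* Matrix.unitaryGroup (Fin d) ℂ} {O : A → Matrix (Fin d) (Fin d) ℂ}
    (hO : IsMultiplet U O) (i j : Fin N) (g : G) :
    Commute (quadOp O i j) (tensorRep U N g : Matrix (Fin N → Fin d) (Fin N → Fin d) ℂ) := by
  obtain ⟨R, hR⟩ := hO
  set V : Matrix (Fin d) (Fin d) ℂ := (U g : Matrix (Fin d) (Fin d) ℂ) with hV
  set O' : A → Matrix (Fin d) (Fin d) ℂ := fun α => V * O α * Vᴴ with hO'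
  have hVV : Vᴴ * V = 1 := conjTranspose_mul_coe (U g)
  have e1 : ∀ α, V * O α = O' α * V := by
    intro α
    rw [hO', Matrix.mul_assoc, hVV, Matrix.mul_one]
  have e2 : ∀ α, V * (O α)ᴴ = (O' α)ᴴ * V := by
    intro α
    rw [hO']
    simp only [Matrix.conjTranspose_mul, Matrix.conjTranspose_conjTranspose]
    rw [Matrix.mul_assoc, Matrix.mul_assoc, hVV, Matrix.mul_one]
  have h1 : tensorPow N V * quadOp O i j = quadOp O' i j * tensorPow N V := by
    simp only [quadOp, Finset.mul_sum, Finset.sum_mul]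
    refine Finset.sum_congr rfl fun α _ => ?_
    rw [← mul_assoc, tensorPow_mul_siteOp i (e1 α), mul_assoc, tensorPow_mul_siteOp j (e2 α),
      ← mul_assoc]
  -- Unitarity of R: ∑_α R_{αβ} conj(R_{αγ}) = δ_{βγ}.
  have h2 : quadOp O' i j = quadOp O i j := by
    have h3 : ∀ α, O' α = ∑ β, (R g : Matrix A A ℂ) α β • O β := hR g
    simp only [quadOp, h3, Matrix.conjTranspose_sum, Matrix.conjTranspose_smul, siteOp_sum,
      siteOp_smul, Finset.sum_mul_sum, smul_mul_smul_comm]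
    rw [Finset.sum_comm]
    refine Finset.sum_congr rfl fun β _ => ?_
    rw [Finset.sum_comm]
    simp only [← Finset.sum_smul]
    have h4 : ∀ γ, ∑ α, (R g : Matrix A A ℂ) α β * star ((R g : Matrix A A ℂ) α γ)
        = (1 : Matrix A A ℂ) γ β := by
      intro γ
      rw [← conjTranspose_mul_coe (R g), Matrix.mul_apply]
      refine Finset.sum_congr rfl fun α _ => ?_
      rw [Matrix.conjTranspose_apply, mul_comm]
    simp only [h4, Matrix.one_apply, ite_smul, one_smul, zero_smul, Finset.sum_ite_eq',
      Finset.mem_univ, if_true]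
  rw [h2] at h1
  exact h1.symm

lemma quadOp_conjTranspose {A : Type*} [Fintype A] (O : A → Matrix (Fin d) (Fin d) ℂ)
    (i j : Fin N) : (quadOp O i j)ᴴ = quadOp O j i := by
  simp only [quadOp, Matrix.conjTranspose_sum, Matrix.conjTranspose_mul, siteOp_conjTranspose,
    Matrix.conjTranspose_conjTranspose]

lemma fidelityCorr_sectorState {A : Type*} [Fintype A] [DecidableEq A]
    (U : G →* Matrix.unitaryGroup (Fin d) ℂ) (J : G →* Matrix.unitaryGroup κ ℂ)
    {O : A → Matrix (Fin d) (Fin d) ℂ} (hO : IsMultiplet U O) (i j : Fin N) :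
    (fidelityCorr (sectorState U N J) O i j : ℂ)
      = (projMatrix (sector (tensorRep U N) J)).trace⁻¹
        * (projMatrix (sector (tensorRep U N) J)
            * matSqrt (quadOp O i j * (quadOp O i j)ᴴ)).trace :=
  fidelity_maxMixed _ (sector_commute J (quadOp_commute hO i j))

lemma trace_sector_matSqrt_eq {A : Type*} [Fintype A]
    (U : G →* Matrix.unitaryGroup (Fin d) ℂ) (J : G →* Matrix.unitaryGroup κ ℂ)
    (O : A → Matrix (Fin d) (Fin d) ℂ) {i j k l : Fin N} (h : i ≠ j) (h' : k ≠ l) :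
    (projMatrix (sector (tensorRep U N) J) * matSqrt (quadOp O i j * (quadOp O i j)ᴴ)).trace
      = (projMatrix (sector (tensorRep U N) J)
          * matSqrt (quadOp O k l * (quadOp O k l)ᴴ)).trace := by
  obtain ⟨σ, rfl, rfl⟩ := exists_perm_map_pair h h'
  rw [← trace_submatrix_equiv (siteEquiv d σ) (_ * matSqrt (quadOp O (σ i) (σ j) * _)),
    ← Matrix.submatrix_mul_equiv _ _ _ (siteEquiv d σ), projMatrix_sector_submatrix,
    ← matSqrt_submatrix (Matrix.posSemidef_self_mul_conjTranspose _),
    ← Matrix.submatrix_mul_equiv _ _ _ (siteEquiv d σ), ← Matrix.conjTranspose_submatrix,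
    quadOp_submatrix]

/-- Passing from (i, j) to (j, i) replaces Q by its adjoint, and so √(QQ†) by √(Q†Q), without
changing the trace against a permutation-invariant projector. -/
lemma fidelityCorr_sectorState_eq_trace_matAbs {A : Type*} [Fintype A] [DecidableEq A]
    (U : G →* Matrix.unitaryGroup (Fin d) ℂ) (J : G →* Matrix.unitaryGroup κ ℂ)
    {O : A → Matrix (Fin d) (Fin d) ℂ} (hO : IsMultiplet U O) {i j : Fin N} (h : i ≠ j) :
    (fidelityCorr (sectorState U N J) O i j : ℂ)
      = (sectorState U N J * matAbs (quadOp O i j)).trace := by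
  rw [fidelityCorr_sectorState U J hO, trace_sector_matSqrt_eq U J O h h.symm, sectorState,
    maxMixed, smul_mul_assoc, Matrix.trace_smul, smul_eq_mul, matAbs,
    quadOp_conjTranspose, quadOp_conjTranspose]

lemma fidelityCorr_sectorState_congr {A : Type*} [Fintype A] [DecidableEq A]
    (U : G →* Matrix.unitaryGroup (Fin d) ℂ) (J : G →* Matrix.unitaryGroup κ ℂ)
    {O : A → Matrix (Fin d) (Fin d) ℂ} (hO : IsMultiplet U O) {i j k l : Fin N} (h : i ≠ j)
    (h' : k ≠ l) :
    fidelityCorr (sectorState U N J) O i j = fidelityCorr (sectorState U N J) O k l := by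
  have := fidelityCorr_sectorState U J hO i j
  rw [trace_sector_matSqrt_eq U J O h h', ← fidelityCorr_sectorState U J hO k l] at this
  exact_mod_cast this

/-- With S = √(QQ†), the trace of PS vanishes only if PS = 0, and PS = 0 is equivalent to PQ = 0
because PS(PS)† = PQ(PQ)†. -/
lemma fidelityCorr_sectorState_pos_iff {A : Type*} [Fintype A] [DecidableEq A]
    (U : G →* Matrix.unitaryGroup (Fin d) ℂ) (J : G →* Matrix.unitaryGroup κ ℂ)
    {O : A → Matrix (Fin d) (Fin d) ℂ} (hO : IsMultiplet U O)
    (hJ : sector (tensorRep U N) J ≠ ⊥) (i j : Fin N) :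
    0 < fidelityCorr (sectorState U N J) O i j ↔
      projMatrix (sector (tensorRep U N) J) * quadOp O i j ≠ 0 := by
  set P := projMatrix (sector (tensorRep U N) J) with hP
  set Q := quadOp O i j with hQ
  have hS := matSqrt_posSemidef (Matrix.posSemidef_self_mul_conjTranspose Q)
  have hF := fidelityCorr_sectorState U J hO i j
  rw [← hP, ← hQ] at hF
  have hn : (0 : ℂ) ≤ (fidelityCorr (sectorState U N J) O i j : ℂ) := by
    rw [hF]
    exact mul_nonneg (inv_nonneg.mpr (projMatrix_posSemidef _).trace_nonneg)
      (trace_mul_posSemidef (projMatrix_posSemidef _) hS)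
  have hn' : 0 ≤ fidelityCorr (sectorState U N J) O i j := by exact_mod_cast hn
  rw [lt_iff_le_and_ne, and_iff_right hn', not_iff_not.symm, not_not, not_not, eq_comm,
    ← Complex.ofReal_eq_zero, hF, mul_eq_zero, inv_eq_zero,
    or_iff_right (trace_projMatrix_ne_zero hJ),
    trace_mul_posSemidef_eq_zero_iff (projMatrix_isHermitian _) (projMatrix_mul_self _) hS]
  constructor
  · intro h
    have h1 : P * Q * (P * Q)ᴴ = 0 := by
      rw [Matrix.conjTranspose_mul, mul_assoc, ← mul_assoc Q,
        ← matSqrt_mul_self (Matrix.posSemidef_self_mul_conjTranspose Q), ← mul_assoc, ← mul_assoc,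
        h, zero_mul, zero_mul]
    exact Matrix.self_mul_conjTranspose_eq_zero.mp h1
  · intro h
    have h1 : P * matSqrt (Q * Qᴴ) * (P * matSqrt (Q * Qᴴ))ᴴ = 0 := by
      rw [Matrix.conjTranspose_mul, hS.isHermitian.eq, mul_assoc, ← mul_assoc (matSqrt _),
        matSqrt_mul_self (Matrix.posSemidef_self_mul_conjTranspose Q), ← mul_assoc, ← mul_assoc,
        h, zero_mul, zero_mul]
    exact Matrix.self_mul_conjTranspose_eq_zero.mp h1

end Sectors

/-! ### Correlators in permutation-invariant singlet states. -/

section Correlators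

open scoped ComplexOrder MatrixOrder

variable {d N : ℕ} {A : Type*} [Fintype A]

/-- The variance of B in the state ρ is nonnegative. -/
lemma trace_mul_mul_self_ge {ι : Type*} [Fintype ι] [DecidableEq ι] {ρ B : Matrix ι ι ℂ}
    (hρ : ρ.PosSemidef) (ht : ρ.trace = 1) (hB : B.IsHermitian) :
    (ρ * B).trace.re ^ 2 ≤ (ρ * (B * B)).trace.re := by
  set x : ℝ := (ρ * B).trace.re with hx
  have hC : (B - (x : ℂ) • (1 : Matrix ι ι ℂ))ᴴ = B - (x : ℂ) • (1 : Matrix ι ι ℂ) := by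
    rw [Matrix.conjTranspose_sub, hB.eq, Matrix.conjTranspose_smul, Matrix.conjTranspose_one]
    simp
  have h := trace_mul_posSemidef hρ
    (Matrix.posSemidef_conjTranspose_mul_self (B - (x : ℂ) • (1 : Matrix ι ι ℂ)))
  rw [hC] at h
  have h1 : ρ * ((B - (x : ℂ) • (1 : Matrix ι ι ℂ)) * (B - (x : ℂ) • (1 : Matrix ι ι ℂ)))
      = ρ * (B * B) - (2 * x : ℂ) • (ρ * B) + (x ^ 2 : ℂ) • ρ := by
    simp only [mul_sub, sub_mul, smul_mul_assoc, mul_smul_comm, one_mul, mul_one, smul_smul,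
      smul_sub]
    module
  rw [h1, Matrix.trace_add, Matrix.trace_sub, Matrix.trace_smul, Matrix.trace_smul, ht] at h
  have h2 := (Complex.nonneg_iff.mp h).1
  have h3 : ((2 * x : ℂ) • (ρ * B).trace).re = 2 * x * x := by
    rw [smul_eq_mul]
    have : (2 * (x : ℂ)) = ((2 * x : ℝ) : ℂ) := by push_cast; rfl
    rw [this, Complex.re_ofReal_mul]
  have h4 : ((x ^ 2 : ℂ) • (1 : ℂ)).re = x ^ 2 := by
    rw [smul_eq_mul, mul_one, ← Complex.ofReal_pow, Complex.ofReal_re]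
  rw [Complex.add_re, Complex.sub_re, h3, h4] at h2
  nlinarith

/-- The operator `∑_α A_{i,α} B_{j,α}`. -/
def bilinearOp (B C : A → Matrix (Fin d) (Fin d) ℂ) (i j : Fin N) :
    Matrix (Fin N → Fin d) (Fin N → Fin d) ℂ :=
  ∑ α, siteOp i (B α) * siteOp j (C α)

lemma bilinearOp_submatrix (σ : Equiv.Perm (Fin N)) (B C : A → Matrix (Fin d) (Fin d) ℂ)
    (i j : Fin N) :
    (bilinearOp B C (σ i) (σ j)).submatrix (siteEquiv d σ) (siteEquiv d σ)
      = bilinearOp B C i j := by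
  have h : (bilinearOp B C (σ i) (σ j)).submatrix (siteEquiv d σ) (siteEquiv d σ)
      = ∑ α, (siteOp (σ i) (B α) * siteOp (σ j) (C α)).submatrix (siteEquiv d σ)
        (siteEquiv d σ) := by
    ext s t
    simp [bilinearOp, Matrix.sum_apply]
  rw [h]
  refine Finset.sum_congr rfl fun α _ => ?_
  rw [← Matrix.submatrix_mul_equiv _ _ _ (siteEquiv d σ), siteOp_submatrix, siteOp_submatrix]

lemma quadOp_eq_bilinearOp (O : A → Matrix (Fin d) (Fin d) ℂ) (i j : Fin N) :
    quadOp O i j = bilinearOp O (fun α => (O α)ᴴ) i j := rfl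

variable {ρ : Matrix (Fin N → Fin d) (Fin N → Fin d) ℂ}

lemma trace_bilinearOp_congr
    (hσ : ∀ σ : Equiv.Perm (Fin N), ρ.submatrix (siteEquiv d σ) (siteEquiv d σ) = ρ)
    (B C : A → Matrix (Fin d) (Fin d) ℂ) {i j k l : Fin N} (h : i ≠ j) (h' : k ≠ l) :
    (ρ * bilinearOp B C i j).trace = (ρ * bilinearOp B C k l).trace := by
  obtain ⟨σ, rfl, rfl⟩ := exists_perm_map_pair h h'
  rw [← trace_submatrix_equiv (siteEquiv d σ) (ρ * bilinearOp B C (σ i) (σ j)),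
    ← Matrix.submatrix_mul_equiv _ _ _ (siteEquiv d σ), hσ, bilinearOp_submatrix]

/-- In a permutation-invariant state all pairs of distinct sites contribute equally to a product
of collective operators. -/
lemma sum_trace_totalOp_mul
    (hσ : ∀ σ : Equiv.Perm (Fin N), ρ.submatrix (siteEquiv d σ) (siteEquiv d σ) = ρ)
    (B C : A → Matrix (Fin d) (Fin d) ℂ) {i j : Fin N} (h : i ≠ j) :
    ∑ α, (ρ * (totalOp N (B α) * totalOp N (C α))).trace
      = (ρ * totalOp N (∑ α, B α * C α)).trace
        + N * (N - 1) * (ρ * bilinearOp B C i j).trace := by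
  have h1 : ∑ α, totalOp N (B α) * totalOp N (C α)
      = totalOp N (∑ α, B α * C α)
        + ∑ k, ∑ l ∈ Finset.univ.erase k, bilinearOp B C k l := by
    simp only [totalOp_mul_totalOp, Finset.sum_add_distrib, totalOp_sum, bilinearOp]
    congr 1
    rw [Finset.sum_comm]
    refine Finset.sum_congr rfl fun k _ => ?_
    rw [Finset.sum_comm]
  rw [← Matrix.trace_sum, ← Finset.mul_sum, h1, mul_add, Matrix.trace_add, Finset.mul_sum,
    Matrix.trace_sum]
  congr 1
  have h2 : ∀ k : Fin N, (ρ * ∑ l ∈ Finset.univ.erase k, bilinearOp B C k l).trace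
      = ((N : ℂ) - 1) * (ρ * bilinearOp B C i j).trace := by
    intro k
    rw [Finset.mul_sum, Matrix.trace_sum]
    rw [Finset.sum_congr rfl fun l hl =>
      trace_bilinearOp_congr hσ B C (Finset.ne_of_mem_erase hl).symm h]
    rw [Finset.sum_const, Finset.card_erase_of_mem (Finset.mem_univ k), Finset.card_univ,
      Fintype.card_fin, nsmul_eq_mul, Nat.cast_sub (Fin.pos k), Nat.cast_one]
  rw [Finset.sum_congr rfl fun k _ => h2 k, Finset.sum_const, Finset.card_univ, Fintype.card_fin,
    nsmul_eq_mul, mul_assoc]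

lemma one_lt_of_ne {i j : Fin N} (h : i ≠ j) : 1 < N := by
  by_contra hN
  exact h (Fin.ext (by omega))

/-- The linear correlator in a permutation-invariant singlet state. -/
lemma linearCorr_eq
    (hσ : ∀ σ : Equiv.Perm (Fin N), ρ.submatrix (siteEquiv d σ) (siteEquiv d σ) = ρ)
    (ht : ρ.trace = 1) {O : A → Matrix (Fin d) (Fin d) ℂ} {c : ℝ}
    (hO : ∑ α, O α * (O α)ᴴ = (c : ℂ) • 1) (hk : ∀ α, totalOp N (O α)ᴴ * ρ = 0)
    {i j : Fin N} (h : i ≠ j) :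
    linearCorr ρ O i j = ((-(c / ((N : ℝ) - 1)) : ℝ) : ℂ) := by
  -- The left side is zero because the collective operators annihilate ρ; the right side is Nc +
  -- N(N-1)q, with q the linear correlator.
  have h1 := sum_trace_totalOp_mul hσ O (fun α => (O α)ᴴ) h
  have h2 : ∀ α, (ρ * (totalOp N (O α) * totalOp N (O α)ᴴ)).trace = 0 := by
    intro α
    rw [Matrix.trace_mul_comm, mul_assoc, hk, mul_zero, Matrix.trace_zero]
  rw [Finset.sum_eq_zero fun α _ => h2 α, hO, totalOp_smul, totalOp_one, mul_smul_comm,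
    mul_smul_comm, mul_one, Matrix.trace_smul, Matrix.trace_smul, ht] at h1
  rw [linearCorr, quadOp_eq_bilinearOp]
  set q := (ρ * bilinearOp O (fun α => (O α)ᴴ) i j).trace with hq
  have hN := one_lt_of_ne h
  have hN0 : (N : ℂ) ≠ 0 := by exact_mod_cast (by omega : N ≠ 0)
  have hN1 : (N : ℂ) - 1 ≠ 0 := by
    rw [sub_ne_zero]
    exact_mod_cast hN.ne'
  push_cast
  rw [← neg_div, eq_div_iff hN1]
  have h3 : (N : ℂ) * (c + (N - 1) * q) = 0 := by
    simp only [smul_eq_mul, mul_one] at h1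
    linear_combination -h1
  have h4 := (mul_eq_zero.mp h3).resolve_left hN0
  linear_combination h4

/-- A one-site operator whose total annihilates a permutation-invariant state has vanishing
expectation. -/
lemma trace_mul_siteOp_eq_zero
    (hσ : ∀ σ : Equiv.Perm (Fin N), ρ.submatrix (siteEquiv d σ) (siteEquiv d σ) = ρ)
    {B : Matrix (Fin d) (Fin d) ℂ} (hk : totalOp N B * ρ = 0) (i : Fin N) :
    (ρ * siteOp i B).trace = 0 := by
  have h1 : ∀ j, (ρ * siteOp j B).trace = (ρ * siteOp i B).trace := by
    intro j
    rw [← trace_submatrix_equiv (siteEquiv d (Equiv.swap i j)) (ρ * siteOp j B),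
      ← Matrix.submatrix_mul_equiv _ _ _ (siteEquiv d (Equiv.swap i j)), hσ]
    congr 2
    have := siteOp_submatrix (Equiv.swap i j) i B
    rwa [Equiv.swap_apply_left] at this
  have h2 : (ρ * totalOp N B).trace = 0 := by
    rw [Matrix.trace_mul_comm, hk, Matrix.trace_zero]
  rw [totalOp, Finset.mul_sum, Matrix.trace_sum, Finset.sum_congr rfl fun j _ => h1 j,
    Finset.sum_const, Finset.card_univ, Fintype.card_fin, nsmul_eq_mul, mul_eq_zero] at h2
  refine h2.resolve_left ?_
  exact_mod_cast (Fin.pos i).ne'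

lemma quadOp_eq_neg_sum {O : A → Matrix (Fin d) (Fin d) ℂ} (ha : ∀ α, (O α)ᴴ = -O α)
    (i j : Fin N) : quadOp O i j = -∑ α, siteOp i (O α) * siteOp j (O α) := by
  simp only [quadOp, ha, siteOp_neg, mul_neg, Finset.sum_neg_distrib]

/-- Writing the square as a bilinear operator in the products O_α O_β makes `sum_trace_totalOp_mul`
applicable to the second moment. -/
lemma quadOp_mul_self {O : A → Matrix (Fin d) (Fin d) ℂ} (ha : ∀ α, (O α)ᴴ = -O α)
    {i j : Fin N} (h : i ≠ j) :
    quadOp O i j * quadOp O i j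
      = bilinearOp (fun p : A × A => O p.1 * O p.2) (fun p : A × A => O p.1 * O p.2) i j := by
  rw [quadOp_eq_neg_sum ha, neg_mul_neg, Finset.sum_mul_sum, bilinearOp, Fintype.sum_prod_type]
  refine Finset.sum_congr rfl fun α _ => ?_
  refine Finset.sum_congr rfl fun β _ => ?_
  rw [siteOp_mul, siteOp_mul]
  exact (siteOp_commute h.symm _ _).mul_mul_mul_comm _ _

lemma quadOp_isHermitian {O : A → Matrix (Fin d) (Fin d) ℂ} (ha : ∀ α, (O α)ᴴ = -O α)
    {i j : Fin N} (h : i ≠ j) : (quadOp O i j).IsHermitian := by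
  change _ = _
  rw [quadOp_conjTranspose, quadOp_eq_neg_sum ha, quadOp_eq_neg_sum ha]
  congr 1
  refine Finset.sum_congr rfl fun α _ => ?_
  rw [(siteOp_commute h _ _).eq]

/-- In a permutation-invariant singlet state the second moment of `∑_α O_{i,α} O_{j,α}†` does not
vanish in the limit of many sites. -/
lemma trace_quadOp_sq_ge (hρ : ρ.PosSemidef)
    (hσ : ∀ σ : Equiv.Perm (Fin N), ρ.submatrix (siteEquiv d σ) (siteEquiv d σ) = ρ)
    (ht : ρ.trace = 1) {O : A → Matrix (Fin d) (Fin d) ℂ} (ha : ∀ α, (O α)ᴴ = -O α) {c : ℝ}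
    (hO : ∑ α, O α * (O α)ᴴ = (c : ℂ) • 1) (hk : ∀ α, totalOp N (O α) * ρ = 0) {K : ℝ}
    (hK : ((K : ℂ) • (1 : Matrix (Fin d) (Fin d) ℂ)
      - ∑ p : A × A, O p.1 * O p.2 * (O p.1 * O p.2)).PosSemidef)
    {i j : Fin N} (h : i ≠ j) :
    c ^ 2 * N ^ 2 ≤ Fintype.card A *
      (N * K + N * (N - 1) * (ρ * (quadOp O i j * quadOp O i j)).trace.re) := by
  set B : A × A → Matrix (Fin d) (Fin d) ℂ := fun p => O p.1 * O p.2 with hB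
  have hk' : ∀ α, ρ * totalOp N (O α) = 0 := by
    intro α
    have := congrArg Matrix.conjTranspose (hk α)
    rw [Matrix.conjTranspose_mul, hρ.isHermitian.eq, totalOp_conjTranspose, ha, totalOp_neg,
      Matrix.conjTranspose_zero, mul_neg, neg_eq_zero] at this
    exact this
  -- The difference is the total of [O_α, O_β], which is the commutator of two collective operators,
  -- each annihilated by ρ.
  have hswap : ∀ α β, ρ * totalOp N (B (α, β)) = ρ * totalOp N (B (β, α)) := by
    intro α β
    rw [← sub_eq_zero, ← mul_sub, ← totalOp_sub, hB]
    simp only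
    rw [← totalOp_commutator, mul_sub, ← mul_assoc, ← mul_assoc, hk', hk', zero_mul, zero_mul,
      sub_zero]
  have hBstar : ∀ α β, (B (α, β))ᴴ = B (β, α) := by
    intro α β
    simp only [hB, Matrix.conjTranspose_mul, ha, neg_mul_neg]
  -- By `hswap` the left factor may be replaced by the total of B_{βα}, the adjoint of the right
  -- factor, which leaves the mean of a positive operator.
  have hnn : ∀ α β, 0 ≤ (ρ * (totalOp N (B (α, β)) * totalOp N (B (α, β)))).trace.re := by
    intro α β
    rw [← mul_assoc, hswap, mul_assoc, ← hBstar, ← totalOp_conjTranspose]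
    exact (Complex.nonneg_iff.mp
      (trace_mul_posSemidef hρ (Matrix.posSemidef_conjTranspose_mul_self _))).1
  have hdiag : ∀ α, (ρ * totalOp N (B (α, α))).trace.re ^ 2
      ≤ (ρ * (totalOp N (B (α, α)) * totalOp N (B (α, α)))).trace.re := by
    intro α
    refine trace_mul_mul_self_ge hρ ht ?_
    change _ = _
    rw [totalOp_conjTranspose, hBstar]
  have hsum : ∑ α, (ρ * totalOp N (B (α, α))).trace.re = -(c * N) := by
    have h1 : ∑ α, B (α, α) = -((c : ℂ) • (1 : Matrix (Fin d) (Fin d) ℂ)) := by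
      rw [← hO, ← Finset.sum_neg_distrib]
      refine Finset.sum_congr rfl fun α _ => ?_
      rw [ha, mul_neg, neg_neg]
    rw [← Complex.re_sum, ← Matrix.trace_sum, ← Finset.mul_sum, ← totalOp_sum, h1, totalOp_neg,
      totalOp_smul, totalOp_one, mul_neg, mul_smul_comm, mul_smul_comm, mul_one, Matrix.trace_neg,
      Matrix.trace_smul, Matrix.trace_smul, ht]
    simp
  -- Cauchy-Schwarz over the diagonal terms, whose means add up to -cN; the off-diagonal terms are
  -- nonnegative and only enlarge the sum.
  have hcs : (c * N) ^ 2 ≤ Fintype.card A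
      * ∑ p : A × A, (ρ * (totalOp N (B p) * totalOp N (B p))).trace.re := by
    calc (c * N) ^ 2 = (∑ α, (ρ * totalOp N (B (α, α))).trace.re) ^ 2 := by rw [hsum, neg_sq]
      _ ≤ Fintype.card A * ∑ α, (ρ * totalOp N (B (α, α))).trace.re ^ 2 :=
        sq_sum_le_card_mul_sum_sq
      _ ≤ Fintype.card A * ∑ p : A × A, (ρ * (totalOp N (B p) * totalOp N (B p))).trace.re := by
        gcongr
        rw [Fintype.sum_prod_type]
        refine Finset.sum_le_sum fun α _ => (hdiag α).trans ?_
        exact Finset.single_le_sum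
          (f := fun β => (ρ * (totalOp N (B (α, β)) * totalOp N (B (α, β)))).trace.re)
          (fun β _ => hnn α β) (Finset.mem_univ α)
  -- The coincident-site contribution is only of order N, against c²N² on the other side.
  have hone : (ρ * totalOp N (∑ p, B p * B p)).trace.re ≤ N * K := by
    rw [totalOp, Finset.mul_sum, Matrix.trace_sum, Complex.re_sum]
    have h1 : ∀ k : Fin N, (ρ * siteOp k (∑ p, B p * B p)).trace.re ≤ K := by
      intro k
      have h2 := (Complex.nonneg_iff.mp (trace_mul_posSemidef hρ (siteOp_posSemidef k hK))).1
      rw [siteOp_sub, siteOp_smul, siteOp_one, mul_sub, mul_smul_comm, mul_one, Matrix.trace_sub,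
        Matrix.trace_smul, ht, Complex.sub_re] at h2
      simp only [smul_eq_mul, mul_one, Complex.ofReal_re] at h2
      linarith
    calc ∑ k : Fin N, (ρ * siteOp k (∑ p, B p * B p)).trace.re ≤ ∑ _k : Fin N, K :=
          Finset.sum_le_sum fun k _ => h1 k
      _ = N * K := by simp
  have hmain := congrArg Complex.re (sum_trace_totalOp_mul hσ B B h)
  rw [← quadOp_mul_self ha h, Complex.re_sum, Complex.add_re] at hmain
  have h3 : ((N : ℂ) * (N - 1) * (ρ * (quadOp O i j * quadOp O i j)).trace).re
      = N * (N - 1) * (ρ * (quadOp O i j * quadOp O i j)).trace.re := by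
    have : (N : ℂ) * (N - 1) = ((N * (N - 1) : ℝ) : ℂ) := by push_cast; rfl
    rw [this, Complex.re_ofReal_mul]
  rw [h3] at hmain
  rw [← mul_pow]
  refine hcs.trans ?_
  rw [hmain]
  gcongr

/-- Uniform bounds on the fidelity correlator in permutation-invariant singlet states. -/
lemma exists_trace_matAbs_bounds {O : A → Matrix (Fin d) (Fin d) ℂ} (ha : ∀ α, (O α)ᴴ = -O α)
    {c : ℝ} (hc : 0 < c) (hO : ∑ α, O α * (O α)ᴴ = (c : ℂ) • 1) :
    ∃ a b : ℝ, 0 < a ∧ ∀ (N : ℕ) (ρ : Matrix (Fin N → Fin d) (Fin N → Fin d) ℂ),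
      ρ.PosSemidef →
      (∀ σ : Equiv.Perm (Fin N), ρ.submatrix (siteEquiv d σ) (siteEquiv d σ) = ρ) →
      ρ.trace = 1 → (∀ α, totalOp N (O α) * ρ = 0) → ∀ i j : Fin N, i ≠ j →
      a ≤ (ρ * matAbs (quadOp O i j)).trace.re ∧ (ρ * matAbs (quadOp O i j)).trace.re ≤ b := by
  set S : Matrix (Fin 2 → Fin d) (Fin 2 → Fin d) ℂ := matAbs (quadOp O 0 1) with hS
  -- K, b and L are chosen for one or two qudits, before N enters, so the resulting bounds are
  -- uniform in N.
  obtain ⟨K, hK, hKS⟩ := exists_smul_sub_mul_self_posSemidef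
    (matAbs_posSemidef (quadOp O (0 : Fin 2) 1))
  obtain ⟨b, -, hb⟩ := exists_smul_one_sub_posSemidef
    (matAbs_posSemidef (quadOp O (0 : Fin 2) 1)).isHermitian
  have hM : (∑ p : A × A, O p.1 * O p.2 * (O p.1 * O p.2)).IsHermitian := by
    change _ = _
    simp only [Matrix.conjTranspose_sum, Matrix.conjTranspose_mul, ha, neg_mul_neg]
    exact Fintype.sum_equiv (Equiv.prodComm A A) _ _ fun p => rfl
  obtain ⟨L, hL, hLM⟩ := exists_smul_one_sub_posSemidef hM
  set r : ℝ := (Fintype.card A : ℝ) with hr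
  have hr0 : 0 ≤ r := Nat.cast_nonneg _
  -- Beyond N - 1 = M the one-site term of the second-moment bound is less than half of c²N².
  set M : ℝ := 2 * L * r / c ^ 2 + 1 with hMdef
  have hM0 : 0 < M := by positivity
  -- The first entry of the minimum serves large N and the second small N. Using r + 1 rather than r
  -- keeps the denominator positive.
  refine ⟨min (c ^ 2 / (2 * (r + 1))) ((c / M) ^ 2) / K, b, by positivity, ?_⟩
  intro N ρ hρ hσ ht hk i j h
  have habs : matAbs (quadOp O i j) = pairAlg h S := by
    rw [hS, ← matAbs_pairAlg, pairAlg_quadOp]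
  have hherm := quadOp_isHermitian ha h (N := N)
  constructor
  · have h1 : (ρ * (quadOp O i j * quadOp O i j)).trace.re
        ≤ K * (ρ * matAbs (quadOp O i j)).trace.re := by
      have h2 := (Complex.nonneg_iff.mp (trace_mul_posSemidef hρ (pairAlg_posSemidef h hKS))).1
      rw [map_sub, map_smul, map_mul, ← hS, ← habs, matAbs_mul_self, hherm.eq, mul_sub,
        mul_smul_comm, Matrix.trace_sub, Matrix.trace_smul, Complex.sub_re, smul_eq_mul,
        Complex.re_ofReal_mul] at h2
      linarith
    rw [div_le_iff₀ hK, mul_comm _ K]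
    refine le_trans ?_ h1
    set q := (ρ * (quadOp O i j * quadOp O i j)).trace.re with hq
    have hN := one_lt_of_ne h
    have hN1 : (0 : ℝ) < (N : ℝ) - 1 := by
      rw [sub_pos]
      exact_mod_cast hN
    -- For small N the square of the nonzero linear correlator already bounds the second moment from
    -- below.
    have hlin : (c / ((N : ℝ) - 1)) ^ 2 ≤ q := by
      have h2 := trace_mul_mul_self_ge hρ ht hherm
      have h3 := linearCorr_eq hσ ht hO (fun α => by rw [ha, totalOp_neg, neg_mul, hk, neg_zero]) h
      rw [linearCorr] at h3
      rwa [h3, Complex.ofReal_re, neg_sq] at h2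
    have hq0 : 0 ≤ q := le_trans (sq_nonneg _) hlin
    have hsq := trace_quadOp_sq_ge hρ hσ ht ha hO hk hLM h
    rw [← hq, ← hr] at hsq
    by_cases hbig : (N : ℝ) - 1 ≤ M
    · refine (min_le_right _ _).trans (le_trans ?_ hlin)
      gcongr
    · refine (min_le_left _ _).trans ?_
      push Not at hbig
      have hNM : 2 * L * r < c ^ 2 * N := by
        have : 2 * L * r / c ^ 2 < N := by
          rw [hMdef] at hbig
          linarith
        rwa [div_lt_iff₀ (by positivity), mul_comm (N : ℝ)] at this
      have hNpos : (0 : ℝ) < N := by linarith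
      have h4 : c ^ 2 * N ≤ r * (L + (N - 1) * q) := by
        have : N * (c ^ 2 * N) ≤ N * (r * (L + ((N : ℝ) - 1) * q)) := by nlinarith
        exact le_of_mul_le_mul_left this hNpos
      have h5 : c ^ 2 * N < 2 * r * (N * q) := by nlinarith [mul_nonneg hr0 hq0]
      have h6 : c ^ 2 < 2 * r * q := by
        have : N * c ^ 2 < N * (2 * r * q) := by linarith
        exact lt_of_mul_lt_mul_left this hNpos.le
      rw [div_le_iff₀ (by positivity)]
      nlinarith
  · have h2 := (Complex.nonneg_iff.mp (trace_mul_posSemidef hρ (pairAlg_posSemidef h hb))).1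
    rw [map_sub, map_smul, map_one, ← hS, ← habs, mul_sub, mul_smul_comm, mul_one,
      Matrix.trace_sub, Matrix.trace_smul, ht, Complex.sub_re] at h2
    simp only [smul_eq_mul, mul_one, Complex.ofReal_re] at h2
    linarith

end Correlators

/-! ### A criterion for SW-SSB of the maximally mixed invariant state. -/

section MMIS

open scoped ComplexOrder MatrixOrder

variable {d : ℕ} {A : Type*} [Fintype A] [DecidableEq A] {G : Type*} [Group G]
  {U : G →* Matrix.unitaryGroup (Fin d) ℂ}

lemma fidelityCorr_mmis {N : ℕ} {O : A → Matrix (Fin d) (Fin d) ℂ} (hO : IsMultiplet U O)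
    {i j : Fin N} (h : i ≠ j) :
    fidelityCorr (mmis U N) O i j = (mmis U N * matAbs (quadOp O i j)).trace.re := by
  have := fidelityCorr_sectorState_eq_trace_matAbs U (1 : G →* Matrix.unitaryGroup (Fin 1) ℂ) hO h
  rw [← mmis_eq_sectorState] at this
  rw [← this, Complex.ofReal_re]

lemma mul_mmis_eq_zero {N : ℕ} {B : Matrix (Fin N → Fin d) (Fin N → Fin d) ℂ}
    (h : B * projMatrix (invSector (tensorRep U N)) = 0) : B * mmis U N = 0 := by
  rw [mmis, maxMixed, mul_smul_comm, h, smul_zero]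

lemma exists_fidelityCorr_mmis_bounds {O : A → Matrix (Fin d) (Fin d) ℂ}
    (hO : IsMultiplet U O) (ha : ∀ α, (O α)ᴴ = -O α) {c : ℝ} (hc : 0 < c)
    (hcas : ∑ α, O α * (O α)ᴴ = (c : ℂ) • 1)
    (hk : ∀ N α, totalOp N (O α) * projMatrix (invSector (tensorRep U N)) = 0) :
    ∃ a b : ℝ, 0 < a ∧ ∀ N ∈ mmisSizes U, ∀ i j : Fin N, i ≠ j →
      a ≤ fidelityCorr (mmis U N) O i j ∧ fidelityCorr (mmis U N) O i j ≤ b := by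
  obtain ⟨a, b, ha0, hab⟩ := exists_trace_matAbs_bounds ha hc hcas
  refine ⟨a, b, ha0, fun N hN i j h => ?_⟩
  rw [fidelityCorr_mmis hO h]
  exact hab N _ (maxMixed_posSemidef _) (mmis_submatrix U) (maxMixed_trace hN)
    (fun α => mul_mmis_eq_zero (hk N α)) i j h

lemma linearCorr_mmis {N : ℕ} (hN : N ∈ mmisSizes U) {O : A → Matrix (Fin d) (Fin d) ℂ} {c : ℝ}
    (hcas : ∑ α, O α * (O α)ᴴ = (c : ℂ) • 1)
    (hk : ∀ α, totalOp N (O α)ᴴ * projMatrix (invSector (tensorRep U N)) = 0)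
    {i j : Fin N} (h : i ≠ j) :
    linearCorr (mmis U N) O i j = ((-(c / ((N : ℝ) - 1)) : ℝ) : ℂ) :=
  linearCorr_eq (mmis_submatrix U) (maxMixed_trace hN) hcas
    (fun α => mul_mmis_eq_zero (hk α)) h

/-- A charged multiplet with scalar Casimir operator whose total generators annihilate the
invariant vectors detects SW-SSB once its fidelity correlator is bounded below. -/
lemma detectsSWSSB_mmis {O : A → Matrix (Fin d) (Fin d) ℂ} (hS : (mmisSizes U).Infinite)
    (hO : IsMultiplet U O) (hch : IsCharged U O) {c : ℝ}
    (hcas : ∑ α, O α * (O α)ᴴ = (c : ℂ) • 1)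
    (hk : ∀ N α, totalOp N (O α)ᴴ * projMatrix (invSector (tensorRep U N)) = 0) {a : ℝ}
    (ha : 0 < a)
    (hF : ∀ N ∈ mmisSizes U, ∀ i j : Fin N, i ≠ j → a ≤ fidelityCorr (mmis U N) O i j) :
    DetectsSWSSB U (mmisSizes U) (mmis U) O where
  sizes_infinite := hS
  state N hN := ⟨maxMixed_posSemidef _, maxMixed_trace hN⟩
  strong N _ := maxMixed_invSector_strong _
  multiplet := hO
  charged := hch
  fidelity_long_range := ⟨a, ha, 0, fun N hN _ i j h => hF N hN i j h⟩
  linear_decay ε hε := by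
    -- Past this size |c|/(N-1) < ε.
    obtain ⟨N₀, hN₀⟩ := exists_nat_gt (|c| / ε + 1)
    refine ⟨N₀, fun N hN hle i j h => ?_⟩
    rw [linearCorr_mmis hN hcas (hk N) h, Complex.norm_real, norm_neg, norm_div]
    have h1 : |c| / ε + 1 < N := hN₀.trans_le (by exact_mod_cast hle)
    have h2 : 0 ≤ |c| / ε := by positivity
    have h3 : 0 < (N : ℝ) - 1 := by linarith
    rw [Real.norm_eq_abs, Real.norm_eq_abs, abs_of_pos h3, div_lt_iff₀ h3]
    have h4 : |c| / ε < (N : ℝ) - 1 := by linarith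
    rw [div_lt_iff₀ hε] at h4
    linarith

end MMIS

/-! ### Schur's lemma, isotypic sectors and complete reducibility. -/

section Schur

open scoped ComplexOrder MatrixOrder Kronecker

variable {G : Type*} [Group G] {ι κ μ : Type*} [Fintype ι] [DecidableEq ι]
  [Fintype κ] [DecidableEq κ] [Fintype μ] [DecidableEq μ]
  {W : G →* Matrix.unitaryGroup ι ℂ} {J : G →* Matrix.unitaryGroup κ ℂ}

lemma nonempty_of_isIrrep (hW : IsIrrep W) : Nonempty ι := by
  by_contra h
  rw [not_nonempty_iff] at h
  obtain ⟨a, b, hab⟩ := hW.toNontrivial.exists_pair_ne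
  apply hab
  exact Subrepresentation.toSubmodule_injective (Subsingleton.elim _ _)

/-- Schur's lemma: the commutant of an irreducible representation consists of the scalars. -/
lemma exists_eq_smul_one_of_commute (hW : IsIrrep W) {A : Matrix ι ι ℂ}
    (h : ∀ g, Commute A (W g)) : ∃ c : ℂ, A = c • 1 := by
  have : (toRep W).IsIrreducible := hW
  obtain ⟨c, hc⟩ :=
    (Representation.IsIrreducible.algebraMap_intertwiningMap_bijective_of_isAlgClosed
      (k := ℂ) (ρ := toRep W)).2 (intertwiner A fun g => (h g).eq)
  refine ⟨c, ?_⟩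
  apply Matrix.toEuclideanLin.injective
  have h1 := congrArg (fun f => f.toLinearMap) hc
  simp only [intertwiner_toLinearMap] at h1
  rw [← h1, map_smul, Matrix.toLpLin_one]
  ext1 v
  rfl

/-- Taking the trace identifies the scalar of Schur's lemma, so it can be computed or shown to be
positive. -/
lemma eq_trace_smul_one_of_commute (hW : IsIrrep W) {A : Matrix ι ι ℂ}
    (h : ∀ g, Commute A (W g)) : A = (A.trace / Fintype.card ι) • 1 := by
  obtain ⟨c, rfl⟩ := exists_eq_smul_one_of_commute hW h
  have := nonempty_of_isIrrep hW
  congr 1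
  rw [Matrix.trace_smul, Matrix.trace_one, smul_eq_mul, mul_div_assoc, div_self, mul_one]
  exact_mod_cast Fintype.card_ne_zero

/-- The space of matrices intertwining two representations. -/
def intertwinerSpace (W : G →* Matrix.unitaryGroup ι ℂ) (J : G →* Matrix.unitaryGroup κ ℂ) :
    Submodule ℂ (Matrix ι κ ℂ) where
  carrier := {T | ∀ g, T * (J g : Matrix κ κ ℂ) = (W g : Matrix ι ι ℂ) * T}
  add_mem' {A B} hA hB g := by rw [Matrix.add_mul, Matrix.mul_add, hA g, hB g]
  zero_mem' g := by rw [Matrix.zero_mul, Matrix.mul_zero]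
  smul_mem' c A hA g := by rw [Matrix.smul_mul, Matrix.mul_smul, hA g]

lemma mem_intertwinerSpace {T : Matrix ι κ ℂ} :
    T ∈ intertwinerSpace W J ↔ ∀ g, T * (J g : Matrix κ κ ℂ) = (W g : Matrix ι ι ℂ) * T := Iff.rfl

lemma finrank_intertwinerSpace : Module.finrank ℂ (intertwinerSpace W J) = mult W J := by
  refine LinearEquiv.finrank_eq
    { toFun := fun T => intertwiner T.1 T.2
      invFun := fun T => ⟨intertwinerMatrix T, intertwinerMatrix_mul T⟩
      map_add' := fun A B => ?_
      map_smul' := fun c A => ?_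
      left_inv := fun T => ?_
      right_inv := fun T => ?_ }
  · apply Representation.IntertwiningMap.ext
    rw [Representation.IntertwiningMap.add_toLinearMap]
    exact map_add Matrix.toEuclideanLin A.1 B.1
  · apply Representation.IntertwiningMap.ext
    exact map_smul Matrix.toEuclideanLin c A.1
  · exact Subtype.ext (LinearEquiv.symm_apply_apply Matrix.toEuclideanLin T.1)
  · exact Representation.IntertwiningMap.ext (toEuclideanLin_intertwinerMatrix T)

lemma conjTranspose_mem_intertwinerSpace {T : Matrix ι κ ℂ} (hT : T ∈ intertwinerSpace W J) :
    Tᴴ ∈ intertwinerSpace J W := by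
  intro g
  have := congrArg Matrix.conjTranspose (hT g⁻¹)
  rw [Matrix.conjTranspose_mul, Matrix.conjTranspose_mul, coe_map_inv, coe_map_inv,
    Matrix.conjTranspose_conjTranspose, Matrix.conjTranspose_conjTranspose] at this
  exact this.symm

lemma mul_mem_intertwinerSpace {L : G →* Matrix.unitaryGroup μ ℂ} {S : Matrix ι κ ℂ}
    {T : Matrix κ μ ℂ} (hS : S ∈ intertwinerSpace W J) (hT : T ∈ intertwinerSpace J L) :
    S * T ∈ intertwinerSpace W L := by
  intro g
  rw [Matrix.mul_assoc, hT g, ← Matrix.mul_assoc, hS g, Matrix.mul_assoc]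

lemma mem_sector_of_intertwiner {T : Matrix ι κ ℂ} (hT : T ∈ intertwinerSpace W J)
    (v : EuclideanSpace ℂ κ) : Matrix.toEuclideanLin T v ∈ sector W J :=
  (le_iSup (fun T : Representation.IntertwiningMap (toRep J) (toRep W) =>
    LinearMap.range T.toLinearMap) (intertwiner T hT)) ⟨v, rfl⟩

lemma projMatrix_sector_mul {T : Matrix ι κ ℂ} (hT : T ∈ intertwinerSpace W J) :
    projMatrix (sector W J) * T = T := by
  apply Matrix.toEuclideanLin.injective
  ext1 v
  rw [toEuclideanLin_mul_apply]
  exact (projMatrix_apply_eq_iff _).mpr (mem_sector_of_intertwiner hT v)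

/-- A matrix that is the identity on every copy of `J` is the identity on the sector of `J`. -/
lemma mul_projMatrix_sector_eq {A B : Matrix ι ι ℂ}
    (h : ∀ T ∈ intertwinerSpace W J, A * T = B * T) :
    A * projMatrix (sector W J) = B * projMatrix (sector W J) := by
  rw [mul_projMatrix_eq_iff]
  intro v hv
  suffices h' : sector W J ≤ LinearMap.eqLocus (Matrix.toEuclideanLin A)
      (Matrix.toEuclideanLin B) from h' hv
  refine iSup_le fun T => ?_
  rintro _ ⟨x, rfl⟩
  rw [LinearMap.mem_eqLocus, ← toEuclideanLin_intertwinerMatrix, ← toEuclideanLin_mul_apply,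
    ← toEuclideanLin_mul_apply, h _ (intertwinerMatrix_mul T)]

/-- The vectors on a product of index sets, as matrices. -/
def vecMatrixEquiv (ι κ : Type*) [Fintype ι] [Fintype κ] :
    EuclideanSpace ℂ (ι × κ) ≃ₗ[ℂ] Matrix ι κ ℂ where
  toFun v := Matrix.of fun i k => v (i, k)
  invFun M := WithLp.toLp 2 fun p => M p.1 p.2
  map_add' _ _ := rfl
  map_smul' _ _ := rfl
  left_inv _ := rfl
  right_inv _ := rfl

lemma vecMatrixEquiv_apply (v : EuclideanSpace ℂ (ι × κ)) (i : ι) (k : κ) :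
    vecMatrixEquiv ι κ v i k = v (i, k) := rfl

lemma inner_eq_trace_vecMatrixEquiv (v w : EuclideanSpace ℂ (ι × κ)) :
    inner ℂ v w = ((vecMatrixEquiv ι κ v)ᴴ * vecMatrixEquiv ι κ w).trace := by
  simp only [PiLp.inner_apply, RCLike.inner_apply, Matrix.trace, Matrix.diag, Matrix.mul_apply,
    Matrix.conjTranspose_apply, vecMatrixEquiv_apply, Fintype.sum_prod_type]
  rw [Finset.sum_comm]
  simp only [mul_comm, starRingEnd_apply]

/-- An orthonormal family of intertwiners spanning all intertwiners. -/
lemma exists_orthonormal_intertwiners (W : G →* Matrix.unitaryGroup ι ℂ)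
    (hJ : IsIrrep J) : ∃ T : Fin (mult W J) → Matrix ι κ ℂ,
      (∀ a, T a ∈ intertwinerSpace W J) ∧
      (∀ a b, (T a)ᴴ * T b = if a = b then 1 else 0) ∧
      projMatrix (sector W J) = ∑ a, T a * (T a)ᴴ := by
  set E : Submodule ℂ (EuclideanSpace ℂ (ι × κ)) :=
    (intertwinerSpace W J).map ((vecMatrixEquiv ι κ).symm : Matrix ι κ ℂ →ₗ[ℂ] _) with hE
  have hfin : Module.finrank ℂ E = mult W J := by
    rw [hE, LinearEquiv.finrank_map_eq, finrank_intertwinerSpace]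
  have hmem : ∀ v ∈ E, vecMatrixEquiv ι κ v ∈ intertwinerSpace W J := by
    rintro _ ⟨T, hT, rfl⟩
    exact hT
  set b := (stdOrthonormalBasis ℂ E).reindex (finCongr hfin) with hb
  have hcard : 0 < (Fintype.card κ : ℝ) := by
    have := nonempty_of_isIrrep hJ
    exact_mod_cast Fintype.card_pos
  -- By Schur's lemma T_a†T_b is the scalar Tr(T_a†T_b)/dim J. Rescaling a Hilbert-Schmidt
  -- orthonormal basis by √(dim J) thus yields isometries with mutually orthogonal ranges.
  set s : ℂ := ((Real.sqrt (Fintype.card κ) : ℝ) : ℂ) with hs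
  have hss : star s * s = Fintype.card κ := by
    rw [hs, RCLike.star_def, Complex.conj_ofReal, ← Complex.ofReal_mul,
      Real.mul_self_sqrt hcard.le]
    simp
  set T : Fin (mult W J) → Matrix ι κ ℂ := fun a => s • vecMatrixEquiv ι κ (b a : _) with hT
  have hTm : ∀ a, T a ∈ intertwinerSpace W J := fun a =>
    Submodule.smul_mem _ _ (hmem _ (b a).2)
  have hTT : ∀ a c, (T a)ᴴ * T c = if a = c then 1 else 0 := by
    intro a c
    have h1 := eq_trace_smul_one_of_commute hJ (A := (T a)ᴴ * T c)
      (mul_mem_intertwinerSpace (conjTranspose_mem_intertwinerSpace (hTm a)) (hTm c))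
    have h2 : ((T a)ᴴ * T c).trace = Fintype.card κ * if a = c then 1 else 0 := by
      simp only [hT]
      rw [Matrix.conjTranspose_smul, Matrix.smul_mul, Matrix.mul_smul, smul_smul,
        Matrix.trace_smul, ← inner_eq_trace_vecMatrixEquiv, hss, smul_eq_mul]
      congr 1
      exact orthonormal_iff_ite.mp b.orthonormal a c
    rw [h1, h2]
    have hcard' : (Fintype.card κ : ℂ) ≠ 0 := by exact_mod_cast hcard.ne'
    rw [mul_div_cancel_left₀ _ hcard']
    split_ifs <;> simp
  refine ⟨T, hTm, hTT, ?_⟩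
  have hspan : ∀ S ∈ intertwinerSpace W J, ∃ c : Fin (mult W J) → ℂ, S = ∑ a, c a • T a := by
    intro S hS
    have hv : (vecMatrixEquiv ι κ).symm S ∈ E := ⟨S, hS, rfl⟩
    have h1 := b.sum_repr ⟨_, hv⟩
    have h2 := congrArg (fun v : E => vecMatrixEquiv ι κ (v : EuclideanSpace ℂ (ι × κ))) h1
    simp only [Submodule.coe_sum, Submodule.coe_smul, map_sum, map_smul,
      LinearEquiv.apply_symm_apply] at h2
    refine ⟨fun a => b.repr ⟨_, hv⟩ a * s⁻¹, ?_⟩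
    refine h2.symm.trans (Finset.sum_congr rfl fun a _ => ?_)
    have hs0 : s ≠ 0 := by
      rw [hs]
      exact_mod_cast (Real.sqrt_pos.mpr hcard).ne'
    simp only [hT]
    rw [smul_smul, inv_mul_cancel_right₀ hs0]
  refine projMatrix_eq_of_isHermitian _ ?_ ?_ ?_
  · change _ = _
    simp only [Matrix.conjTranspose_sum, Matrix.conjTranspose_mul,
      Matrix.conjTranspose_conjTranspose]
  · intro v hv
    -- ∑ T_a T_a† fixes each T_a, hence every intertwiner, hence every vector of the sector.
    have h1 := mul_projMatrix_sector_eq (W := W) (J := J) (A := ∑ a, T a * (T a)ᴴ) (B := 1) ?_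
    · have h2 := (mul_projMatrix_eq_iff _).mp h1 v hv
      rw [h2, Matrix.toLpLin_one]
      rfl
    · intro S hS
      obtain ⟨c, rfl⟩ := hspan S hS
      rw [Matrix.one_mul, Matrix.sum_mul]
      refine Finset.sum_congr rfl fun a _ => ?_
      rw [Matrix.mul_sum, Finset.sum_eq_single a]
      · rw [Matrix.mul_smul, Matrix.mul_assoc, hTT, if_pos rfl, Matrix.mul_one]
      · intro c' _ hc'
        rw [Matrix.mul_smul, Matrix.mul_assoc, hTT, if_neg hc'.symm, Matrix.mul_zero, smul_zero]
      · simp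
  · intro v
    rw [map_sum, LinearMap.sum_apply]
    refine Submodule.sum_mem _ fun a _ => ?_
    rw [toEuclideanLin_mul_apply]
    exact mem_sector_of_intertwiner (hTm a) _

lemma projMatrix_sector_commute_rep (hJ : IsIrrep J) (g : G) :
    Commute (projMatrix (sector W J)) (W g : Matrix ι ι ℂ) := by
  obtain ⟨T, hT, -, hP⟩ := exists_orthonormal_intertwiners W hJ
  rw [hP]
  exact Commute.sum_left _ _ _ fun a _ =>
    mul_mem_intertwinerSpace (hT a) (conjTranspose_mem_intertwinerSpace (hT a)) g

lemma intertwiner_eq_zero {L : G →* Matrix.unitaryGroup μ ℂ} (hJ : IsIrrep J) (hL : IsIrrep L)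
    (h : ¬ Nonempty (Representation.Equiv (toRep L) (toRep J))) {T : Matrix κ μ ℂ}
    (hT : T ∈ intertwinerSpace J L) : T = 0 := by
  have : (toRep J).IsIrreducible := hJ
  have : (toRep L).IsIrreducible := hL
  rcases Representation.IsIrreducible.bijective_or_eq_zero (intertwiner T hT) with hb | h0
  · exact absurd ⟨Representation.IntertwiningMap.ofBijective (intertwiner T hT) hb⟩ h
  · apply Matrix.toEuclideanLin.injective
    rw [← intertwiner_toLinearMap T hT, h0, map_zero]
    rfl

/-- The sectors of inequivalent irreducible representations are orthogonal. -/
lemma projMatrix_sector_mul_sector {L : G →* Matrix.unitaryGroup μ ℂ} (hJ : IsIrrep J)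
    (hL : IsIrrep L) (h : ¬ Nonempty (Representation.Equiv (toRep L) (toRep J))) :
    projMatrix (sector W J) * projMatrix (sector W L) = 0 := by
  obtain ⟨T, hT, -, hP⟩ := exists_orthonormal_intertwiners W hJ
  obtain ⟨S, hS, -, hQ⟩ := exists_orthonormal_intertwiners W hL
  rw [hP, hQ, Finset.sum_mul_sum]
  refine Finset.sum_eq_zero fun a _ => Finset.sum_eq_zero fun b _ => ?_
  have h0 : (T a)ᴴ * S b = 0 := intertwiner_eq_zero hJ hL h
    (mul_mem_intertwinerSpace (conjTranspose_mem_intertwinerSpace (hT a)) (hS b))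
  rw [Matrix.mul_assoc, ← Matrix.mul_assoc (T a)ᴴ, h0, Matrix.zero_mul, Matrix.mul_zero]

/-- A nonzero invariant subspace contains an isometric copy of an irreducible representation. -/
lemma exists_isIrrep_intertwiner (W : G →* Matrix.unitaryGroup ι ℂ)
    {R : Submodule ℂ (EuclideanSpace ℂ ι)} (hR : R ≠ ⊥)
    (hinv : ∀ g, ∀ v ∈ R, Matrix.toEuclideanLin (W g : Matrix ι ι ℂ) v ∈ R) :
    ∃ (m : ℕ) (J : G →* Matrix.unitaryGroup (Fin m) ℂ) (T : Matrix ι (Fin m) ℂ),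
      IsIrrep J ∧ T ∈ intertwinerSpace W J ∧ Tᴴ * T = 1 ∧
      ∀ v, Matrix.toEuclideanLin T v ∈ R := by
  -- A minimal nonzero invariant subspace K; an orthonormal basis of it gives an isometry T with
  -- range K, and J = T†WT.
  obtain ⟨K, ⟨hK0, hKR, hKinv⟩, hmin⟩ := wellFounded_lt.has_min
    {K : Submodule ℂ (EuclideanSpace ℂ ι) | K ≠ ⊥ ∧ K ≤ R ∧
      ∀ g, ∀ v ∈ K, Matrix.toEuclideanLin (W g : Matrix ι ι ℂ) v ∈ K} ⟨R, hR, le_rfl, hinv⟩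
  set b := stdOrthonormalBasis ℂ K with hb
  set f : EuclideanSpace ℂ (Fin (Module.finrank ℂ K)) →ₗ[ℂ] EuclideanSpace ℂ ι :=
    K.subtype ∘ₗ (b.repr.symm.toLinearEquiv : _ →ₗ[ℂ] K) with hf
  set T : Matrix ι (Fin (Module.finrank ℂ K)) ℂ := Matrix.toEuclideanLin.symm f with hT
  have hTf : Matrix.toEuclideanLin T = f := LinearEquiv.apply_symm_apply _ _
  have hfmem : ∀ v, f v ∈ K := fun v => (b.repr.symm v).2
  have hfsurj : ∀ v ∈ K, ∃ x, f x = v := by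
    intro v hv
    refine ⟨b.repr ⟨v, hv⟩, ?_⟩
    simp [hf]
  have hfinner : ∀ x y, inner ℂ (f x) (f y) = inner ℂ x y := by
    intro x y
    exact b.repr.symm.inner_map_map x y
  have hTT : Tᴴ * T = 1 := by
    apply Matrix.toEuclideanLin.injective
    ext1 y
    refine ext_inner_left ℂ fun x => ?_
    rw [toEuclideanLin_mul_apply, ← inner_toEuclideanLin, hTf, hfinner, Matrix.toLpLin_one]
    rfl
  have hfinj : Function.Injective f := by
    intro x y hxy
    have := congrArg (Matrix.toEuclideanLin Tᴴ) hxy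
    rw [← hTf, ← toEuclideanLin_mul_apply, ← toEuclideanLin_mul_apply, hTT,
      Matrix.toLpLin_one] at this
    exact this
  have hP : projMatrix K = T * Tᴴ := by
    refine projMatrix_eq_of_isHermitian K (Matrix.isHermitian_mul_conjTranspose_self T) ?_ ?_
    · intro v hv
      obtain ⟨x, rfl⟩ := hfsurj v hv
      rw [← hTf, ← toEuclideanLin_mul_apply, Matrix.mul_assoc, hTT, Matrix.mul_one]
    · intro v
      rw [toEuclideanLin_mul_apply, hTf]
      exact hfmem _
  have hPW : ∀ g, (W g : Matrix ι ι ℂ) * T = T * (Tᴴ * (W g : Matrix ι ι ℂ) * T) := by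
    intro g
    have h1 : projMatrix K * ((W g : Matrix ι ι ℂ) * T) = (W g : Matrix ι ι ℂ) * T := by
      apply Matrix.toEuclideanLin.injective
      ext1 v
      rw [toEuclideanLin_mul_apply, toEuclideanLin_mul_apply, hTf]
      exact (projMatrix_apply_eq_iff K).mpr (hKinv g _ (hfmem v))
    rw [← h1, hP]
    simp only [Matrix.mul_assoc]
  have hmulJ : ∀ g h, Tᴴ * ((W (g * h) : Matrix.unitaryGroup ι ℂ) : Matrix ι ι ℂ) * T
      = Tᴴ * (W g : Matrix ι ι ℂ) * T * (Tᴴ * (W h : Matrix ι ι ℂ) * T) := by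
    intro g h
    rw [Matrix.mul_assoc (Tᴴ * (W g : Matrix ι ι ℂ)) T, ← hPW, map_mul]
    simp only [Submonoid.coe_mul, Matrix.mul_assoc]
  have hone : Tᴴ * ((W 1 : Matrix.unitaryGroup ι ℂ) : Matrix ι ι ℂ) * T = 1 := by
    rw [map_one]
    simp only [Submonoid.coe_one, Matrix.mul_one]
    exact hTT
  let J : G →* Matrix.unitaryGroup (Fin (Module.finrank ℂ K)) ℂ :=
    { toFun := fun g => ⟨Tᴴ * (W g : Matrix ι ι ℂ) * T, by
        rw [Matrix.mem_unitaryGroup_iff]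
        have h1 : star (Tᴴ * (W g : Matrix ι ι ℂ) * T)
            = Tᴴ * ((W g⁻¹ : Matrix.unitaryGroup ι ℂ) : Matrix ι ι ℂ) * T := by
          rw [coe_map_inv, Matrix.star_eq_conjTranspose, Matrix.conjTranspose_mul,
            Matrix.conjTranspose_mul, Matrix.conjTranspose_conjTranspose, Matrix.mul_assoc]
        rw [h1, ← hmulJ, mul_inv_cancel, hone]⟩
      map_one' := Subtype.ext hone
      map_mul' := fun g h => Subtype.ext (hmulJ g h) }
  have hJT : T ∈ intertwinerSpace W J := fun g => (hPW g).symm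
  refine ⟨_, J, T, ?_, hJT, hTT, fun v => ?_⟩
  · have hnt : Nontrivial (Subrepresentation (toRep J)) := by
      refine ⟨⊥, ⊤, fun h => hK0 ?_⟩
      rw [Submodule.eq_bot_iff]
      intro v hv
      obtain ⟨x, rfl⟩ := hfsurj v hv
      have hx : x ∈ (⊤ : Subrepresentation (toRep J)).toSubmodule :=
        Submodule.mem_top
      rw [← h] at hx
      rw [(Submodule.mem_bot ℂ).mp hx, map_zero]
    -- The image under T of an invariant subspace of J is a W-invariant subspace of K, so by
    -- minimality it is 0 or K.
    refine @IsSimpleOrder.mk _ _ _ hnt fun L => ?_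
    have hLK : L.toSubmodule.map f ≤ K := by
      rintro _ ⟨x, -, rfl⟩
      exact hfmem x
    have hLinv : ∀ g, ∀ v ∈ L.toSubmodule.map f,
        Matrix.toEuclideanLin (W g : Matrix ι ι ℂ) v ∈ L.toSubmodule.map f := by
      rintro g _ ⟨x, hx, rfl⟩
      refine ⟨toRep J g x, L.apply_mem_toSubmodule g hx, ?_⟩
      rw [toRep_apply, ← hTf, ← toEuclideanLin_mul_apply, ← toEuclideanLin_mul_apply, hJT g]
    by_cases h0 : L.toSubmodule.map f = ⊥
    · left
      apply Subrepresentation.toSubmodule_injective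
      exact Submodule.map_injective_of_injective hfinj (h0.trans (Submodule.map_bot f).symm)
    · right
      apply Subrepresentation.toSubmodule_injective
      have h1 := hmin _ ⟨h0, hLK.trans hKR, hLinv⟩
      have h2 : L.toSubmodule.map f = K := hLK.eq_of_not_lt h1
      change L.toSubmodule = ⊤
      rw [Submodule.eq_top_iff']
      intro x
      have h3 : f x ∈ L.toSubmodule.map f := by
        rw [h2]
        exact hfmem x
      obtain ⟨y, hy, hxy⟩ := h3
      rw [← hfinj hxy]
      exact hy
  · rw [hTf]
    exact hKR (hfmem v)

/-- The sectors of all the irreducible representations that occur exhaust the representation. -/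
lemma sum_projMatrix_sector {K : Type*} [Fintype K] [DecidableEq K] {m : K → ℕ}
    {J : ∀ k, G →* Matrix.unitaryGroup (Fin (m k)) ℂ} (hJ : ListsIrreps W m J) :
    ∑ k, projMatrix (sector W (J k)) = 1 := by
  set P : K → Matrix ι ι ℂ := fun k => projMatrix (sector W (J k)) with hP
  have horth : ∀ k l, k ≠ l → P k * P l = 0 := fun k l hkl =>
    projMatrix_sector_mul_sector (hJ.irrep k) (hJ.irrep l)
      fun h => hkl (hJ.inequivalent l k h).symm
  -- Q commutes with the representation, so a nonzero range would contain an irreducible copy T. It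
  -- is equivalent to a listed J k, so T would have to lie in a sector that P k T = 0 excludes.
  set Q : Matrix ι ι ℂ := 1 - ∑ k, P k with hQ
  have hPQ : ∀ k, P k * Q = 0 := by
    intro k
    rw [hQ, mul_sub, mul_one, Finset.mul_sum, Finset.sum_eq_single k, hP, projMatrix_mul_self,
      sub_self]
    · intro l _ hl
      exact horth k l hl.symm
    · simp
  have hQW : ∀ g, Commute Q (W g) := by
    intro g
    exact (Commute.one_left _).sub_left (Commute.sum_left _ _ _ fun k _ =>
      projMatrix_sector_commute_rep (hJ.irrep k) g)
  by_contra hne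
  have hQ0 : Q ≠ 0 := fun h => hne (sub_eq_zero.mp h).symm
  have hR : LinearMap.range (Matrix.toEuclideanLin Q) ≠ ⊥ := by
    intro h
    rw [LinearMap.range_eq_bot] at h
    exact hQ0 (by simpa using h)
  obtain ⟨m', J', T, hJ', hT, hTT, hTR⟩ := exists_isIrrep_intertwiner W hR (by
    rintro g _ ⟨x, rfl⟩
    refine ⟨Matrix.toEuclideanLin (W g : Matrix ι ι ℂ) x, ?_⟩
    rw [← toEuclideanLin_mul_apply, ← toEuclideanLin_mul_apply, (hQW g).eq])
  have hT0 : T ≠ 0 := by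
    rintro rfl
    have := nonempty_of_isIrrep hJ'
    rw [Matrix.mul_zero] at hTT
    exact zero_ne_one hTT
  have hPT : ∀ k, P k * T = 0 := by
    intro k
    apply Matrix.toEuclideanLin.injective
    ext1 v
    obtain ⟨x, hx⟩ := hTR v
    rw [toEuclideanLin_mul_apply, ← hx, ← toEuclideanLin_mul_apply, hPQ, map_zero, map_zero]
    rfl
  obtain ⟨k, ⟨e⟩⟩ := hJ.complete m' J' hJ' (by
    intro h
    apply hT0
    have := projMatrix_sector_mul hT
    rw [← this]
    apply Matrix.toEuclideanLin.injective
    ext1 v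
    have h1 : Matrix.toEuclideanLin (projMatrix (sector W J')) (Matrix.toEuclideanLin T v) ∈
        (⊥ : Submodule ℂ (EuclideanSpace ℂ ι)) := h ▸ projMatrix_apply_mem (sector W J') _
    rw [Submodule.mem_bot] at h1
    rw [toEuclideanLin_mul_apply, h1]
    simp)
  -- Precomposing T with the equivalence makes it a copy of J k, which P k fixes; but P k also
  -- annihilates it.
  have hS : T * intertwinerMatrix e.symm.toIntertwiningMap ∈ intertwinerSpace W (J k) :=
    mul_mem_intertwinerSpace hT (intertwinerMatrix_mul _)
  have h1 := projMatrix_sector_mul hS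
  rw [← Matrix.mul_assoc] at h1
  have h2 : T * intertwinerMatrix e.symm.toIntertwiningMap = 0 := by
    rw [← h1]
    change P k * T * _ = 0
    rw [hPT, Matrix.zero_mul]
  apply hT0
  have h3 : intertwinerMatrix e.symm.toIntertwiningMap * intertwinerMatrix e.toIntertwiningMap
      = 1 := by
    apply Matrix.toEuclideanLin.injective
    ext1 v
    rw [toEuclideanLin_mul_apply, toEuclideanLin_intertwinerMatrix,
      toEuclideanLin_intertwinerMatrix, Matrix.toLpLin_one]
    exact e.symm_apply_apply v
  rw [← Matrix.mul_one T, ← h3, ← Matrix.mul_assoc, h2, Matrix.zero_mul]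

end Schur

/-! ### Invariant vectors of tensor products and multiplicities. -/

section Multiplicities

open scoped ComplexOrder MatrixOrder Kronecker

variable {G : Type*} [Group G] {ι κ μ : Type*} [Fintype ι] [DecidableEq ι]
  [Fintype κ] [DecidableEq κ] [Fintype μ] [DecidableEq μ]

/-- The projector onto the invariant vectors is determined by its matrix identities. -/
lemma projMatrix_invSector_eq {W : G →* Matrix.unitaryGroup ι ℂ} {P : Matrix ι ι ℂ}
    (hP : P.IsHermitian) (h1 : ∀ g, (W g : Matrix ι ι ℂ) * P = P)
    (h2 : ∀ Q : Matrix ι ι ℂ, (∀ g, (W g : Matrix ι ι ℂ) * Q = Q) → P * Q = Q) :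
    projMatrix (invSector W) = P := by
  have h3 := h2 _ (rep_mul_invSector W)
  have h4 : projMatrix (invSector W) * P = P := by
    apply Matrix.toEuclideanLin.injective
    ext1 v
    rw [toEuclideanLin_mul_apply, projMatrix_apply_eq_iff, mem_invSector_iff]
    intro g
    rw [← toEuclideanLin_mul_apply, h1]
  have := congrArg Matrix.conjTranspose h3
  rw [Matrix.conjTranspose_mul, hP.eq, (projMatrix_isHermitian _).eq, h4] at this
  exact this.symm

lemma invSector_mul_of_fixed {W : G →* Matrix.unitaryGroup ι ℂ} {Q : Matrix ι κ ℂ}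
    (h : ∀ g, (W g : Matrix ι ι ℂ) * Q = Q) : projMatrix (invSector W) * Q = Q := by
  apply Matrix.toEuclideanLin.injective
  ext1 v
  rw [toEuclideanLin_mul_apply, projMatrix_apply_eq_iff, mem_invSector_iff]
  intro g
  rw [← toEuclideanLin_mul_apply, h]

/-- Intertwiners commute with the projections onto the invariant vectors. -/
lemma invSector_mul_intertwiner {W : G →* Matrix.unitaryGroup ι ℂ}
    {J : G →* Matrix.unitaryGroup κ ℂ} {T : Matrix ι κ ℂ} (hT : T ∈ intertwinerSpace W J) :
    projMatrix (invSector W) * T = T * projMatrix (invSector J) := by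
  have key : ∀ {α β : Type _} [Fintype α] [DecidableEq α] [Fintype β] [DecidableEq β]
      {V : G →* Matrix.unitaryGroup α ℂ} {L : G →* Matrix.unitaryGroup β ℂ} {S : Matrix α β ℂ},
      S ∈ intertwinerSpace V L → projMatrix (invSector V) * (S * projMatrix (invSector L))
        = S * projMatrix (invSector L) := by
    intro α β _ _ _ _ V L S hS
    refine invSector_mul_of_fixed fun g => ?_
    rw [← Matrix.mul_assoc, ← hS g, Matrix.mul_assoc, rep_mul_invSector]
  have h1 := key hT
  have h2 : projMatrix (invSector J) * (Tᴴ * projMatrix (invSector W))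
      = Tᴴ * projMatrix (invSector W) := by
    refine invSector_mul_of_fixed fun g => ?_
    rw [← Matrix.mul_assoc, ← conjTranspose_mem_intertwinerSpace hT g, Matrix.mul_assoc,
      rep_mul_invSector]
  have h3 := congrArg Matrix.conjTranspose h2
  simp only [Matrix.conjTranspose_mul, Matrix.conjTranspose_conjTranspose,
    (projMatrix_isHermitian _).eq] at h3
  rw [← h3, Matrix.mul_assoc, h1]

/-- Relabelling the product basis identifies N qudits with a pair tensored with the remaining N - 2.
-/
lemma invSector_submatrix {W : G →* Matrix.unitaryGroup ι ℂ} {V : G →* Matrix.unitaryGroup κ ℂ}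
    (e : ι ≃ κ) (h : ∀ g, (W g : Matrix ι ι ℂ) = (V g : Matrix κ κ ℂ).submatrix e e) :
    projMatrix (invSector W) = (projMatrix (invSector V)).submatrix e e := by
  refine projMatrix_invSector_eq ((projMatrix_isHermitian _).submatrix e) (fun g => ?_)
    fun Q hQ => ?_
  · rw [h, Matrix.submatrix_mul_equiv, rep_mul_invSector]
  · have h1 : projMatrix (invSector V) * Q.submatrix e.symm e.symm = Q.submatrix e.symm e.symm := by
      refine invSector_mul_of_fixed fun g => ?_
      have h2 := congrArg (fun M => Matrix.submatrix M e.symm e.symm) (hQ g)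
      simp only [h] at h2
      rw [← Matrix.submatrix_mul_equiv _ _ _ e.symm] at h2
      simpa using h2
    have h2 := congrArg (fun M => Matrix.submatrix M e e) h1
    beta_reduce at h2
    rw [← Matrix.submatrix_mul_equiv _ _ _ e] at h2
    simpa using h2

/-- The tensor product of two unitary representations. -/
def prodRep (W : G →* Matrix.unitaryGroup ι ℂ) (V : G →* Matrix.unitaryGroup κ ℂ) :
    G →* Matrix.unitaryGroup (ι × κ) ℂ where
  toFun g := ⟨(W g : Matrix ι ι ℂ) ⊗ₖ (V g : Matrix κ κ ℂ), by
    rw [Matrix.mem_unitaryGroup_iff, Matrix.star_eq_conjTranspose, Matrix.conjTranspose_kronecker,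
      ← Matrix.mul_kronecker_mul, coe_mul_conjTranspose, coe_mul_conjTranspose,
      Matrix.one_kronecker_one]⟩
  map_one' := Subtype.ext (by simp)
  map_mul' g h := Subtype.ext (by simp [Matrix.mul_kronecker_mul])

lemma coe_prodRep (W : G →* Matrix.unitaryGroup ι ℂ) (V : G →* Matrix.unitaryGroup κ ℂ) (g : G) :
    ((prodRep W V g : Matrix.unitaryGroup (ι × κ) ℂ) : Matrix (ι × κ) (ι × κ) ℂ)
      = (W g : Matrix ι ι ℂ) ⊗ₖ (V g : Matrix κ κ ℂ) := rfl

lemma coe_conjRep (J : G →* Matrix.unitaryGroup κ ℂ) (g : G) :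
    ((conjRep J g : Matrix.unitaryGroup κ ℂ) : Matrix κ κ ℂ)
      = (J g : Matrix κ κ ℂ).map star := rfl

/-- The invariant vectors of `J ⊗ W` correspond to the intertwiners from the conjugate of `J`
to `W`. -/
lemma finrank_invSector_prodRep (J : G →* Matrix.unitaryGroup κ ℂ)
    (W : G →* Matrix.unitaryGroup ι ℂ) :
    Module.finrank ℂ (invSector (prodRep J W)) = mult W (conjRep J) := by
  rw [← finrank_intertwinerSpace, ← LinearEquiv.finrank_map_eq
    ((vecMatrixEquiv κ ι).trans (Matrix.transposeLinearEquiv κ ι ℂ ℂ)) (invSector (prodRep J W))]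
  -- Viewed as a matrix M, an invariant vector satisfies J M Wᵀ = M. Since Jᵀ is inverse to the
  -- complex conjugate of J, this says that Mᵀ intertwines the conjugate of J with W.
  have key : ∀ v : EuclideanSpace ℂ (κ × ι), v ∈ invSector (prodRep J W) ↔
      (vecMatrixEquiv κ ι v)ᵀ ∈ intertwinerSpace W (conjRep J) := by
    intro v
    rw [mem_invSector_iff, mem_intertwinerSpace]
    refine forall_congr' fun g => ?_
    set M := vecMatrixEquiv κ ι v with hM
    have h1 : vecMatrixEquiv κ ι (Matrix.toEuclideanLin
        ((prodRep J W g : Matrix.unitaryGroup (κ × ι) ℂ) : Matrix (κ × ι) (κ × ι) ℂ) v)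
        = (J g : Matrix κ κ ℂ) * M * (W g : Matrix ι ι ℂ)ᵀ := by
      ext x s
      rw [vecMatrixEquiv_apply, coe_prodRep, Matrix.toLpLin_apply]
      simp only [Matrix.mulVec, dotProduct, Matrix.mul_apply, Matrix.kroneckerMap_apply,
        Fintype.sum_prod_type, Matrix.transpose_apply, hM, vecMatrixEquiv_apply, Finset.sum_mul]
      rw [Finset.sum_comm]
      refine Finset.sum_congr rfl fun t _ => Finset.sum_congr rfl fun y _ => ?_
      ring
    have hJ1 : (J g : Matrix κ κ ℂ)ᵀ * (J g : Matrix κ κ ℂ).map star = 1 := by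
      have := congrArg Matrix.transpose (conjTranspose_mul_coe (J g))
      rwa [Matrix.transpose_mul, Matrix.transpose_one] at this
    have hJ2 : (J g : Matrix κ κ ℂ).map star * (J g : Matrix κ κ ℂ)ᵀ = 1 :=
      mul_eq_one_comm.mp hJ1
    rw [← (vecMatrixEquiv κ ι).injective.eq_iff, h1, ← hM, coe_conjRep,
      ← Matrix.transpose_injective.eq_iff]
    simp only [Matrix.transpose_mul, Matrix.transpose_transpose]
    constructor
    · intro h
      conv_lhs => rw [← h]
      rw [Matrix.mul_assoc, Matrix.mul_assoc, hJ1, Matrix.mul_one]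
    · intro h
      rw [← Matrix.mul_assoc, ← h, Matrix.mul_assoc, hJ2, Matrix.mul_one]
  have h2 : (invSector (prodRep J W)).map
      (((vecMatrixEquiv κ ι).trans (Matrix.transposeLinearEquiv κ ι ℂ ℂ) :
        EuclideanSpace ℂ (κ × ι) ≃ₗ[ℂ] Matrix ι κ ℂ) : EuclideanSpace ℂ (κ × ι) →ₗ[ℂ] Matrix ι κ ℂ)
      = intertwinerSpace W (conjRep J) := by
    ext M
    constructor
    · rintro ⟨v, hv, rfl⟩
      exact (key v).mp hv
    · intro hM
      refine ⟨(vecMatrixEquiv κ ι).symm Mᵀ, (key _).mpr ?_, ?_⟩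
      · rw [LinearEquiv.apply_symm_apply, Matrix.transpose_transpose]
        exact hM
      · change (vecMatrixEquiv κ ι ((vecMatrixEquiv κ ι).symm Mᵀ))ᵀ = M
        rw [LinearEquiv.apply_symm_apply, Matrix.transpose_transpose]
  rw [h2]

/-- The weight of the sector `J ⊗ W` within the invariant vectors of `V ⊗ W`. -/
lemma trace_invSector_prodRep_mul {V : G →* Matrix.unitaryGroup μ ℂ}
    {J : G →* Matrix.unitaryGroup κ ℂ} (hJ : IsIrrep J) (W : G →* Matrix.unitaryGroup ι ℂ) :
    (projMatrix (invSector (prodRep V W))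
      * (projMatrix (sector V J) ⊗ₖ (1 : Matrix ι ι ℂ))).trace
      = (mult V J : ℂ) * mult W (conjRep J) := by
  obtain ⟨T, hT, hTT, hP⟩ := exists_orthonormal_intertwiners V hJ
  have hS : ∀ a, T a ⊗ₖ (1 : Matrix ι ι ℂ) ∈ intertwinerSpace (prodRep V W) (prodRep J W) := by
    intro a g
    rw [coe_prodRep, coe_prodRep, ← Matrix.mul_kronecker_mul, ← Matrix.mul_kronecker_mul, hT a g,
      Matrix.one_mul, Matrix.mul_one]
  have hsplit : projMatrix (sector V J) ⊗ₖ (1 : Matrix ι ι ℂ)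
      = ∑ a, (T a ⊗ₖ (1 : Matrix ι ι ℂ)) * (T a ⊗ₖ (1 : Matrix ι ι ℂ))ᴴ := by
    have h1 : ∀ a, (T a ⊗ₖ (1 : Matrix ι ι ℂ)) * (T a ⊗ₖ (1 : Matrix ι ι ℂ))ᴴ
        = (T a * (T a)ᴴ) ⊗ₖ (1 : Matrix ι ι ℂ) := by
      intro a
      rw [Matrix.conjTranspose_kronecker, ← Matrix.mul_kronecker_mul, Matrix.conjTranspose_one,
        Matrix.one_mul]
    simp only [h1, hP]
    ext p q
    simp only [Matrix.kroneckerMap_apply, Matrix.sum_apply, Finset.sum_mul]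
  rw [hsplit, Matrix.mul_sum, Matrix.trace_sum]
  -- T_a ⊗ 1 is an isometric intertwiner, so by cyclicity the trace becomes that of the invariant
  -- projector of J ⊗ W. Each copy of J in V thus contributes the same dimension.
  have h2 : ∀ a, (projMatrix (invSector (prodRep V W))
      * ((T a ⊗ₖ (1 : Matrix ι ι ℂ)) * (T a ⊗ₖ (1 : Matrix ι ι ℂ))ᴴ)).trace
      = mult W (conjRep J) := by
    intro a
    rw [← Matrix.mul_assoc, invSector_mul_intertwiner (hS a), Matrix.trace_mul_comm,
      ← Matrix.mul_assoc, Matrix.conjTranspose_kronecker, ← Matrix.mul_kronecker_mul, hTT,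
      if_pos rfl, Matrix.conjTranspose_one, Matrix.one_mul, Matrix.one_kronecker_one,
      Matrix.one_mul, trace_projMatrix, finrank_invSector_prodRep]
  rw [Finset.sum_congr rfl fun a _ => h2 a]
  simp

lemma trace_invSector_mul_pairOp {d N : ℕ} (U : G →* Matrix.unitaryGroup (Fin d) ℂ)
    {J : G →* Matrix.unitaryGroup κ ℂ} (hJ : IsIrrep J) {i j : Fin N} (h : i ≠ j) :
    (projMatrix (invSector (tensorRep U N))
      * pairOp i j (projMatrix (sector (tensorRep U 2) J))).trace
      = (mult (tensorRep U 2) J : ℂ) * mult (tensorRep U (N - 2)) (conjRep J) := by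
  rw [invSector_submatrix (V := prodRep (tensorRep U 2) (tensorRep U (N - 2))) (pairEquiv d h)
    fun g => tensorPow_eq_kronecker h _, pairOp_eq_kronecker h, Matrix.submatrix_mul_equiv,
    trace_submatrix_equiv, trace_invSector_prodRep_mul hJ]

/-- The absolute value of a combination of orthogonal projectors that add up to the identity. -/
lemma matAbs_sum_smul {K : Type*} [Fintype K] [DecidableEq K] {P : K → Matrix ι ι ℂ}
    (hP : ∀ k, (P k).PosSemidef) (hPP : ∀ k, P k * P k = P k) (h : ∀ k l, k ≠ l → P k * P l = 0)
    (c : K → ℝ) :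
    matAbs (∑ k, (c k : ℂ) • P k) = ∑ k, ((|c k| : ℝ) : ℂ) • P k := by
  have hmul : ∀ a b : K → ℝ, (∑ k, (a k : ℂ) • P k) * (∑ k, (b k : ℂ) • P k)
      = ∑ k, ((a k * b k : ℝ) : ℂ) • P k := by
    intro a b
    rw [Finset.sum_mul_sum]
    refine Finset.sum_congr rfl fun k _ => ?_
    rw [Finset.sum_eq_single k]
    · rw [smul_mul_smul_comm, hPP, Complex.ofReal_mul]
    · intro l _ hl
      rw [smul_mul_smul_comm, h k l hl.symm, smul_zero]
    · simp
  refine matSqrt_unique ?_ ?_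
  · refine Matrix.posSemidef_sum _ fun k _ => (hP k).smul ?_
    exact_mod_cast abs_nonneg (c k)
  · have h1 : (∑ k, (c k : ℂ) • P k)ᴴ = ∑ k, (c k : ℂ) • P k := by
      simp [Matrix.conjTranspose_sum, Matrix.conjTranspose_smul, (hP _).isHermitian.eq]
    rw [h1, hmul, hmul]
    simp only [abs_mul_abs_self]

end Multiplicities

/-! ### Derivatives of unitary representations at the identity. -/

section Generators

variable {n : ℕ} {G : Type*} [TopologicalSpace G] [ChartedSpace (EuclideanSpace ℝ (Fin n)) G]
  [Group G]

/-- The coordinate vector of a tangent vector at the identity. -/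
def coordVec (X : GroupLieAlgebra 𝓘(ℝ, EuclideanSpace ℝ (Fin n)) G) : EuclideanSpace ℝ (Fin n) := X

/-- The curve through the identity that is straight in the preferred chart. -/
def chartCurve (X : GroupLieAlgebra 𝓘(ℝ, EuclideanSpace ℝ (Fin n)) G) (t : ℝ) : G :=
  (extChartAt 𝓘(ℝ, EuclideanSpace ℝ (Fin n)) (1 : G)).symm
    (extChartAt 𝓘(ℝ, EuclideanSpace ℝ (Fin n)) (1 : G) 1 + t • coordVec X)

lemma chartCurve_zero (X : GroupLieAlgebra 𝓘(ℝ, EuclideanSpace ℝ (Fin n)) G) :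
    chartCurve X 0 = 1 := by
  rw [chartCurve, zero_smul, add_zero]
  exact extChartAt_to_inv (1 : G)

/-- The manifold derivative at 1 is the ordinary derivative in the preferred chart, where this curve
is a straight line. Identities for `generator` thereby reduce to one-variable calculus. -/
lemma hasDerivAt_comp_chartCurve {F : Type*} [NormedAddCommGroup F] [NormedSpace ℝ F] {f : G → F}
    (hf : MDifferentiableAt 𝓘(ℝ, EuclideanSpace ℝ (Fin n)) 𝓘(ℝ, F) f 1)
    (X : GroupLieAlgebra 𝓘(ℝ, EuclideanSpace ℝ (Fin n)) G) :
    HasDerivAt (fun t => f (chartCurve X t))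
      (mfderiv 𝓘(ℝ, EuclideanSpace ℝ (Fin n)) 𝓘(ℝ, F) f 1 X : F) 0 := by
  let D : EuclideanSpace ℝ (Fin n) →L[ℝ] F :=
    mfderiv 𝓘(ℝ, EuclideanSpace ℝ (Fin n)) 𝓘(ℝ, F) f 1
  have h1 : HasFDerivWithinAt
      (fun y => f ((extChartAt 𝓘(ℝ, EuclideanSpace ℝ (Fin n)) (1 : G)).symm y)) D
      (Set.range 𝓘(ℝ, EuclideanSpace ℝ (Fin n)))
      (extChartAt 𝓘(ℝ, EuclideanSpace ℝ (Fin n)) (1 : G) 1) := hf.hasMFDerivAt.2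
  rw [ModelWithCorners.range_eq_univ, hasFDerivWithinAt_univ] at h1
  have h2 : HasDerivAt (fun t : ℝ => extChartAt 𝓘(ℝ, EuclideanSpace ℝ (Fin n)) (1 : G) 1
      + t • coordVec X) (coordVec X) 0 := by
    simpa using ((hasDerivAt_id (0 : ℝ)).smul_const (coordVec X)).const_add
      (extChartAt 𝓘(ℝ, EuclideanSpace ℝ (Fin n)) (1 : G) 1)
  exact HasFDerivAt.comp_hasDerivAt_of_eq (0 : ℝ) h1 h2 (by simp)

variable {m : ℕ}

lemma IsSmoothRep.mdifferentiableAt {W : G →* Matrix.unitaryGroup (Fin m) ℂ}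
    (hW : IsSmoothRep (n := n) W) (a b : Fin m) (g : G) :
    MDifferentiableAt 𝓘(ℝ, EuclideanSpace ℝ (Fin n)) 𝓘(ℝ, ℂ)
      (fun g : G => (W g : Matrix (Fin m) (Fin m) ℂ) a b) g :=
  (hW a b).mdifferentiable (by simp) g

/-- A matrix-valued curve with entrywise derivative `B` at `0`. -/
def HasEntryDeriv {ι κ : Type*} (A : ℝ → Matrix ι κ ℂ) (B : Matrix ι κ ℂ) : Prop :=
  ∀ a b, HasDerivAt (fun t => A t a b) (B a b) 0

lemma hasEntryDeriv_chartCurve {W : G →* Matrix.unitaryGroup (Fin m) ℂ}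
    (hW : IsSmoothRep (n := n) W) (X : GroupLieAlgebra 𝓘(ℝ, EuclideanSpace ℝ (Fin n)) G) :
    HasEntryDeriv (fun t => (W (chartCurve X t) : Matrix (Fin m) (Fin m) ℂ)) (generator W X) :=
  fun a b => hasDerivAt_comp_chartCurve (hW.mdifferentiableAt a b 1) X

section EntryDeriv

variable {ι κ ν : Type*} [Fintype ι] [Fintype κ]

lemma HasEntryDeriv.unique {A : ℝ → Matrix ι κ ℂ} {B B' : Matrix ι κ ℂ}
    (h : HasEntryDeriv A B) (h' : HasEntryDeriv A B') : B = B' := by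
  ext a b
  exact (h a b).unique (h' a b)

lemma hasEntryDeriv_const (B : Matrix ι κ ℂ) : HasEntryDeriv (fun _ => B) 0 :=
  fun _ _ => hasDerivAt_const _ _

lemma HasEntryDeriv.mul {A : ℝ → Matrix ν κ ℂ} {A' : ℝ → Matrix κ ι ℂ} {B : Matrix ν κ ℂ}
    {B' : Matrix κ ι ℂ} (h : HasEntryDeriv A B) (h' : HasEntryDeriv A' B') :
    HasEntryDeriv (fun t => A t * A' t) (B * A' 0 + A 0 * B') := by
  intro a b
  simp only [Matrix.mul_apply, Matrix.add_apply, ← Finset.sum_add_distrib]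
  exact HasDerivAt.fun_sum fun c _ => (h a c).mul (h' c b)

lemma HasEntryDeriv.const_mul {A' : ℝ → Matrix κ ι ℂ} {B' : Matrix κ ι ℂ} (C : Matrix ν κ ℂ)
    (h' : HasEntryDeriv A' B') : HasEntryDeriv (fun t => C * A' t) (C * B') := by
  have h : HasEntryDeriv (fun _ => C) 0 := fun _ _ => hasDerivAt_const _ _
  simpa using h.mul h'

lemma HasEntryDeriv.mul_const {A : ℝ → Matrix ν κ ℂ} {B : Matrix ν κ ℂ}
    (h : HasEntryDeriv A B) (C : Matrix κ ι ℂ) : HasEntryDeriv (fun t => A t * C) (B * C) := by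
  have h' : HasEntryDeriv (fun _ => C) 0 := fun _ _ => hasDerivAt_const _ _
  simpa using h.mul h'

lemma HasEntryDeriv.conjTranspose {A : ℝ → Matrix ι κ ℂ} {B : Matrix ι κ ℂ}
    (h : HasEntryDeriv A B) : HasEntryDeriv (fun t => (A t)ᴴ) Bᴴ :=
  fun a b => (h b a).star

/-- Leibniz rule for a product over the sites: differentiating one factor at A 0 = 1 leaves the
identity on all others. -/
lemma HasEntryDeriv.tensorPow {d : ℕ} (N : ℕ) {A : ℝ → Matrix (Fin d) (Fin d) ℂ}
    {B : Matrix (Fin d) (Fin d) ℂ} (h : HasEntryDeriv A B) (h0 : A 0 = 1) :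
    HasEntryDeriv (fun t => tensorPow N (A t)) (totalOp N B) := by
  intro s t
  have := HasDerivAt.fun_finsetProd (u := Finset.univ) fun i (_ : i ∈ Finset.univ) => h (s i) (t i)
  refine this.congr_deriv ?_
  simp only [totalOp, Matrix.sum_apply, siteOp, Matrix.of_apply, h0, Matrix.one_apply, smul_eq_mul]
  refine Finset.sum_congr rfl fun i _ => ?_
  split_ifs with hi
  · rw [Finset.prod_eq_one, one_mul]
    intro k hk
    rw [if_pos (hi k (Finset.ne_of_mem_erase hk))]
  · push Not at hi
    obtain ⟨k, hk, hne⟩ := hi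
    rw [Finset.prod_eq_zero (Finset.mem_erase.mpr ⟨hk, Finset.mem_univ k⟩) (if_neg hne), zero_mul]

end EntryDeriv

/-- Differentiate W W† = 1. -/
lemma generator_conjTranspose {W : G →* Matrix.unitaryGroup (Fin m) ℂ}
    (hW : IsSmoothRep (n := n) W) (X : GroupLieAlgebra 𝓘(ℝ, EuclideanSpace ℝ (Fin n)) G) :
    (generator W X)ᴴ = -generator W X := by
  have h := hasEntryDeriv_chartCurve hW X
  have h1 := h.mul h.conjTranspose
  have h2 := (hasEntryDeriv_const (1 : Matrix (Fin m) (Fin m) ℂ)).unique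
    (by simpa only [coe_mul_conjTranspose] using h1)
  simp only [chartCurve_zero, map_one] at h2
  simp only [OneMemClass.coe_one, Matrix.conjTranspose_one, mul_one, one_mul] at h2
  exact (neg_eq_of_add_eq_zero_right h2.symm).symm

lemma generator_add (W : G →* Matrix.unitaryGroup (Fin m) ℂ)
    (X Y : GroupLieAlgebra 𝓘(ℝ, EuclideanSpace ℝ (Fin n)) G) :
    generator W (X + Y) = generator W X + generator W Y := by
  ext a b
  exact (mfderiv 𝓘(ℝ, EuclideanSpace ℝ (Fin n)) 𝓘(ℝ, ℂ)
    (fun g : G => (W g : Matrix (Fin m) (Fin m) ℂ) a b) 1).map_add X Y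

lemma generator_smul (W : G →* Matrix.unitaryGroup (Fin m) ℂ) (c : ℝ)
    (X : GroupLieAlgebra 𝓘(ℝ, EuclideanSpace ℝ (Fin n)) G) :
    generator W (c • X) = c • generator W X := by
  ext a b
  exact (mfderiv 𝓘(ℝ, EuclideanSpace ℝ (Fin n)) 𝓘(ℝ, ℂ)
    (fun g : G => (W g : Matrix (Fin m) (Fin m) ℂ) a b) 1).map_smul c X

/-- The representation of the Lie algebra as a linear map. -/
def generatorLin (W : G →* Matrix.unitaryGroup (Fin m) ℂ) :
    GroupLieAlgebra 𝓘(ℝ, EuclideanSpace ℝ (Fin n)) G →ₗ[ℝ] Matrix (Fin m) (Fin m) ℂ where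
  toFun := generator W
  map_add' := generator_add W
  map_smul' := generator_smul W

/-- Generators of the tensor power representation are the total operators of the generators. -/
lemma hasEntryDeriv_tensorRep {U : G →* Matrix.unitaryGroup (Fin m) ℂ}
    (hU : IsSmoothRep (n := n) U) (N : ℕ)
    (X : GroupLieAlgebra 𝓘(ℝ, EuclideanSpace ℝ (Fin n)) G) :
    HasEntryDeriv (fun t => ((tensorRep U N (chartCurve X t) : Matrix.unitaryGroup _ ℂ) :
      Matrix (Fin N → Fin m) (Fin N → Fin m) ℂ)) (totalOp N (generator U X)) :=
  (hasEntryDeriv_chartCurve hU X).tensorPow N (by simp [chartCurve_zero])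

/-- Along the curve, the tensor power times the invariant projector is constant, so its derivative
vanishes. -/
lemma totalOp_generator_mul_invSector {U : G →* Matrix.unitaryGroup (Fin m) ℂ}
    (hU : IsSmoothRep (n := n) U) (N : ℕ)
    (X : GroupLieAlgebra 𝓘(ℝ, EuclideanSpace ℝ (Fin n)) G) :
    totalOp N (generator U X) * projMatrix (invSector (tensorRep U N)) = 0 := by
  have h := (hasEntryDeriv_tensorRep hU N X).mul_const (projMatrix (invSector (tensorRep U N)))
  simp only [rep_mul_invSector] at h
  exact h.unique (hasEntryDeriv_const _)

lemma totalOp_generator_mul_intertwiner {U : G →* Matrix.unitaryGroup (Fin m) ℂ}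
    (hU : IsSmoothRep (n := n) U) (N : ℕ) {k : ℕ} {J : G →* Matrix.unitaryGroup (Fin k) ℂ}
    (hJ : IsSmoothRep (n := n) J) {T : Matrix (Fin N → Fin m) (Fin k) ℂ}
    (hT : T ∈ intertwinerSpace (tensorRep U N) J)
    (X : GroupLieAlgebra 𝓘(ℝ, EuclideanSpace ℝ (Fin n)) G) :
    totalOp N (generator U X) * T = T * generator J X := by
  have h1 := (hasEntryDeriv_tensorRep hU N X).mul_const T
  have h2 := (hasEntryDeriv_chartCurve hJ X).const_mul T
  simp only [mem_intertwinerSpace.mp hT] at h2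
  exact h1.unique h2

end Generators

/-! ### The derived representation is a Lie algebra homomorphism. -/

section LieHom

variable {n : ℕ} {G : Type*} [TopologicalSpace G] [ChartedSpace (EuclideanSpace ℝ (Fin n)) G]
  [Group G] {m : ℕ}

/-- The matrix coefficient `Re Tr(M W(g))`. -/
def coeffFun (W : G →* Matrix.unitaryGroup (Fin m) ℂ) (M : Matrix (Fin m) (Fin m) ℂ) (g : G) : ℝ :=
  (M * (W g : Matrix (Fin m) (Fin m) ℂ)).trace.re

lemma coeffFun_eq_sum (W : G →* Matrix.unitaryGroup (Fin m) ℂ) (M : Matrix (Fin m) (Fin m) ℂ) :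
    coeffFun W M = fun g => ∑ a, ∑ b,
      (Complex.reCLM ∘L (ContinuousLinearMap.mul ℝ ℂ (M a b)))
        ((W g : Matrix (Fin m) (Fin m) ℂ) b a) := by
  ext g
  simp [coeffFun, Matrix.trace, Matrix.mul_apply, -Complex.mul_re]

lemma coeffFun_one (W : G →* Matrix.unitaryGroup (Fin m) ℂ) (M : Matrix (Fin m) (Fin m) ℂ) :
    coeffFun W M 1 = M.trace.re := by
  simp [coeffFun]

lemma contMDiff_coeffFun {W : G →* Matrix.unitaryGroup (Fin m) ℂ} (hW : IsSmoothRep (n := n) W)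
    (M : Matrix (Fin m) (Fin m) ℂ) :
    ContMDiff 𝓘(ℝ, EuclideanSpace ℝ (Fin n)) 𝓘(ℝ, ℝ) ∞ (coeffFun W M) := by
  rw [coeffFun_eq_sum]
  refine contMDiff_finsetSum fun a _ => contMDiff_finsetSum fun b _ => ?_
  exact (Complex.reCLM ∘L (ContinuousLinearMap.mul ℝ ℂ (M a b))).contMDiff.comp (hW b a)

lemma HasEntryDeriv.trace_re {A : ℝ → Matrix (Fin m) (Fin m) ℂ} {B : Matrix (Fin m) (Fin m) ℂ}
    (h : HasEntryDeriv A B) : HasDerivAt (fun t => (A t).trace.re) B.trace.re 0 :=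
  HasFDerivAt.comp_hasDerivAt (0 : ℝ) Complex.reCLM.hasFDerivAt
    (HasDerivAt.fun_sum fun c _ => h c c)

lemma mvfderiv_coeffFun_one {W : G →* Matrix.unitaryGroup (Fin m) ℂ}
    (hW : IsSmoothRep (n := n) W) (M : Matrix (Fin m) (Fin m) ℂ)
    (X : GroupLieAlgebra 𝓘(ℝ, EuclideanSpace ℝ (Fin n)) G) :
    mvfderiv 𝓘(ℝ, EuclideanSpace ℝ (Fin n)) (coeffFun W M) 1 X = (M * generator W X).trace.re :=
  (hasDerivAt_comp_chartCurve ((contMDiff_coeffFun hW M).mdifferentiable (by simp) 1) X).unique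
    ((hasEntryDeriv_chartCurve hW X).const_mul M).trace_re

open scoped ComplexOrder in
lemma eq_zero_of_trace_mul_conjTranspose_re {D : Matrix (Fin m) (Fin m) ℂ}
    (h : (D * Dᴴ).trace.re = 0) : D = 0 := by
  have h1 := (Matrix.posSemidef_self_mul_conjTranspose D).trace_nonneg
  rw [Complex.le_def] at h1
  exact Matrix.trace_mul_conjTranspose_self_eq_zero_iff.mp (Complex.ext h h1.2.symm)

variable [LieGroup 𝓘(ℝ, EuclideanSpace ℝ (Fin n)) ∞ G]

/-- Translating by g replaces M by M W(g) and moves the question to the identity. The derivative is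
again a coefficient function, so derivatives can be iterated algebraically. -/
lemma mvfderiv_coeffFun {W : G →* Matrix.unitaryGroup (Fin m) ℂ}
    (hW : IsSmoothRep (n := n) W) (M : Matrix (Fin m) (Fin m) ℂ)
    (X : GroupLieAlgebra 𝓘(ℝ, EuclideanSpace ℝ (Fin n)) G) (g : G) :
    mvfderiv 𝓘(ℝ, EuclideanSpace ℝ (Fin n)) (coeffFun W M) g (mulInvariantVectorField X g)
      = coeffFun W (generator W X * M) g := by
  have h1 : coeffFun W M ∘ (g * ·) = coeffFun W (M * (W g : Matrix (Fin m) (Fin m) ℂ)) := by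
    ext h
    simp [coeffFun, Matrix.mul_assoc]
  have h2 := mvfderiv_coeffFun_one hW (M * (W g : Matrix (Fin m) (Fin m) ℂ)) X
  rw [← h1, mvfderiv, mfderiv_comp_of_eq (y := g)
    ((contMDiff_coeffFun hW M).mdifferentiable (by simp) g)
    ((contMDiff_mul_left (I := 𝓘(ℝ, EuclideanSpace ℝ (Fin n))) (n := ∞)).mdifferentiable (by simp) 1)
    (mul_one g)] at h2
  have h3 : (M * (W g : Matrix (Fin m) (Fin m) ℂ) * generator W X).trace.re
      = coeffFun W (generator W X * M) g := by
    rw [coeffFun, Matrix.trace_mul_comm, ← Matrix.mul_assoc]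
  rw [← h3, ← h2]
  -- The tangent spaces at `g * 1` and `g` are formally different fibres, each given by the model
  -- space; the base point is changed there.
  have h4 : ∀ g' : G, g' = g → ∀ v : EuclideanSpace ℝ (Fin n),
      (mvfderiv 𝓘(ℝ, EuclideanSpace ℝ (Fin n)) (coeffFun W M) g : _ → ℝ) v
      = (mvfderiv 𝓘(ℝ, EuclideanSpace ℝ (Fin n)) (coeffFun W M) g' : _ → ℝ) v := by
    rintro _ rfl v
    rfl
  exact h4 (g * 1) (mul_one g) _

open VectorField in
-- Multiplying an invariant field Z by a coefficient function f makes the bracket see the derivative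
-- of f: [X, fZ] = (Xf)Z + f[X, Z].
lemma mlieBracket_coeffFun_smul {W : G →* Matrix.unitaryGroup (Fin m) ℂ}
    (hW : IsSmoothRep (n := n) W) (M : Matrix (Fin m) (Fin m) ℂ)
    (X Z : GroupLieAlgebra 𝓘(ℝ, EuclideanSpace ℝ (Fin n)) G) :
    mlieBracket 𝓘(ℝ, EuclideanSpace ℝ (Fin n)) (mulInvariantVectorField X)
        (coeffFun W M • mulInvariantVectorField Z)
      = coeffFun W (generator W X * M) • mulInvariantVectorField Z
        + coeffFun W M • mulInvariantVectorField ⁅X, Z⁆ := by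
  ext1 g
  rw [mlieBracket_smul_right ((contMDiff_coeffFun hW M).mdifferentiable (by simp) g)
    (mdifferentiableAt_mulInvariantVectorField Z), mvfderiv_coeffFun hW,
    GroupLieAlgebra.bracket_def, mulInvariantVector_mlieBracket]
  rfl

lemma contMDiff_coeffFun_smul {W : G →* Matrix.unitaryGroup (Fin m) ℂ}
    (hW : IsSmoothRep (n := n) W) (M : Matrix (Fin m) (Fin m) ℂ)
    (Z : GroupLieAlgebra 𝓘(ℝ, EuclideanSpace ℝ (Fin n)) G) :
    ContMDiff 𝓘(ℝ, EuclideanSpace ℝ (Fin n)) (𝓘(ℝ, EuclideanSpace ℝ (Fin n)).prod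
        𝓘(ℝ, EuclideanSpace ℝ (Fin n))) (minSmoothness ℝ 2)
      (fun g : G => (⟨g, (coeffFun W M • mulInvariantVectorField Z :
        (g : G) → TangentSpace 𝓘(ℝ, EuclideanSpace ℝ (Fin n)) g) g⟩ :
          TangentBundle 𝓘(ℝ, EuclideanSpace ℝ (Fin n)) G)) :=
  ((contMDiff_coeffFun hW M).of_le (by
    rw [minSmoothness_of_isRCLikeNormedField]
    exact ENat.LEInfty.out)).smul_section (contMDiff_mulInvariantVectorField Z)

open VectorField in
lemma mlieBracket_mlieBracket_coeffFun_smul {W : G →* Matrix.unitaryGroup (Fin m) ℂ}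
    (hW : IsSmoothRep (n := n) W) (M : Matrix (Fin m) (Fin m) ℂ)
    (X Y Z : GroupLieAlgebra 𝓘(ℝ, EuclideanSpace ℝ (Fin n)) G) :
    mlieBracket 𝓘(ℝ, EuclideanSpace ℝ (Fin n)) (mulInvariantVectorField X)
        (mlieBracket 𝓘(ℝ, EuclideanSpace ℝ (Fin n)) (mulInvariantVectorField Y)
          (coeffFun W M • mulInvariantVectorField Z))
      = coeffFun W (generator W X * (generator W Y * M)) • mulInvariantVectorField Z
        + coeffFun W (generator W Y * M) • mulInvariantVectorField ⁅X, Z⁆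
        + (coeffFun W (generator W X * M) • mulInvariantVectorField ⁅Y, Z⁆
        + coeffFun W M • mulInvariantVectorField ⁅X, ⁅Y, Z⁆⁆) := by
  rw [mlieBracket_coeffFun_smul hW]
  ext1 g
  have hm : minSmoothness ℝ 2 ≠ 0 := by
    rw [minSmoothness_of_isRCLikeNormedField]
    exact two_ne_zero
  rw [mlieBracket_add_right ((contMDiff_coeffFun_smul hW _ _).mdifferentiable hm g)
    ((contMDiff_coeffFun_smul hW _ _).mdifferentiable hm g), mlieBracket_coeffFun_smul hW,
    mlieBracket_coeffFun_smul hW]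
  rfl

lemma mfderiv_one_mul : (mfderiv 𝓘(ℝ, EuclideanSpace ℝ (Fin n)) 𝓘(ℝ, EuclideanSpace ℝ (Fin n))
      (fun x : G => 1 * x) 1 : EuclideanSpace ℝ (Fin n) →L[ℝ] EuclideanSpace ℝ (Fin n))
    = ContinuousLinearMap.id ℝ (EuclideanSpace ℝ (Fin n)) := by
  have h : HasMFDerivAt 𝓘(ℝ, EuclideanSpace ℝ (Fin n)) 𝓘(ℝ, EuclideanSpace ℝ (Fin n))
      (fun x : G => 1 * x) 1 (ContinuousLinearMap.id ℝ (EuclideanSpace ℝ (Fin n))) :=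
    (hasMFDerivAt_id (I := 𝓘(ℝ, EuclideanSpace ℝ (Fin n))) (1 : G)).congr_of_eventuallyEq
      (Filter.Eventually.of_forall fun x => one_mul x)
  exact h.mfderiv

lemma mulInvariantVectorField_one (X : GroupLieAlgebra 𝓘(ℝ, EuclideanSpace ℝ (Fin n)) G) :
    mulInvariantVectorField X 1 = X :=
  congrArg (fun L : EuclideanSpace ℝ (Fin n) →L[ℝ] EuclideanSpace ℝ (Fin n) =>
    L (coordVec X)) mfderiv_one_mul

open VectorField in
/-- The derivative of a representation is a Lie algebra homomorphism. -/
lemma generator_lie {W : G →* Matrix.unitaryGroup (Fin m) ℂ}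
    (hW : IsSmoothRep (n := n) W) (X Y : GroupLieAlgebra 𝓘(ℝ, EuclideanSpace ℝ (Fin n)) G) :
    generator W ⁅X, Y⁆ = generator W X * generator W Y - generator W Y * generator W X := by
  by_cases hZ : ∃ Z : GroupLieAlgebra 𝓘(ℝ, EuclideanSpace ℝ (Fin n)) G, Z ≠ 0
  · obtain ⟨Z, hZ⟩ := hZ
    have key : ∀ M : Matrix (Fin m) (Fin m) ℂ,
        (generator W ⁅X, Y⁆ * M).trace.re
          = ((generator W X * generator W Y - generator W Y * generator W X) * M).trace.re := by
      intro M
      -- The Jacobi identity for X, Y and fZ at the identity: after the terms with brackets of Z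
      -- cancel, it says that (XYf - YXf - [X,Y]f)Z = 0.
      have h := leibniz_identity_mlieBracket_apply (x := (1 : G))
        (contMDiff_mulInvariantVectorField X 1) (contMDiff_mulInvariantVectorField Y 1)
        (contMDiff_coeffFun_smul hW M Z 1)
      rw [mlieBracket_mlieBracket_coeffFun_smul hW, mlieBracket_mlieBracket_coeffFun_smul hW,
        ← mulInvariantVector_mlieBracket, ← GroupLieAlgebra.bracket_def,
        mlieBracket_coeffFun_smul hW] at h
      simp only [Pi.add_apply, Pi.smul_apply', mulInvariantVectorField_one, coeffFun_one] at h
      rw [leibniz_lie X Y Z] at h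
      have h2 : ((generator W X * (generator W Y * M)).trace.re
          - (generator W Y * (generator W X * M)).trace.re
          - (generator W ⁅X, Y⁆ * M).trace.re) • Z = 0 := by
        rw [sub_smul, sub_smul, sub_eq_zero, sub_eq_iff_eq_add]
        rw [smul_add] at h
        have := sub_eq_zero.mpr h
        rw [← sub_eq_zero, ← this]
        abel
      have h3 := (smul_eq_zero.mp h2).resolve_right hZ
      rw [Matrix.sub_mul, Matrix.trace_sub, Complex.sub_re, Matrix.mul_assoc, Matrix.mul_assoc]
      linarith
    -- Choosing M as the adjoint of the defect makes its Hilbert-Schmidt norm vanish.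
    have h4 := key (generator W ⁅X, Y⁆
      - (generator W X * generator W Y - generator W Y * generator W X))ᴴ
    rw [← sub_eq_zero, ← Complex.sub_re, ← Matrix.trace_sub, ← Matrix.sub_mul] at h4
    rw [← sub_eq_zero]
    set D := generator W ⁅X, Y⁆
      - (generator W X * generator W Y - generator W Y * generator W X)
    exact eq_zero_of_trace_mul_conjTranspose_re h4
  · push Not at hZ
    have h0 : generator W (0 : GroupLieAlgebra 𝓘(ℝ, EuclideanSpace ℝ (Fin n)) G) = 0 :=
      (generatorLin W).map_zero
    rw [hZ X, hZ Y, hZ ⁅(0 : GroupLieAlgebra 𝓘(ℝ, EuclideanSpace ℝ (Fin n)) G), 0⁆, h0]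
    simp

end LieHom

/-! ### The adjoint action of the group on its Lie algebra. -/

section Adjoint

variable {n : ℕ} {G : Type*} [TopologicalSpace G] [ChartedSpace (EuclideanSpace ℝ (Fin n)) G]
  {m : ℕ}

/-- The derivative of a self-map in the trivialization of tangent spaces by the model space. -/
def coordDeriv (f : G → G) (x : G) : EuclideanSpace ℝ (Fin n) →L[ℝ] EuclideanSpace ℝ (Fin n) :=
  mfderiv 𝓘(ℝ, EuclideanSpace ℝ (Fin n)) 𝓘(ℝ, EuclideanSpace ℝ (Fin n)) f x

lemma coordDeriv_comp {f g : G → G}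
    (hf : ContMDiff 𝓘(ℝ, EuclideanSpace ℝ (Fin n)) 𝓘(ℝ, EuclideanSpace ℝ (Fin n)) ∞ f)
    (hg : ContMDiff 𝓘(ℝ, EuclideanSpace ℝ (Fin n)) 𝓘(ℝ, EuclideanSpace ℝ (Fin n)) ∞ g) (x : G) :
    coordDeriv (f ∘ g) x = (coordDeriv f (g x)).comp (coordDeriv (n := n) g x) :=
  mfderiv_comp x (hf.mdifferentiable (by simp) _) (hg.mdifferentiable (by simp) _)

lemma coordDeriv_id (x : G) :
    coordDeriv (id : G → G) x = ContinuousLinearMap.id ℝ (EuclideanSpace ℝ (Fin n)) :=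
  mfderiv_id

variable [Group G]

/-- Conjugation by a group element. -/
def conjMap (g h : G) : G := g * h * g⁻¹

/-- The adjoint action in coordinates. -/
def adMap (g : G) (X : GroupLieAlgebra 𝓘(ℝ, EuclideanSpace ℝ (Fin n)) G) :
    GroupLieAlgebra 𝓘(ℝ, EuclideanSpace ℝ (Fin n)) G :=
  coordDeriv (conjMap g) 1 (coordVec X)

lemma conjMap_comp (g h : G) : conjMap g ∘ conjMap h = conjMap (g * h) := by
  ext x
  simp [conjMap, mul_assoc]

lemma conjMap_one_left : conjMap (1 : G) = id := by
  ext x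
  simp [conjMap]

lemma conjMap_one (g : G) : conjMap g 1 = 1 := by simp [conjMap]

variable [LieGroup 𝓘(ℝ, EuclideanSpace ℝ (Fin n)) ∞ G]

lemma contMDiff_mulLeft (g : G) : ContMDiff 𝓘(ℝ, EuclideanSpace ℝ (Fin n))
    𝓘(ℝ, EuclideanSpace ℝ (Fin n)) ∞ (g * ·) := contMDiff_mul_left

lemma contMDiff_conjMap (g : G) : ContMDiff 𝓘(ℝ, EuclideanSpace ℝ (Fin n))
    𝓘(ℝ, EuclideanSpace ℝ (Fin n)) ∞ (conjMap g) :=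
  (contMDiff_mul_right (a := g⁻¹)).comp (contMDiff_mulLeft g)

lemma coordDeriv_conjMap_inv (g x : G) :
    (coordDeriv (conjMap g) x).comp (coordDeriv (n := n) (conjMap g⁻¹) (conjMap g x))
      = ContinuousLinearMap.id ℝ (EuclideanSpace ℝ (Fin n)) := by
  have h := coordDeriv_comp (n := n) (contMDiff_conjMap g) (contMDiff_conjMap g⁻¹) (conjMap g x)
  have h1 : conjMap g⁻¹ (conjMap g x) = x := by simp [conjMap, mul_assoc]
  rw [conjMap_comp, mul_inv_cancel, conjMap_one_left, coordDeriv_id, h1] at h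
  exact h.symm

lemma coordDeriv_conjMap_inv' (g x : G) :
    (coordDeriv (n := n) (conjMap g⁻¹) (conjMap g x)).comp (coordDeriv (conjMap g) x)
      = ContinuousLinearMap.id ℝ (EuclideanSpace ℝ (Fin n)) := by
  have h := coordDeriv_comp (n := n) (contMDiff_conjMap g⁻¹) (contMDiff_conjMap g) x
  rw [conjMap_comp, inv_mul_cancel, conjMap_one_left, coordDeriv_id] at h
  exact h.symm

lemma adMap_inv_adMap (g : G) (X : GroupLieAlgebra 𝓘(ℝ, EuclideanSpace ℝ (Fin n)) G) :
    adMap g⁻¹ (adMap g X) = X := by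
  have h := coordDeriv_conjMap_inv' (n := n) g 1
  rw [conjMap_one] at h
  exact DFunLike.congr_fun h (coordVec X)

/-- Conjugation is a group homomorphism, so conjugating after left translation by h is left
translation by the conjugate of h after conjugating. Differentiate this at 1. -/
lemma coordDeriv_conjMap_mulInvariant (g h : G)
    (X : GroupLieAlgebra 𝓘(ℝ, EuclideanSpace ℝ (Fin n)) G) :
    coordDeriv (n := n) (conjMap g) h (mulInvariantVectorField X h)
      = mulInvariantVectorField (adMap g X) (conjMap g h) := by
  have h1 := coordDeriv_comp (n := n) (contMDiff_conjMap g) (contMDiff_mulLeft h) 1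
  have h2 := coordDeriv_comp (n := n) (contMDiff_mulLeft (conjMap g h)) (contMDiff_conjMap g) 1
  have h3 : conjMap g ∘ (h * ·) = (conjMap g h * ·) ∘ conjMap g := by
    ext x
    simp [conjMap, mul_assoc]
  rw [h3, h2, conjMap_one, mul_one] at h1
  exact (DFunLike.congr_fun h1 (coordVec X)).symm

open VectorField in
lemma mpullback_conjMap (g : G) (X : GroupLieAlgebra 𝓘(ℝ, EuclideanSpace ℝ (Fin n)) G) :
    mpullback 𝓘(ℝ, EuclideanSpace ℝ (Fin n)) 𝓘(ℝ, EuclideanSpace ℝ (Fin n)) (conjMap g)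
      (mulInvariantVectorField (adMap g X)) = mulInvariantVectorField X := by
  ext1 h
  rw [mpullback_apply]
  have h1 : (coordDeriv (n := n) (conjMap g) h).inverse
      = coordDeriv (n := n) (conjMap g⁻¹) (conjMap g h) :=
    ContinuousLinearMap.inverse_eq (coordDeriv_conjMap_inv g h) (coordDeriv_conjMap_inv' g h)
  have h2 : (coordDeriv (n := n) (conjMap g) h).inverse
      (coordDeriv (n := n) (conjMap g) h (mulInvariantVectorField X h))
      = mulInvariantVectorField X h := by
    rw [h1]
    exact DFunLike.congr_fun (coordDeriv_conjMap_inv' (n := n) g h) _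
  rw [coordDeriv_conjMap_mulInvariant] at h2
  exact h2

lemma adMap_eq_of_inv (g : G) (X : GroupLieAlgebra 𝓘(ℝ, EuclideanSpace ℝ (Fin n)) G) :
    adMap g (adMap g⁻¹ X) = X := by
  have := adMap_inv_adMap g⁻¹ X
  rwa [inv_inv] at this

open VectorField in
-- Pullback along the diffeomorphism `conjMap g` preserves brackets of vector fields, and it sends
-- the left-invariant field of `adMap g X` to that of X.
lemma adMap_lie (g : G) (X Y : GroupLieAlgebra 𝓘(ℝ, EuclideanSpace ℝ (Fin n)) G) :
    adMap g ⁅X, Y⁆ = ⁅adMap g X, adMap g Y⁆ := by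
  have h := mpullback_mlieBracket (n := ∞) (f := conjMap g) (x₀ := (1 : G))
    (mdifferentiableAt_mulInvariantVectorField (adMap g X))
    (mdifferentiableAt_mulInvariantVectorField (adMap g Y)) (contMDiff_conjMap g 1) (by
      rw [minSmoothness_of_isRCLikeNormedField]
      exact ENat.LEInfty.out)
  rw [mpullback_conjMap, mpullback_conjMap, ← GroupLieAlgebra.bracket_def,
    ← mulInvariantVector_mlieBracket, ← GroupLieAlgebra.bracket_def,
    ← adMap_eq_of_inv g ⁅adMap g X, adMap g Y⁆, mpullback_conjMap,
    mulInvariantVectorField_one] at h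
  rw [← h, adMap_eq_of_inv]

/-- The adjoint action as a Lie algebra automorphism. -/
def adEquiv (g : G) : GroupLieAlgebra 𝓘(ℝ, EuclideanSpace ℝ (Fin n)) G ≃ₗ⁅ℝ⁆
    GroupLieAlgebra 𝓘(ℝ, EuclideanSpace ℝ (Fin n)) G where
  toFun := adMap g
  map_add' X Y := (coordDeriv (n := n) (conjMap g) 1).map_add (coordVec X) (coordVec Y)
  map_smul' c X := (coordDeriv (n := n) (conjMap g) 1).map_smul c (coordVec X)
  map_lie' := adMap_lie g _ _
  invFun := adMap g⁻¹
  left_inv := adMap_inv_adMap g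
  right_inv := adMap_eq_of_inv g

/-- Both sides are the derivative at 0 of the curve W(g γ(t) g⁻¹), by the chain rule and by
multiplicativity respectively. -/
lemma generator_adMap {W : G →* Matrix.unitaryGroup (Fin m) ℂ} (hW : IsSmoothRep (n := n) W)
    (g : G) (X : GroupLieAlgebra 𝓘(ℝ, EuclideanSpace ℝ (Fin n)) G) :
    generator W (adMap g X)
      = (W g : Matrix (Fin m) (Fin m) ℂ) * generator W X * (W g : Matrix (Fin m) (Fin m) ℂ)ᴴ := by
  have h1 := ((hasEntryDeriv_chartCurve hW X).const_mul (W g : Matrix (Fin m) (Fin m) ℂ)).mul_const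
    (W g : Matrix (Fin m) (Fin m) ℂ)ᴴ
  refine HasEntryDeriv.unique (A := fun t => (W (conjMap g (chartCurve X t)) : Matrix _ _ ℂ)) ?_ ?_
  · intro a b
    have h2 : MDifferentiableAt 𝓘(ℝ, EuclideanSpace ℝ (Fin n)) 𝓘(ℝ, ℂ)
        ((fun g : G => (W g : Matrix (Fin m) (Fin m) ℂ) a b) ∘ conjMap g) 1 :=
      (hW.mdifferentiableAt a b _).comp 1 ((contMDiff_conjMap g).mdifferentiable (by simp) 1)
    refine (hasDerivAt_comp_chartCurve h2 X).congr_deriv ?_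
    rw [mfderiv_comp_of_eq (y := 1) (hW.mdifferentiableAt a b _)
      ((contMDiff_conjMap g).mdifferentiable (by simp) 1) (conjMap_one g)]
    have h4 : ∀ g' : G, g' = 1 → ∀ v : EuclideanSpace ℝ (Fin n),
        (mfderiv 𝓘(ℝ, EuclideanSpace ℝ (Fin n)) 𝓘(ℝ, ℂ)
          (fun g : G => (W g : Matrix (Fin m) (Fin m) ℂ) a b) g' : _ → ℂ) v
        = (mfderiv 𝓘(ℝ, EuclideanSpace ℝ (Fin n)) 𝓘(ℝ, ℂ)
          (fun g : G => (W g : Matrix (Fin m) (Fin m) ℂ) a b) 1 : _ → ℂ) v := by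
      rintro _ rfl v
      rfl
    exact h4 _ (conjMap_one g) _
  · simpa [conjMap, ← coe_map_inv] using h1

end Adjoint

/-- A linear map on a semisimple Lie algebra that vanishes on brackets is zero. -/
lemma linearMap_eq_zero_of_lie {L V : Type*} [LieRing L] [LieAlgebra ℝ L]
    [LieAlgebra.IsSemisimple ℝ L] [AddCommGroup V] [Module ℝ V] (f : L →ₗ[ℝ] V)
    (hf : ∀ x y : L, f ⁅x, y⁆ = 0) : f = 0 := by
  -- The kernel is an ideal since f vanishes on all brackets. Each minimal ideal I is nonabelian, so
  -- I = [I, I] lies in it, and the minimal ideals generate L.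
  let K : LieIdeal ℝ L := { LinearMap.ker f with lie_mem := fun {x m} _ => hf x m }
  have hK : ∀ x, x ∈ K ↔ f x = 0 := fun x => Iff.rfl
  have htop : K = ⊤ := by
    rw [eq_top_iff, ← LieAlgebra.IsSemisimple.sSup_atoms_eq_top (R := ℝ) (L := L)]
    refine sSup_le fun I hI => ?_
    have h1 : ⁅I, I⁆ = I := by
      refine (hI.le_iff.mp (LieSubmodule.lie_le_right I I)).resolve_left fun h => ?_
      exact LieAlgebra.IsSemisimple.non_abelian_of_isAtom I hI
        ((LieSubmodule.lie_abelian_iff_lie_self_eq_bot I).mpr h)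
    rw [← h1, LieSubmodule.lie_le_iff]
    exact fun x _ m _ => hf x m
  ext x
  exact (hK x).mp (htop ▸ LieSubmodule.mem_top x)

/-! ### Consequences of connectedness and semisimplicity. -/

section Connected

variable {n : ℕ} {G : Type*} [TopologicalSpace G] [ChartedSpace (EuclideanSpace ℝ (Fin n)) G]

lemma isLocallyConstant_of_mfderiv_eq_zero
    [IsManifold 𝓘(ℝ, EuclideanSpace ℝ (Fin n)) 1 G] {f : G → ℂ}
    (hf : MDifferentiable 𝓘(ℝ, EuclideanSpace ℝ (Fin n)) 𝓘(ℝ, ℂ) f)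
    (h0 : ∀ g, mfderiv 𝓘(ℝ, EuclideanSpace ℝ (Fin n)) 𝓘(ℝ, ℂ) f g = 0) :
    IsLocallyConstant f := by
  rw [IsLocallyConstant.iff_eventually_eq]
  intro x
  set φ := extChartAt 𝓘(ℝ, EuclideanSpace ℝ (Fin n)) x with hφ
  obtain ⟨r, hr, hball⟩ := Metric.mem_nhds_iff.mp (extChartAt_target_mem_nhds
    (I := 𝓘(ℝ, EuclideanSpace ℝ (Fin n))) x)
  have hder : ∀ y ∈ Metric.ball (φ x) r, HasFDerivAt (f ∘ φ.symm)
      (0 : EuclideanSpace ℝ (Fin n) →L[ℝ] ℂ) y := by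
    intro y hy
    have h1 : MDifferentiableAt 𝓘(ℝ, EuclideanSpace ℝ (Fin n)) 𝓘(ℝ, EuclideanSpace ℝ (Fin n))
        φ.symm y :=
      ((contMDiffOn_extChartAt_symm (n := 1) x).contMDiffAt
        (Filter.mem_of_superset (Metric.isOpen_ball.mem_nhds hy) hball)).mdifferentiableAt
        one_ne_zero
    have h2 := (hf (φ.symm y)).hasMFDerivAt.comp y h1.hasMFDerivAt
    rw [h0, ContinuousLinearMap.zero_comp] at h2
    exact hasMFDerivAt_iff_hasFDerivAt.mp h2
  have hconst : ∀ y ∈ Metric.ball (φ x) r, f (φ.symm y) = f x := by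
    intro y hy
    have := (convex_ball (φ x) r).is_const_of_fderivWithin_eq_zero (𝕜 := ℝ) (f := f ∘ φ.symm)
      (fun z hz => (hder z hz).differentiableAt.differentiableWithinAt)
      (fun z hz => (hder z hz).hasFDerivWithinAt.fderivWithin
        (Metric.isOpen_ball.uniqueDiffWithinAt hz)) hy (Metric.mem_ball_self hr)
    rw [Function.comp_apply, Function.comp_apply, hφ, extChartAt_to_inv] at this
    exact this
  filter_upwards [extChartAt_source_mem_nhds (I := 𝓘(ℝ, EuclideanSpace ℝ (Fin n))) x,
    (continuousAt_extChartAt (I := 𝓘(ℝ, EuclideanSpace ℝ (Fin n))) x).preimage_mem_nhds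
      (Metric.ball_mem_nhds _ hr)] with y hy1 hy2
  rw [← hconst _ hy2, hφ, (extChartAt _ x).left_inv hy1]

variable [Group G] [LieGroup 𝓘(ℝ, EuclideanSpace ℝ (Fin n)) ∞ G] [ConnectedSpace G] {m : ℕ}

lemma mulInvariantVectorField_inv_apply (g : G) (v : EuclideanSpace ℝ (Fin n)) :
    ∃ X : GroupLieAlgebra 𝓘(ℝ, EuclideanSpace ℝ (Fin n)) G, mulInvariantVectorField X g = v := by
  have h := coordDeriv_comp (n := n) (contMDiff_mulLeft g) (contMDiff_mulLeft g⁻¹) g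
  have h1 : ((g * ·) ∘ (g⁻¹ * ·) : G → G) = id := by
    ext x
    simp
  rw [h1, coordDeriv_id, inv_mul_cancel] at h
  exact ⟨coordDeriv (n := n) (g⁻¹ * ·) g v, (DFunLike.congr_fun h v).symm⟩

/-- The derivative of a function in the trivialization of tangent spaces by the model space. -/
def coordDiff (f : G → ℂ) (x : G) : EuclideanSpace ℝ (Fin n) →L[ℝ] ℂ :=
  mfderiv 𝓘(ℝ, EuclideanSpace ℝ (Fin n)) 𝓘(ℝ, ℂ) f x

lemma coordDiff_comp {f : G → ℂ} {Φ : G → G}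
    (hf : MDifferentiable 𝓘(ℝ, EuclideanSpace ℝ (Fin n)) 𝓘(ℝ, ℂ) f)
    (hΦ : ContMDiff 𝓘(ℝ, EuclideanSpace ℝ (Fin n)) 𝓘(ℝ, EuclideanSpace ℝ (Fin n)) ∞ Φ) (x : G) :
    coordDiff (f ∘ Φ) x = (coordDiff f (Φ x)).comp (coordDeriv (n := n) Φ x) :=
  mfderiv_comp x (hf _) (hΦ.mdifferentiable (by simp) _)

/-- A smooth representation of a connected Lie group with zero derivative is trivial. -/
lemma rep_eq_one_of_generator_eq_zero {W : G →* Matrix.unitaryGroup (Fin m) ℂ}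
    (hW : IsSmoothRep (n := n) W)
    (h0 : ∀ X : GroupLieAlgebra 𝓘(ℝ, EuclideanSpace ℝ (Fin n)) G, generator W X = 0) (g : G) :
    W g = 1 := by
  have : IsManifold 𝓘(ℝ, EuclideanSpace ℝ (Fin n)) 1 G :=
    IsManifold.of_le (n := ∞) (by exact ENat.LEInfty.out)
  apply Subtype.ext
  ext a b
  have hd : MDifferentiable 𝓘(ℝ, EuclideanSpace ℝ (Fin n)) 𝓘(ℝ, ℂ)
      (fun g : G => (W g : Matrix (Fin m) (Fin m) ℂ) a b) := fun g => hW.mdifferentiableAt a b g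
  have h1 := isLocallyConstant_of_mfderiv_eq_zero hd fun g => by
    ext v
    -- Every tangent vector at g is a left translate of some X at the identity, where the derivative
    -- along X is an entry of W(g) times the generator, hence zero.
    obtain ⟨X, hX⟩ := mulInvariantVectorField_inv_apply g v
    have h2 : coordDiff (n := n) (fun g : G => (W g : Matrix (Fin m) (Fin m) ℂ) a b) g
        (mulInvariantVectorField X g) = 0 := by
      have h3 := coordDiff_comp hd (contMDiff_mulLeft g) 1
      rw [mul_one] at h3
      have h4 := hasDerivAt_comp_chartCurve
        ((hd (g * 1)).comp 1 ((contMDiff_mulLeft g).mdifferentiable (by simp) 1)) X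
      have h5 := (hasEntryDeriv_chartCurve hW X).const_mul (W g : Matrix (Fin m) (Fin m) ℂ) a b
      rw [h0, Matrix.mul_zero, Matrix.zero_apply] at h5
      refine (DFunLike.congr_fun h3 (coordVec X)).symm.trans (h4.unique ?_)
      simpa using h5
    rw [hX] at h2
    exact h2
  have := h1.apply_eq_of_preconnectedSpace g 1
  rwa [map_one] at this

/-- The one-dimensional determinant representation. -/
def detRep {G : Type*} [Group G] (U : G →* Matrix.unitaryGroup (Fin m) ℂ) :
    G →* Matrix.unitaryGroup (Fin 1) ℂ where
  toFun g := ⟨Matrix.of fun _ _ => (U g : Matrix (Fin m) (Fin m) ℂ).det, by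
    rw [Matrix.mem_unitaryGroup_iff]
    have h := congrArg Matrix.det (coe_mul_conjTranspose (U g))
    rw [Matrix.det_mul, Matrix.det_conjTranspose, Matrix.det_one] at h
    ext a b
    rw [Subsingleton.elim b a]
    simpa [Matrix.mul_apply, Matrix.star_apply] using h⟩
  map_one' := by
    apply Subtype.ext
    ext a b
    rw [Subsingleton.elim b a]
    simp
  map_mul' g h := by
    apply Subtype.ext
    ext a b
    rw [Subsingleton.elim b a]
    simp [Matrix.mul_apply]

lemma IsSmoothRep.detRep {U : G →* Matrix.unitaryGroup (Fin m) ℂ} (hU : IsSmoothRep (n := n) U) :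
    IsSmoothRep (n := n) (detRep U) := by
  intro _ _
  have h : ContDiff ℝ ∞ (fun A : Fin m → Fin m → ℂ => (Matrix.of A).det) := by
    simp only [Matrix.det_apply, Matrix.of_apply]
    fun_prop
  exact h.contMDiff.comp (contMDiff_pi_space.mpr fun a => contMDiff_pi_space.mpr fun b => hU a b)

/-- Otherwise the representation is trivial, and an off-diagonal matrix unit lies in its commutant,
against Schur's lemma. -/
lemma exists_generator_ne_zero {U : G →* Matrix.unitaryGroup (Fin m) ℂ}
    (hU : IsSmoothRep (n := n) U) (hirr : IsIrrep U) (hm : 2 ≤ m) :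
    ∃ X : GroupLieAlgebra 𝓘(ℝ, EuclideanSpace ℝ (Fin n)) G, generator U X ≠ 0 := by
  by_contra! h
  have h1 := rep_eq_one_of_generator_eq_zero hU h
  have h2 := eq_trace_smul_one_of_commute hirr
    (A := Matrix.single (⟨0, by omega⟩ : Fin m) ⟨1, by omega⟩ (1 : ℂ)) fun g => by
      rw [h1]
      exact Commute.one_right _
  have h3 := congrFun (congrFun h2 ⟨0, by omega⟩) ⟨1, by omega⟩
  simp at h3

variable [LieAlgebra.IsSemisimple ℝ (GroupLieAlgebra 𝓘(ℝ, EuclideanSpace ℝ (Fin n)) G)]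

/-- Representations of connected semisimple Lie groups have determinant one. -/
lemma det_rep_eq_one {U : G →* Matrix.unitaryGroup (Fin m) ℂ} (hU : IsSmoothRep (n := n) U)
    (g : G) : (U g : Matrix (Fin m) (Fin m) ℂ).det = 1 := by
  -- 1×1 matrices commute, so the derivative of the determinant representation vanishes on brackets.
  have h := linearMap_eq_zero_of_lie (generatorLin (n := n) (SWSSB.detRep U)) fun X Y => by
    refine (generator_lie hU.detRep X Y).trans ?_
    ext a b
    rw [Subsingleton.elim b a, Subsingleton.elim a 0]
    simp [Matrix.mul_apply, mul_comm]
  have h1 := rep_eq_one_of_generator_eq_zero hU.detRep (DFunLike.congr_fun h) g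
  have h2 := congrArg (fun A : Matrix.unitaryGroup (Fin 1) ℂ => (A : Matrix (Fin 1) (Fin 1) ℂ) 0 0) h1
  exact h2

lemma trace_generator {U : G →* Matrix.unitaryGroup (Fin m) ℂ} (hU : IsSmoothRep (n := n) U)
    (X : GroupLieAlgebra 𝓘(ℝ, EuclideanSpace ℝ (Fin n)) G) : (generator U X).trace = 0 := by
  have h := linearMap_eq_zero_of_lie
    ((Matrix.traceLinearMap (Fin m) ℝ ℂ).comp (generatorLin (n := n) U)) fun X Y => by
      change (generator U ⁅X, Y⁆).trace = 0
      rw [generator_lie hU, Matrix.trace_sub, Matrix.trace_mul_comm, sub_self]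
  exact DFunLike.congr_fun h X

end Connected

/-! ### Antisymmetric states: invariant vectors exist for infinitely many sizes. -/

section Determinant

variable {d : ℕ}

/-- Expand the determinant multilinearly in the rows of A. -/
lemma sum_prod_mul_det (A : Matrix (Fin d) (Fin d) ℂ) :
    ∑ t : Fin d → Fin d, (∏ i, A i (t i)) * ((1 : Matrix (Fin d) (Fin d) ℂ).submatrix t id).det
      = A.det := by
  have h := (Matrix.detRowAlternating (n := Fin d) (R := ℂ)).toMultilinearMap.map_sum
    (fun i j => A i j • (1 : Matrix (Fin d) (Fin d) ℂ) j)
  have h1 : (fun i => ∑ j, A i j • (1 : Matrix (Fin d) (Fin d) ℂ) j) = A := by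
    ext i k
    simp [Finset.sum_apply, Matrix.one_apply]
  rw [h1] at h
  refine Eq.trans (Finset.sum_congr rfl fun t _ => ?_) h.symm
  rw [MultilinearMap.map_smul_univ]
  rfl

variable {k : ℕ}

/-- The product of `k` totally antisymmetric states of `d` qudits of dimension `d`. -/
def detVector (k d : ℕ) : EuclideanSpace ℂ (Fin (k * d) → Fin d) :=
  WithLp.toLp 2 fun s => ∏ b, ((1 : Matrix (Fin d) (Fin d) ℂ).submatrix
    (fun i => s (finProdFinEquiv (b, i))) id).det

/-- Each block of d qudits carries the determinant line, so it contributes one factor det A. -/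
lemma tensorPow_detVector (A : Matrix (Fin d) (Fin d) ℂ) :
    Matrix.toEuclideanLin (tensorPow (k * d) A) (detVector k d)
      = (A.det) ^ k • detVector k d := by
  ext s
  have hs : ∀ b : Fin k, (A.submatrix (fun i => s (finProdFinEquiv (b, i))) id).det
      = ((1 : Matrix (Fin d) (Fin d) ℂ).submatrix
        (fun i => s (finProdFinEquiv (b, i))) id).det * A.det := by
    intro b
    rw [← Matrix.det_mul]
    congr 1
    ext i j
    simp [Matrix.mul_apply, Matrix.one_apply]
  have hR : (A.det ^ k • detVector k d) s
      = ∏ b : Fin k, (A.submatrix (fun i => s (finProdFinEquiv (b, i))) id).det := by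
    simp only [hs, Finset.prod_mul_distrib, Finset.prod_const, Finset.card_univ, Fintype.card_fin]
    simp [detVector, mul_comm]
  rw [hR]
  simp only [← sum_prod_mul_det (A.submatrix _ id)]
  rw [Finset.prod_univ_sum, Fintype.piFinset_univ]
  have hL : Matrix.toEuclideanLin (tensorPow (k * d) A) (detVector k d) s
      = ∑ t, tensorPow (k * d) A s t * detVector k d t := rfl
  rw [hL]
  refine (Fintype.sum_equiv ((Equiv.curry (Fin k) (Fin d) (Fin d)).symm.trans
    (Equiv.arrowCongr finProdFinEquiv (Equiv.refl _))) _ _ fun p => ?_).symm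
  rw [Finset.prod_mul_distrib]
  congr 1
  · rw [← Fintype.prod_prod_type']
    refine Fintype.prod_equiv finProdFinEquiv _ _ fun x => ?_
    simp [Equiv.arrowCongr, Function.uncurry]
  · refine Finset.prod_congr rfl fun b _ => ?_
    congr 2
    ext i
    simp [Equiv.arrowCongr]

variable {G : Type*} [Group G] {U : G →* Matrix.unitaryGroup (Fin d) ℂ}

lemma mul_mem_mmisSizes (hU : ∀ g, (U g : Matrix (Fin d) (Fin d) ℂ).det = 1) (k : ℕ) :
    k * d ∈ mmisSizes U := by
  intro h
  have hmem : detVector k d ∈ invSector (tensorRep U (k * d)) := fun g => by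
    rw [toRep_apply, coe_tensorRep, tensorPow_detVector, hU, one_pow, one_smul]
  rw [h, Submodule.mem_bot] at hmem
  -- On the basis vector that enumerates 0, …, d-1 within each block, every factor is the
  -- determinant of the identity.
  have h1 : detVector k d (fun x => (finProdFinEquiv.symm x).2) = 1 := by
    simp only [detVector, Equiv.symm_apply_apply]
    refine Finset.prod_eq_one fun b _ => ?_
    rw [← Matrix.det_one (n := Fin d) (R := ℂ)]
    rfl
  rw [hmem] at h1
  exact zero_ne_one h1

lemma mmisSizes_infinite (hU : ∀ g, (U g : Matrix (Fin d) (Fin d) ℂ).det = 1) (hd : 0 < d) :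
    (mmisSizes U).Infinite :=
  Set.infinite_of_injective_forall_mem (f := fun k => k * d)
    (fun _ _ h => Nat.eq_of_mul_eq_mul_right hd h) (mul_mem_mmisSizes hU)

end Determinant

/-! ### Multiplets from invariant forms, and their scalar Casimir operators. -/

section Multiplets

variable {d : ℕ} {G : Type*} [Group G] {U : G →* Matrix.unitaryGroup (Fin d) ℂ}
  {A : Type*} [Fintype A] [DecidableEq A]

/-- A change of frame preserving a form with Gram matrix s·1 is orthogonal. The sign of s is
immaterial; it is -1 for the Killing form, 1 for an inner product and 1/2 for the spin operators. -/
lemma mul_transpose_eq_one_of_form {V : Type*} [AddCommGroup V] [Module ℝ V]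
    (B : V →ₗ[ℝ] V →ₗ[ℝ] ℝ) {s : ℝ} (hs : s ≠ 0) {x : A → V}
    (hx : ∀ α β, B (x α) (x β) = if α = β then s else 0) {R : Matrix A A ℝ}
    (h : ∀ α β, B (∑ γ, R α γ • x γ) (∑ γ, R β γ • x γ) = B (x α) (x β)) : R * Rᵀ = 1 := by
  ext α β
  have h1 := h α β
  simp only [map_sum, map_smul, LinearMap.sum_apply, LinearMap.smul_apply, hx, smul_eq_mul,
    mul_ite, mul_zero] at h1
  rw [Matrix.mul_apply, Matrix.one_apply]
  apply mul_right_cancel₀ hs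
  rw [Finset.sum_mul, ite_mul, one_mul, zero_mul, ← h1]
  refine Finset.sum_congr rfl fun γ _ => ?_
  simp [Matrix.transpose_apply]
  ring

lemma isMultiplet_of_orthogonal {O : A → Matrix (Fin d) (Fin d) ℂ} (R : G → Matrix A A ℝ)
    (hR : ∀ g, R g * (R g)ᵀ = 1)
    (h : ∀ g α, (U g : Matrix (Fin d) (Fin d) ℂ) * O α * (U g : Matrix (Fin d) (Fin d) ℂ)ᴴ
      = ∑ β, R g α β • O β) : IsMultiplet U O := by
  refine ⟨fun g => ⟨(R g).map Complex.ofRealHom, ?_⟩, fun g α => ?_⟩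
  · rw [Matrix.mem_unitaryGroup_iff]
    have h1 := congrArg (fun M : Matrix A A ℝ => M.map Complex.ofRealHom) (hR g)
    rw [Matrix.map_mul, Matrix.map_one _ (map_zero _) (map_one _)] at h1
    rw [← h1]
    congr 1
    ext a b
    simp [Matrix.star_apply]
  · rw [h]
    refine Finset.sum_congr rfl fun β _ => ?_
    ext a b
    simp

lemma sum_mul_conjTranspose_commute {O : A → Matrix (Fin d) (Fin d) ℂ} (hO : IsMultiplet U O)
    (g : G) : Commute (∑ α, O α * (O α)ᴴ) (U g : Matrix (Fin d) (Fin d) ℂ) := by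
  obtain ⟨R, hR⟩ := hO
  have h1 : (U g : Matrix (Fin d) (Fin d) ℂ) * (∑ α, O α * (O α)ᴴ)
      * (U g : Matrix (Fin d) (Fin d) ℂ)ᴴ = ∑ α, O α * (O α)ᴴ := by
    have h2 : ∀ α, (U g : Matrix (Fin d) (Fin d) ℂ) * (O α * (O α)ᴴ)
        * (U g : Matrix (Fin d) (Fin d) ℂ)ᴴ
        = (∑ β, (R g : Matrix A A ℂ) α β • O β) * (∑ β, (R g : Matrix A A ℂ) α β • O β)ᴴ := by
      intro α
      rw [← hR, Matrix.conjTranspose_mul, Matrix.conjTranspose_mul,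
        Matrix.conjTranspose_conjTranspose]
      simp only [Matrix.mul_assoc]
      rw [← Matrix.mul_assoc (U g : Matrix (Fin d) (Fin d) ℂ)ᴴ (U g : Matrix (Fin d) (Fin d) ℂ),
        conjTranspose_mul_coe, Matrix.one_mul]
    rw [Finset.mul_sum, Finset.sum_mul, Finset.sum_congr rfl fun α _ => h2 α]
    simp only [Matrix.conjTranspose_sum, Matrix.conjTranspose_smul, Finset.sum_mul_sum,
      Matrix.smul_mul, Matrix.mul_smul, smul_smul]
    rw [Finset.sum_comm]
    have h3 : ∀ β γ, ∑ α, star ((R g : Matrix A A ℂ) α γ) * (R g : Matrix A A ℂ) α β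
        = if β = γ then 1 else 0 := by
      intro β γ
      have := congrFun (congrFun (conjTranspose_mul_coe (R g)) γ) β
      rw [Matrix.mul_apply, Matrix.one_apply] at this
      simp only [Matrix.conjTranspose_apply, eq_comm] at this ⊢
      exact this
    refine Finset.sum_congr rfl fun β _ => ?_
    rw [Finset.sum_comm]
    rw [Finset.sum_congr rfl fun γ _ => (Finset.sum_smul (s := Finset.univ)).symm]
    rw [Finset.sum_eq_single β (fun γ _ hγ => by
      have := h3 β γ
      rw [if_neg hγ.symm] at this
      rw [this, zero_smul]) (fun h => absurd (Finset.mem_univ β) h)]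
    have := h3 β β
    rw [if_pos rfl] at this
    rw [this, one_smul]
  have h4 := congrArg (· * (U g : Matrix (Fin d) (Fin d) ℂ)) h1
  simp only [Matrix.mul_assoc, conjTranspose_mul_coe, Matrix.mul_one] at h4
  exact h4.symm

open scoped ComplexOrder in
-- The sum commutes with an irreducible representation, so it is scalar; its trace is a sum of
-- squared norms, positive once some O_α is nonzero.
lemma exists_sum_mul_conjTranspose_eq {O : A → Matrix (Fin d) (Fin d) ℂ} (hirr : IsIrrep U)
    (hO : IsMultiplet U O) (h0 : ∃ α, O α ≠ 0) :
    ∃ c : ℝ, 0 < c ∧ ∑ α, O α * (O α)ᴴ = (c : ℂ) • 1 := by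
  have h1 := eq_trace_smul_one_of_commute hirr (sum_mul_conjTranspose_commute hO)
  have hpos : ∀ α, 0 ≤ (O α * (O α)ᴴ).trace := fun α =>
    (Matrix.posSemidef_self_mul_conjTranspose (O α)).trace_nonneg
  have hd : 0 < d := by
    have := nonempty_of_isIrrep hirr
    exact Fin.pos_iff_nonempty.mpr this
  have ht : 0 < (∑ α, O α * (O α)ᴴ).trace := by
    rw [Matrix.trace_sum]
    obtain ⟨α, hα⟩ := h0
    refine Finset.sum_pos' (fun β _ => hpos β) ⟨α, Finset.mem_univ α, (hpos α).lt_of_ne' ?_⟩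
    exact fun h => hα (Matrix.trace_mul_conjTranspose_self_eq_zero_iff.mp h)
  have hre := Complex.pos_iff.mp ht
  refine ⟨(∑ α, O α * (O α)ᴴ).trace.re / d, div_pos hre.1 (by exact_mod_cast hd), ?_⟩
  have h2 : ((((∑ α, O α * (O α)ᴴ).trace.re / d : ℝ) : ℂ))
      = (∑ α, O α * (O α)ᴴ).trace / Fintype.card (Fin d) := by
    rw [Fintype.card_fin, Complex.ofReal_div, Complex.ofReal_natCast]
    congr 1
    exact Complex.ext rfl hre.2
  rw [h2]
  exact h1

end Multiplets

/-! ### SW-SSB and the Casimir decomposition for semisimple Lie groups. -/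

section LieMMIS

variable {n : ℕ} {G : Type*} [TopologicalSpace G] [ChartedSpace (EuclideanSpace ℝ (Fin n)) G]
  [Group G] {d m : ℕ} {A : Type*} [Fintype A] [DecidableEq A]

/-- Irreducible representations occurring in tensor powers of a smooth representation are smooth. -/
lemma isSmoothRep_of_sector_ne_bot {U : G →* Matrix.unitaryGroup (Fin d) ℂ}
    (hU : IsSmoothRep (n := n) U) {N : ℕ} {J : G →* Matrix.unitaryGroup (Fin m) ℂ}
    (hJ : IsIrrep J) (h : sector (tensorRep U N) J ≠ ⊥) : IsSmoothRep (n := n) J := by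
  obtain ⟨T, hT, hTT, hP⟩ := exists_orthonormal_intertwiners (tensorRep U N) hJ
  have hne : Nonempty (Fin (mult (tensorRep U N) J)) := by
    by_contra hempty
    rw [not_nonempty_iff] at hempty
    rw [Fintype.sum_empty] at hP
    apply h
    rw [Submodule.eq_bot_iff]
    intro v hv
    rw [← projMatrix_apply_eq_iff, hP] at hv
    rw [← hv]
    simp
  obtain ⟨a⟩ := hne
  -- J is a compression of the tensor power by an isometric intertwiner, so its entries are
  -- polynomials in those of U.
  have hJT : ∀ g, (J g : Matrix (Fin m) (Fin m) ℂ)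
      = (T a)ᴴ * tensorPow N (U g : Matrix (Fin d) (Fin d) ℂ) * T a := by
    intro g
    have h1 := hTT a a
    rw [if_pos rfl] at h1
    rw [Matrix.mul_assoc, ← coe_tensorRep, ← mem_intertwinerSpace.mp (hT a) g,
      ← Matrix.mul_assoc, h1, Matrix.one_mul]
  intro p q
  have hsm : ContDiff ℝ ∞ (fun A : Fin d → Fin d → ℂ =>
      ∑ t, (∑ s, (T a)ᴴ p s * ∏ i, A (s i) (t i)) * T a t q) := by
    fun_prop
  have h2 : ContMDiff 𝓘(ℝ, EuclideanSpace ℝ (Fin n)) 𝓘(ℝ, ℂ) ∞ (fun g : G =>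
      ∑ t, (∑ s, (T a)ᴴ p s * ∏ i, (U g : Matrix (Fin d) (Fin d) ℂ) (s i) (t i)) * T a t q) :=
    hsm.contMDiff.comp (contMDiff_pi_space.mpr fun a => contMDiff_pi_space.mpr fun b => hU a b)
  refine h2.congr fun g => ?_
  rw [hJT g]
  simp only [Matrix.mul_apply, tensorPow, Matrix.of_apply]

lemma casimirOp_eq {U : G →* Matrix.unitaryGroup (Fin m) ℂ} (hU : IsSmoothRep (n := n) U)
    (X : A → GroupLieAlgebra 𝓘(ℝ, EuclideanSpace ℝ (Fin n)) G) :
    casimirOp X U = ∑ α, generator U (X α) * (generator U (X α))ᴴ := by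
  simp only [generator_conjTranspose hU, mul_neg, Finset.sum_neg_distrib, casimirOp]

variable [LieGroup 𝓘(ℝ, EuclideanSpace ℝ (Fin n)) ∞ G]

/-- The adjoint action permutes the generators linearly, and its matrix in a Killing-orthonormal
basis is orthogonal because automorphisms preserve the Killing form. -/
lemma isMultiplet_generator {U : G →* Matrix.unitaryGroup (Fin m) ℂ} (hU : IsSmoothRep (n := n) U)
    {X : Module.Basis A ℝ (GroupLieAlgebra 𝓘(ℝ, EuclideanSpace ℝ (Fin n)) G)}
    (hX : IsKillingOrthonormal X) : IsMultiplet U (fun α => generator U (X α)) := by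
  have hexp : ∀ (g : G) α, adEquiv g (X α) = ∑ β, X.repr (adEquiv g (X α)) β • X β :=
    fun g α => (X.sum_repr _).symm
  refine isMultiplet_of_orthogonal (fun g => Matrix.of fun α β => X.repr (adEquiv g (X α)) β)
    (fun g => ?_) fun g α => ?_
  · refine mul_transpose_eq_one_of_form
      (killingForm ℝ (GroupLieAlgebra 𝓘(ℝ, EuclideanSpace ℝ (Fin n)) G)) (s := -1) (by norm_num)
      (x := X) hX fun α β => ?_
    simp only [Matrix.of_apply]
    rw [← hexp, ← hexp, LieAlgebra.killingForm_of_equiv_apply]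
  · rw [← generator_adMap hU]
    change generatorLin U (adEquiv g (X α)) = _
    rw [hexp, map_sum]
    simp only [map_smul]
    rfl

open scoped ComplexOrder in
lemma casimirOp_eq_smul_one {U : G →* Matrix.unitaryGroup (Fin m) ℂ}
    (hU : IsSmoothRep (n := n) U) (hirr : IsIrrep U)
    {X : Module.Basis A ℝ (GroupLieAlgebra 𝓘(ℝ, EuclideanSpace ℝ (Fin n)) G)}
    (hX : IsKillingOrthonormal X) : casimirOp X U = (casimirValue X U : ℂ) • 1 := by
  have h1 := eq_trace_smul_one_of_commute hirr
    (sum_mul_conjTranspose_commute (isMultiplet_generator hU hX))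
  rw [← casimirOp_eq hU] at h1
  have h0 : 0 ≤ (casimirOp X U).trace := by
    rw [casimirOp_eq hU, Matrix.trace_sum]
    exact Finset.sum_nonneg fun α _ => (Matrix.posSemidef_self_mul_conjTranspose _).trace_nonneg
  have h2 : (casimirValue X U : ℂ) = (casimirOp X U).trace / Fintype.card (Fin m) := by
    rw [casimirValue, Fintype.card_fin, Complex.ofReal_div, Complex.ofReal_natCast]
    congr 1
    exact Complex.ext rfl (Complex.nonneg_iff.mp h0).2
  rw [h2]
  exact h1

section Decomposition

variable {U : G →* Matrix.unitaryGroup (Fin d) ℂ}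
  {X : Module.Basis A ℝ (GroupLieAlgebra 𝓘(ℝ, EuclideanSpace ℝ (Fin n)) G)}
  {K : Type*} [Fintype K] [DecidableEq K] {k : K → ℕ}
  {J : ∀ a, G →* Matrix.unitaryGroup (Fin (k a)) ℂ}

/-- The Casimir of the pair is the two one-site Casimirs plus a cross term, just as S₁·S₂ is
obtained from the total spin. -/
lemma neg_sum_totalOp_sq (hU : IsSmoothRep (n := n) U) (hirr : IsIrrep U)
    (hX : IsKillingOrthonormal X) :
    -∑ α, totalOp 2 (generator U (X α)) * totalOp 2 (generator U (X α))
      = (2 * casimirValue X U : ℂ) • (1 : Matrix (Fin 2 → Fin d) (Fin 2 → Fin d) ℂ)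
        + (2 : ℂ) • quadOp (fun α => generator U (X α)) 0 1 := by
  have h1 : ∀ α, totalOp 2 (generator U (X α)) * totalOp 2 (generator U (X α))
      = siteOp 0 (generator U (X α) * generator U (X α))
        + siteOp 1 (generator U (X α) * generator U (X α))
        + (2 : ℂ) • (siteOp 0 (generator U (X α)) * siteOp 1 (generator U (X α))) := by
    intro α
    have hc := siteOp_commute (zero_ne_one : (0 : Fin 2) ≠ 1) (generator U (X α))
      (generator U (X α))
    simp only [totalOp, Fin.sum_univ_two, mul_add, add_mul, ← hc.eq, siteOp_mul, two_smul]
    abel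
  have h2 : ∀ i : Fin 2, ∑ α, siteOp i (generator U (X α) * generator U (X α))
      = -((casimirValue X U : ℂ) • 1) := by
    intro i
    rw [← siteOp_sum, ← neg_eq_iff_eq_neg, ← siteOp_one i, ← siteOp_smul,
      ← casimirOp_eq_smul_one hU hirr hX, ← siteOp_neg]
    rfl
  rw [quadOp_eq_neg_sum (generator_conjTranspose hU <| X ·)]
  simp only [h1, Finset.sum_add_distrib, h2, ← Finset.smul_sum]
  module

/-- On each copy of J the pair Casimir acts as the scalar c_J; solving c_J = 2c_V + 2Q for Q gives
the coefficient. -/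
lemma quadOp_eq_sum_sector (hU : IsSmoothRep (n := n) U) (hirr : IsIrrep U)
    (hX : IsKillingOrthonormal X) (hJ : ListsIrreps (tensorRep U 2) k J) :
    quadOp (fun α => generator U (X α)) 0 1
      = ∑ a, (((casimirValue X (J a) - 2 * casimirValue X U) / 2 : ℝ) : ℂ)
          • projMatrix (sector (tensorRep U 2) (J a)) := by
  rw [← Matrix.mul_one (quadOp _ 0 1), ← sum_projMatrix_sector hJ, Finset.mul_sum]
  refine Finset.sum_congr rfl fun a _ => ?_
  rw [← Matrix.one_mul (projMatrix (sector (tensorRep U 2) (J a))), ← Matrix.smul_mul,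
    Matrix.one_mul]
  refine mul_projMatrix_sector_eq fun T hT => ?_
  have hs := isSmoothRep_of_sector_ne_bot hU (hJ.irrep a) (hJ.occurs a)
  have h1 : (-∑ α, totalOp 2 (generator U (X α)) * totalOp 2 (generator U (X α))) * T
      = (casimirValue X (J a) : ℂ) • T := by
    rw [Matrix.neg_mul, Matrix.sum_mul]
    have h2 : ∀ α, totalOp 2 (generator U (X α)) * totalOp 2 (generator U (X α)) * T
        = T * (generator (J a) (X α) * generator (J a) (X α)) := by
      intro α
      rw [Matrix.mul_assoc, totalOp_generator_mul_intertwiner hU 2 hs hT, ← Matrix.mul_assoc,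
        totalOp_generator_mul_intertwiner hU 2 hs hT, Matrix.mul_assoc]
    simp only [h2]
    rw [← Matrix.mul_sum, ← Matrix.mul_neg]
    change T * casimirOp X (J a) = _
    rw [casimirOp_eq_smul_one hs (hJ.irrep a) hX, Matrix.mul_smul, Matrix.mul_one]
  rw [neg_sum_totalOp_sq hU hirr hX, Matrix.add_mul, Matrix.smul_mul, Matrix.smul_mul,
    Matrix.one_mul] at h1
  rw [Matrix.smul_mul, Matrix.one_mul]
  have h3 : ∀ (Y : Matrix (Fin 2 → Fin d) (Fin (k a)) ℂ) (p q : ℂ),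
      (2 * p) • T + (2 : ℂ) • Y = q • T → Y = ((q - 2 * p) / 2) • T := by
    intro Y p q h
    have h4 : Y = (1 / 2 : ℂ) • ((2 : ℂ) • Y) := by
      rw [smul_smul]
      norm_num
    rw [h4, eq_sub_of_add_eq' h]
    module
  rw [Complex.ofReal_div, Complex.ofReal_sub, Complex.ofReal_mul, Complex.ofReal_ofNat]
  exact h3 _ _ _ h1

lemma quadOp_eq_sum_pairOp (hU : IsSmoothRep (n := n) U) (hirr : IsIrrep U)
    (hX : IsKillingOrthonormal X) (hJ : ListsIrreps (tensorRep U 2) k J) {N : ℕ} {i j : Fin N}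
    (h : i ≠ j) :
    quadOp (fun α => generator U (X α)) i j
      = ∑ a, (((casimirValue X (J a) - 2 * casimirValue X U) / 2 : ℝ) : ℂ)
          • pairOp i j (projMatrix (sector (tensorRep U 2) (J a))) := by
  rw [← pairAlg_quadOp h, quadOp_eq_sum_sector hU hirr hX hJ, map_sum]
  simp only [map_smul]
  rfl

/-- In |Q| the coefficients are replaced by their absolute values, since the sector projectors are
orthogonal and sum to 1. The weight of each sector comes from `trace_invSector_mul_pairOp`, divided
by the dimension of the invariant space. -/
lemma fidelityCorr_mmis_eq_sum (hU : IsSmoothRep (n := n) U) (hirr : IsIrrep U)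
    (hX : IsKillingOrthonormal X) (hJ : ListsIrreps (tensorRep U 2) k J) {N : ℕ} {i j : Fin N}
    (h : i ≠ j) :
    fidelityCorr (mmis U N) (fun α => generator U (X α)) i j
      = ∑ a, |(casimirValue X (J a) - 2 * casimirValue X U) / 2|
          * ((mult (tensorRep U 2) (J a) : ℝ)
              * (mult (tensorRep U (N - 2)) (conjRep (J a)) : ℝ)
            / (Module.finrank ℂ (invSector (tensorRep U N)) : ℝ)) := by
  rw [fidelityCorr_mmis (isMultiplet_generator hU hX) h, ← pairAlg_quadOp h,
    quadOp_eq_sum_sector hU hirr hX hJ, matAbs_pairAlg, matAbs_sum_smul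
      (fun a => projMatrix_posSemidef _) (fun a => projMatrix_mul_self _)
      (fun a b hab => projMatrix_sector_mul_sector (hJ.irrep a) (hJ.irrep b)
        fun hne => hab (hJ.inequivalent b a hne).symm), map_sum, Finset.mul_sum,
    Matrix.trace_sum, Complex.re_sum]
  refine Finset.sum_congr rfl fun a _ => ?_
  rw [map_smul, pairAlg_apply, mmis, maxMixed, Matrix.mul_smul, Matrix.smul_mul,
    Matrix.trace_smul, Matrix.trace_smul, trace_invSector_mul_pairOp U (hJ.irrep a) h,
    trace_projMatrix, smul_eq_mul, smul_eq_mul, Complex.re_ofReal_mul]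
  congr 1
  have : (((Module.finrank ℂ (invSector (tensorRep U N)) : ℂ))⁻¹
      * ((mult (tensorRep U 2) (J a) : ℂ) * mult (tensorRep U (N - 2)) (conjRep (J a))))
      = (((mult (tensorRep U 2) (J a) : ℝ)
              * (mult (tensorRep U (N - 2)) (conjRep (J a)) : ℝ)
            / (Module.finrank ℂ (invSector (tensorRep U N)) : ℝ) : ℝ) : ℂ) := by
    push_cast
    ring
  rw [this, Complex.ofReal_re]

end Decomposition

/-- By Schur's lemma a symmetric operator is scalar, while the span of the generators is traceless.
-/
lemma isCharged_of_generators [ConnectedSpace G]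
    [LieAlgebra.IsSemisimple ℝ (GroupLieAlgebra 𝓘(ℝ, EuclideanSpace ℝ (Fin n)) G)]
    {U : G →* Matrix.unitaryGroup (Fin d) ℂ} (hU : IsSmoothRep (n := n) U) (hirr : IsIrrep U)
    {O : A → Matrix (Fin d) (Fin d) ℂ}
    (hO : ∀ α, ∃ X : GroupLieAlgebra 𝓘(ℝ, EuclideanSpace ℝ (Fin n)) G, generator U X = O α) :
    IsCharged U O := by
  intro B hB hsym
  have ht : B.trace = 0 := by
    have hle : Submodule.span ℂ (Set.range O)
        ≤ LinearMap.ker (Matrix.traceLinearMap (Fin d) ℂ ℂ) := by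
      rw [Submodule.span_le]
      rintro _ ⟨α, rfl⟩
      obtain ⟨X, hX⟩ := hO α
      rw [← hX]
      exact trace_generator hU X
    exact hle hB
  rw [eq_trace_smul_one_of_commute hirr (A := B) fun g => ?_, ht, zero_div, zero_smul]
  have h1 := congrArg (· * (U g : Matrix (Fin d) (Fin d) ℂ)) (hsym g)
  simp only [Matrix.mul_assoc, conjTranspose_mul_coe, Matrix.mul_one] at h1
  exact h1.symm

/-- A multiplet of generators of a compact connected semisimple group detects SW-SSB. -/
lemma detectsSWSSB_of_generators [ConnectedSpace G]
    [LieAlgebra.IsSemisimple ℝ (GroupLieAlgebra 𝓘(ℝ, EuclideanSpace ℝ (Fin n)) G)]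
    {U : G →* Matrix.unitaryGroup (Fin d) ℂ} (hU : IsSmoothRep (n := n) U) (hirr : IsIrrep U)
    (hd : 0 < d) {O : A → Matrix (Fin d) (Fin d) ℂ}
    (hO : ∀ α, ∃ X : GroupLieAlgebra 𝓘(ℝ, EuclideanSpace ℝ (Fin n)) G, generator U X = O α)
    (hm : IsMultiplet U O) (h0 : ∃ α, O α ≠ 0) :
    DetectsSWSSB U (mmisSizes U) (mmis U) O := by
  have ha : ∀ α, (O α)ᴴ = -O α := fun α => by
    obtain ⟨X, hX⟩ := hO α
    rw [← hX, generator_conjTranspose hU]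
  have hk : ∀ N α, totalOp N (O α) * projMatrix (invSector (tensorRep U N)) = 0 := fun N α => by
    obtain ⟨X, hX⟩ := hO α
    rw [← hX, totalOp_generator_mul_invSector hU]
  obtain ⟨c, hc, hcas⟩ := exists_sum_mul_conjTranspose_eq hirr hm h0
  obtain ⟨a, b, ha0, hab⟩ := exists_fidelityCorr_mmis_bounds hm ha hc hcas hk
  refine detectsSWSSB_mmis (mmisSizes_infinite (det_rep_eq_one hU) hd) hm
    (isCharged_of_generators hU hirr hO) hcas (fun N α => ?_) ha0
    fun N hN i j h => (hab N hN i j h).1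
  rw [ha, totalOp_neg, Matrix.neg_mul, hk, neg_zero]

/-- The range of the derived representation has a basis which is a multiplet. -/
lemma exists_generator_multiplet {U : G →* Matrix.unitaryGroup (Fin d) ℂ}
    (hU : IsSmoothRep (n := n) U)
    (h0 : ∃ X : GroupLieAlgebra 𝓘(ℝ, EuclideanSpace ℝ (Fin n)) G, generator U X ≠ 0) :
    ∃ (r : ℕ) (O : Fin r → Matrix (Fin d) (Fin d) ℂ),
      (∀ α, ∃ X : GroupLieAlgebra 𝓘(ℝ, EuclideanSpace ℝ (Fin n)) G, generator U X = O α) ∧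
      IsMultiplet U O ∧ ∃ α, O α ≠ 0 := by
  set e := (vecMatrixEquiv (Fin d) (Fin d)).restrictScalars ℝ with he
  -- The image of the Lie algebra, with the real Hilbert-Schmidt inner product. Conjugation by U(g)
  -- preserves both, so an orthonormal basis is a multiplet, with no appeal to the Killing form.
  set S : Submodule ℝ (EuclideanSpace ℂ (Fin d × Fin d)) :=
    LinearMap.range ((e.symm : Matrix (Fin d) (Fin d) ℂ →ₗ[ℝ] _).comp (generatorLin (n := n) U))
    with hS
  have hmem : ∀ X, e.symm (generator (n := n) U X) ∈ S := fun X => ⟨X, rfl⟩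
  set b := stdOrthonormalBasis ℝ S with hb
  have hgen : ∀ α, ∃ X : GroupLieAlgebra 𝓘(ℝ, EuclideanSpace ℝ (Fin n)) G,
      generator U X = e (b α : EuclideanSpace ℂ (Fin d × Fin d)) := by
    intro α
    obtain ⟨X, hX⟩ := (b α).2
    refine ⟨X, ?_⟩
    rw [← hX]
    exact (e.apply_symm_apply _).symm
  refine ⟨_, fun α => e (b α : EuclideanSpace ℂ (Fin d × Fin d)), hgen, ?_, ?_⟩
  · have hconj : ∀ (g : G) α, e.symm ((U g : Matrix (Fin d) (Fin d) ℂ) * e (b α : _)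
        * (U g : Matrix (Fin d) (Fin d) ℂ)ᴴ) ∈ S := by
      intro g α
      obtain ⟨X, hX⟩ := hgen α
      rw [← hX, ← generator_adMap hU]
      exact hmem _
    have hexp : ∀ (g : G) α, e.symm ((U g : Matrix (Fin d) (Fin d) ℂ) * e (b α : _)
        * (U g : Matrix (Fin d) (Fin d) ℂ)ᴴ)
        = ∑ β, b.repr ⟨_, hconj g α⟩ β • (b β : EuclideanSpace ℂ (Fin d × Fin d)) := by
      intro g α
      have := congrArg Subtype.val (b.sum_repr ⟨_, hconj g α⟩)
      simpa using this.symm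
    refine isMultiplet_of_orthogonal (fun g => Matrix.of fun α β => b.repr ⟨_, hconj g α⟩ β)
      (fun g => ?_) fun g α => ?_
    · refine mul_transpose_eq_one_of_form (innerₗ (EuclideanSpace ℂ (Fin d × Fin d)))
        one_ne_zero (x := fun α => (b α : EuclideanSpace ℂ (Fin d × Fin d)))
        (fun α β => ?_) fun α β => ?_
      · exact orthonormal_iff_ite.mp b.orthonormal α β
      · simp only [Matrix.of_apply]
        rw [← hexp, ← hexp]
        have hin : ∀ v w : EuclideanSpace ℂ (Fin d × Fin d),
            innerₗ (EuclideanSpace ℂ (Fin d × Fin d)) v w = ((e v)ᴴ * e w).trace.re := by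
          intro v w
          have h1 := congrArg Complex.re (inner_eq_trace_vecMatrixEquiv v w)
          rw [PiLp.inner_apply, Complex.re_sum] at h1
          rw [innerₗ_apply_apply, PiLp.inner_apply]
          exact h1
        rw [hin, hin, e.apply_symm_apply, e.apply_symm_apply]
        congr 1
        rw [Matrix.conjTranspose_mul, Matrix.conjTranspose_mul, Matrix.conjTranspose_conjTranspose]
        simp only [Matrix.mul_assoc]
        rw [← Matrix.mul_assoc (U g : Matrix (Fin d) (Fin d) ℂ)ᴴ (U g : Matrix (Fin d) (Fin d) ℂ),
          conjTranspose_mul_coe, Matrix.one_mul, Matrix.trace_mul_comm]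
        simp only [Matrix.mul_assoc]
        rw [conjTranspose_mul_coe, Matrix.mul_one, Matrix.trace_mul_comm]
    · have h1 := congrArg e (hexp g α)
      rw [e.apply_symm_apply, map_sum] at h1
      simp only [map_smul] at h1
      exact h1
  · obtain ⟨X, hX⟩ := h0
    by_contra! hall
    apply hX
    have h1 := congrArg Subtype.val (b.sum_repr ⟨_, hmem X⟩)
    have h2 : ∀ α, (b α : EuclideanSpace ℂ (Fin d × Fin d)) = 0 := fun α =>
      e.injective ((hall α).trans (map_zero e).symm)
    have h3 : e.symm (generator (n := n) U X) = 0 := by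
      rw [← show _ = e.symm (generator (n := n) U X) from h1]
      simp [h2]
    exact e.symm.injective (h3.trans (map_zero e.symm).symm)

lemma exists_generator_basis_ne_zero {U : G →* Matrix.unitaryGroup (Fin d) ℂ}
    (X : Module.Basis A ℝ (GroupLieAlgebra 𝓘(ℝ, EuclideanSpace ℝ (Fin n)) G))
    (h0 : ∃ X : GroupLieAlgebra 𝓘(ℝ, EuclideanSpace ℝ (Fin n)) G, generator U X ≠ 0) :
    ∃ α, generator U (X α) ≠ 0 := by
  by_contra! hall
  obtain ⟨Y, hY⟩ := h0
  have : generatorLin (n := n) U = 0 := X.ext fun α => hall α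
  exact hY (DFunLike.congr_fun this Y)

lemma casimirValue_pos {U : G →* Matrix.unitaryGroup (Fin d) ℂ} (hU : IsSmoothRep (n := n) U)
    (hirr : IsIrrep U) {X : Module.Basis A ℝ (GroupLieAlgebra 𝓘(ℝ, EuclideanSpace ℝ (Fin n)) G)}
    (hX : IsKillingOrthonormal X)
    (h0 : ∃ X : GroupLieAlgebra 𝓘(ℝ, EuclideanSpace ℝ (Fin n)) G, generator U X ≠ 0) :
    0 < casimirValue X U := by
  obtain ⟨c, hc, hcas⟩ := exists_sum_mul_conjTranspose_eq hirr (isMultiplet_generator hU hX)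
    (exists_generator_basis_ne_zero X h0)
  rw [← casimirOp_eq hU, casimirOp_eq_smul_one hU hirr hX] at hcas
  have hne := nonempty_of_isIrrep hirr
  have h1 := congrFun (congrFun hcas hne.some) hne.some
  simp only [Matrix.smul_apply, Matrix.one_apply_eq, smul_eq_mul, mul_one] at h1
  rwa [Complex.ofReal_inj.mp h1]

end LieMMIS

/-! ### The defining representation of SU(2) on qubits. -/

section Qubits

lemma spin_conjTranspose (α : Fin 3) : (spin α)ᴴ = spin α := by
  fin_cases α <;> ext a b <;> fin_cases a <;> fin_cases b <;>
    simp [spin, Matrix.conjTranspose_apply]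

lemma spin_trace (α : Fin 3) : (spin α).trace = 0 := by
  fin_cases α <;> simp [spin, Matrix.trace_fin_two]; ring

/-- The completeness relation of the Pauli matrices. -/
lemma spin_completeness (a b c e : Fin 2) :
    ∑ α, spin α a b * spin α c e
      = (1 / 2) * (if a = e ∧ c = b then 1 else 0) - (1 / 4) * (if a = b ∧ c = e then 1 else 0) := by
  fin_cases a <;> fin_cases b <;> fin_cases c <;> fin_cases e <;>
    simp [spin, Fin.sum_univ_three] <;> ring_nf <;> norm_num

lemma sum_spin_mul_self : ∑ α, spin α * (spin α)ᴴ = (((3 / 4 : ℝ) : ℝ) : ℂ) • 1 := by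
  simp only [spin_conjTranspose]
  ext a b
  fin_cases a <;> fin_cases b <;>
    simp [spin, Fin.sum_univ_three] <;> ring_nf <;> norm_num

lemma spin_mul_self (α : Fin 3) : spin α * spin α = (1 / 4 : ℂ) • 1 := by
  fin_cases α <;> ext a b <;> fin_cases a <;> fin_cases b <;>
    simp [spin, Matrix.mul_apply] <;> ring_nf <;> norm_num

/-- The factor 2 compensates Tr(S_α S_β) = δ_{αβ}/2. -/
lemma eq_sum_spin {M : Matrix (Fin 2) (Fin 2) ℂ} (hM : Mᴴ = M) (ht : M.trace = 0) :
    M = ∑ β, (2 * (M * spin β).trace.re) • spin β := by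
  have h00 : (M 0 0).im = 0 := by
    have := congrArg Complex.im (congrFun (congrFun hM 0) 0)
    simp [Matrix.conjTranspose_apply] at this
    linarith
  have h01 : M 1 0 = star (M 0 1) := (congrFun (congrFun hM 1) 0).symm
  have h11 : M 1 1 = -M 0 0 := by
    rw [Matrix.trace_fin_two] at ht
    exact eq_neg_of_add_eq_zero_right ht
  ext a b
  fin_cases a <;> fin_cases b <;>
    simp [spin, Fin.sum_univ_three, Matrix.trace_fin_two, Matrix.mul_apply, h01, h11, h00,
      Complex.ext_iff, Matrix.sum_apply] <;> ring_nf <;> simp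

/-- The real trace form `Re Tr(M N)`. -/
def traceForm (m : ℕ) : Matrix (Fin m) (Fin m) ℂ →ₗ[ℝ] Matrix (Fin m) (Fin m) ℂ →ₗ[ℝ] ℝ :=
  LinearMap.mk₂ ℝ (fun M N => (M * N).trace.re)
    (fun M N P => by simp [add_mul]) (fun c M N => by simp)
    (fun M N P => by simp [mul_add]) (fun c M N => by simp)

lemma traceForm_spin (α β : Fin 3) :
    traceForm 2 (spin α) (spin β) = if α = β then 1 / 2 else 0 := by
  change ((spin α) * (spin β)).trace.re = _
  fin_cases α <;> fin_cases β <;>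
    simp [spin, Matrix.trace_fin_two] <;> norm_num

lemma isMultiplet_spin : IsMultiplet qubitRep spin := by
  have hexp : ∀ (g : Matrix.specialUnitaryGroup (Fin 2) ℂ) α,
      (qubitRep g : Matrix (Fin 2) (Fin 2) ℂ) * spin α * (qubitRep g : Matrix (Fin 2) (Fin 2) ℂ)ᴴ
        = ∑ β, (2 * ((qubitRep g : Matrix (Fin 2) (Fin 2) ℂ) * spin α
          * (qubitRep g : Matrix (Fin 2) (Fin 2) ℂ)ᴴ * spin β).trace.re) • spin β := by
    intro g α
    refine eq_sum_spin ?_ ?_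
    · rw [Matrix.conjTranspose_mul, Matrix.conjTranspose_mul, Matrix.conjTranspose_conjTranspose,
        spin_conjTranspose, Matrix.mul_assoc]
    · rw [Matrix.trace_mul_comm, ← Matrix.mul_assoc, conjTranspose_mul_coe, Matrix.one_mul,
        spin_trace]
  refine isMultiplet_of_orthogonal (fun g => Matrix.of fun α β =>
    2 * ((qubitRep g : Matrix (Fin 2) (Fin 2) ℂ) * spin α
      * (qubitRep g : Matrix (Fin 2) (Fin 2) ℂ)ᴴ * spin β).trace.re) (fun g => ?_) hexp
  refine mul_transpose_eq_one_of_form (traceForm 2) (by norm_num) traceForm_spin fun α β => ?_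
  simp only [Matrix.of_apply]
  rw [← hexp, ← hexp]
  change (_ * _ : Matrix (Fin 2) (Fin 2) ℂ).trace.re = (_ * _ : Matrix (Fin 2) (Fin 2) ℂ).trace.re
  congr 1
  simp only [Matrix.mul_assoc]
  rw [← Matrix.mul_assoc (qubitRep g : Matrix (Fin 2) (Fin 2) ℂ)ᴴ
    (qubitRep g : Matrix (Fin 2) (Fin 2) ℂ), conjTranspose_mul_coe, Matrix.one_mul,
    Matrix.trace_mul_comm]
  simp only [Matrix.mul_assoc]
  rw [conjTranspose_mul_coe, Matrix.mul_one]

/-- The rotation with cosine `c` and sine `s` generated by a spin operator. -/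
lemma rotation_mem (α : Fin 3) {c s : ℝ} (h : c ^ 2 + s ^ 2 = 1) :
    (c : ℂ) • (1 : Matrix (Fin 2) (Fin 2) ℂ) + (2 * Complex.I * s) • spin α
      ∈ Matrix.specialUnitaryGroup (Fin 2) ℂ := by
  have hc : (c : ℂ) ^ 2 + (s : ℂ) ^ 2 = 1 := by exact_mod_cast h
  have hI := Complex.I_sq
  rw [Matrix.mem_specialUnitaryGroup_iff, Matrix.mem_unitaryGroup_iff]
  constructor
  · have hstar : star ((c : ℂ) • (1 : Matrix (Fin 2) (Fin 2) ℂ) + (2 * Complex.I * s) • spin α)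
        = (c : ℂ) • (1 : Matrix (Fin 2) (Fin 2) ℂ) - (2 * Complex.I * s) • spin α := by
      rw [Matrix.star_eq_conjTranspose, Matrix.conjTranspose_add, Matrix.conjTranspose_smul,
        Matrix.conjTranspose_smul, spin_conjTranspose, Matrix.conjTranspose_one, sub_eq_add_neg,
        ← neg_smul]
      simp
    rw [hstar, mul_sub, add_mul, add_mul]
    simp only [Matrix.smul_mul, Matrix.mul_smul, Matrix.one_mul, Matrix.mul_one, spin_mul_self,
      smul_smul]
    have h1 : (c : ℂ) * c + (s : ℂ) * s = 1 := by linear_combination hc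
    have h2 : (2 * Complex.I * s) * ((2 * Complex.I * s) * (1 / 4)) = -((s : ℂ) * s) := by
      linear_combination (s : ℂ) ^ 2 * hI
    rw [h2]
    conv_rhs => rw [← one_smul ℂ (1 : Matrix (Fin 2) (Fin 2) ℂ), ← h1]
    module
  · fin_cases α <;> simp [spin, Matrix.det_fin_two]
    · linear_combination hc - (s : ℂ) ^ 2 * hI
    · linear_combination hc + (Complex.I ^ 2 - 1) * (s : ℂ) ^ 2 * hI
    · linear_combination hc - (s : ℂ) ^ 2 * hI

lemma totalOp_spin_mul_invSector (N : ℕ) (α : Fin 3) :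
    totalOp N (spin α) * projMatrix (invSector (tensorRep qubitRep N)) = 0 := by
  -- The one-parameter group exp(2itS_α), with derivative 2iS_α at 0.
  let γ : ℝ → Matrix.specialUnitaryGroup (Fin 2) ℂ := fun t =>
    ⟨_, rotation_mem α (Real.cos_sq_add_sin_sq t)⟩
  have h1 : HasEntryDeriv (fun t => (γ t : Matrix (Fin 2) (Fin 2) ℂ))
      ((2 * Complex.I) • spin α) := by
    intro a b
    have hc : HasDerivAt (fun t : ℝ => (Real.cos t : ℂ)) 0 0 := by
      simpa using (Real.hasDerivAt_cos 0).ofReal_comp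
    have hs : HasDerivAt (fun t : ℝ => (Real.sin t : ℂ)) 1 0 := by
      simpa using (Real.hasDerivAt_sin 0).ofReal_comp
    have h2 := (hc.mul_const ((1 : Matrix (Fin 2) (Fin 2) ℂ) a b)).add
      ((hs.const_mul (2 * Complex.I)).mul_const (spin α a b))
    refine h2.congr_deriv ?_
    simp
  have h0 : (γ 0 : Matrix (Fin 2) (Fin 2) ℂ) = 1 := by simp [γ]
  have h2 := (h1.tensorPow N h0).mul_const (projMatrix (invSector (tensorRep qubitRep N)))
  have h3 : ∀ t, tensorPow N (γ t : Matrix (Fin 2) (Fin 2) ℂ)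
      * projMatrix (invSector (tensorRep qubitRep N))
      = projMatrix (invSector (tensorRep qubitRep N)) := fun t =>
    rep_mul_invSector (tensorRep qubitRep N) (γ t)
  simp only [h3] at h2
  have h4 := h2.unique (hasEntryDeriv_const _)
  rw [totalOp_smul, Matrix.smul_mul] at h4
  exact (smul_eq_zero.mp h4).resolve_left (by simp)

lemma isCharged_spin : IsCharged qubitRep spin := by
  intro B hB hsym
  have ht : B.trace = 0 := by
    have hle : Submodule.span ℂ (Set.range spin)
        ≤ LinearMap.ker (Matrix.traceLinearMap (Fin 2) ℂ ℂ) := by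
      rw [Submodule.span_le]
      rintro _ ⟨α, rfl⟩
      exact spin_trace α
    exact hle hB
  have hcomm : ∀ α, spin α * B = B * spin α := by
    intro α
    -- The matrix 2iS_α itself belongs to SU(2), so a symmetric operator commutes with every spin
    -- operator.
    have hmem := rotation_mem α (c := 0) (s := 1) (by norm_num)
    have h1 := congrArg (· * (qubitRep ⟨_, hmem⟩ : Matrix (Fin 2) (Fin 2) ℂ)) (hsym ⟨_, hmem⟩)
    simp only [Matrix.mul_assoc, conjTranspose_mul_coe, Matrix.mul_one] at h1
    have h2 : (qubitRep ⟨_, hmem⟩ : Matrix (Fin 2) (Fin 2) ℂ) = (2 * Complex.I) • spin α := by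
      change ((0 : ℝ) : ℂ) • (1 : Matrix (Fin 2) (Fin 2) ℂ)
        + (2 * Complex.I * ((1 : ℝ) : ℂ)) • spin α = _
      simp
    rw [h2, Matrix.smul_mul, Matrix.mul_smul] at h1
    exact smul_right_injective _ (by simp) h1
  have hz := hcomm 2
  have hx := hcomm 0
  have h01 := congrFun (congrFun hz 0) 1
  have h10 := congrFun (congrFun hz 1) 0
  have hd := congrFun (congrFun hx 0) 1
  simp [spin, Matrix.mul_apply] at h01 h10 hd
  rw [Matrix.trace_fin_two] at ht
  ext a b
  fin_cases a <;> fin_cases b <;> simp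
  · linear_combination ht / 2 - hd
  · linear_combination h01
  · linear_combination -h10
  · linear_combination ht / 2 + hd

/-- The invariant states of `N` qubits exist exactly for even `N`. -/
lemma mem_mmisSizes_qubitRep_iff (N : ℕ) : N ∈ mmisSizes qubitRep ↔ Even N := by
  constructor
  · intro h
    by_contra hN
    rw [Nat.not_even_iff_odd] at hN
    apply h
    rw [Submodule.eq_bot_iff]
    intro v hv
    -- The central element -1 acts as (-1)^N, so for odd N nothing nonzero is fixed.
    have hmem : (-1 : Matrix (Fin 2) (Fin 2) ℂ) ∈ Matrix.specialUnitaryGroup (Fin 2) ℂ := by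
      have := rotation_mem 0 (c := -1) (s := 0) (by norm_num)
      simpa using this
    have h1 := mem_invSector_iff.mp hv ⟨-1, hmem⟩
    have h2 : tensorPow N (-1 : Matrix (Fin 2) (Fin 2) ℂ) = -1 := by
      have : (-1 : Matrix (Fin 2) (Fin 2) ℂ) = (-1 : ℂ) • 1 := by simp
      rw [this]
      ext s t
      have h3 := congrFun (congrFun (tensorPow_one (d := 2) N) s) t
      simp only [tensorPow, Matrix.of_apply] at h3
      simp only [tensorPow, Matrix.of_apply, Matrix.smul_apply, smul_eq_mul,
        Finset.prod_mul_distrib, h3]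
      simp [hN.neg_one_pow]
    rw [coe_tensorRep] at h1
    change Matrix.toEuclideanLin (tensorPow N (-1 : Matrix (Fin 2) (Fin 2) ℂ)) v = v at h1
    rw [h2, map_neg, LinearMap.neg_apply] at h1
    have h4 : Matrix.toEuclideanLin (1 : Matrix (Fin N → Fin 2) (Fin N → Fin 2) ℂ) v = v := by simp
    rw [h4] at h1
    have h5 : (2 : ℂ) • v = 0 := by
      rw [two_smul]
      nth_rewrite 1 [← h1]
      exact neg_add_cancel v
    exact (smul_eq_zero.mp h5).resolve_left two_ne_zero
  · rintro ⟨k, rfl⟩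
    rw [← mul_two]
    exact mul_mem_mmisSizes (fun g => (Matrix.mem_specialUnitaryGroup_iff.mp g.2).2) k

lemma quadOp_spin_mul_self :
    quadOp spin (0 : Fin 2) 1 * quadOp spin (0 : Fin 2) 1
      = (3 / 16 : ℂ) • (1 : Matrix (Fin 2 → Fin 2) (Fin 2 → Fin 2) ℂ)
        - (1 / 2 : ℂ) • quadOp spin (0 : Fin 2) 1 := by
  set E : Matrix (Fin 2 → Fin 2) (Fin 2 → Fin 2) ℂ :=
    Matrix.of fun s t => if s 0 = t 1 ∧ s 1 = t 0 then 1 else 0 with hE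
  -- S₁·S₂ = E/2 - 1/4 with E the swap of the two qubits; the quadratic relation then follows from
  -- E² = 1.
  have h1 : quadOp spin (0 : Fin 2) 1 = (1 / 2 : ℂ) • E - (1 / 4 : ℂ) • 1 := by
    ext s t
    have h2 : ∀ α, (siteOp (0 : Fin 2) (spin α) * siteOp 1 (spin α)ᴴ :
        Matrix (Fin 2 → Fin 2) (Fin 2 → Fin 2) ℂ) s t
        = spin α (s 0) (t 0) * spin α (s 1) (t 1) := by
      intro α
      rw [spin_conjTranspose, siteOp_eq_tensorFam, siteOp_eq_tensorFam, ← map_mul, tensorFam_apply]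
      simp [Fin.prod_univ_two]
    simp only [quadOp, Matrix.sum_apply, h2, spin_completeness, Matrix.sub_apply,
      Matrix.smul_apply, smul_eq_mul, hE, Matrix.of_apply, Matrix.one_apply, funext_iff,
      Fin.forall_fin_two]
  have hEE : E * E = 1 := by
    have hsw : E = (1 : Matrix (Fin 2 → Fin 2) (Fin 2 → Fin 2) ℂ).submatrix
        (fun s => ![s 1, s 0]) id := by
      ext s t
      simp [hE, Matrix.one_apply, funext_iff, Fin.forall_fin_two, and_comm]
    have hmul : ∀ M : Matrix (Fin 2 → Fin 2) (Fin 2 → Fin 2) ℂ,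
        E * M = M.submatrix (fun s => ![s 1, s 0]) id := by
      intro M
      rw [hsw]
      ext s t
      simp [Matrix.mul_apply, Matrix.one_apply]
    rw [hmul]
    ext s t
    simp [hE, Matrix.one_apply, funext_iff, Fin.forall_fin_two, and_comm]
  rw [h1]
  simp only [sub_mul, mul_sub, Matrix.smul_mul, Matrix.mul_smul, hEE, Matrix.one_mul,
    Matrix.mul_one]
  module

open scoped ComplexOrder in
-- The eigenvalues of S₁·S₂ are 1/4 and -3/4, and 3/8 - x/2 is the affine function that agrees with
-- |x| at both.
lemma matAbs_quadOp_spin :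
    matAbs (quadOp spin (0 : Fin 2) 1)
      = (3 / 8 : ℂ) • (1 : Matrix (Fin 2 → Fin 2) (Fin 2 → Fin 2) ℂ)
        - (1 / 2 : ℂ) • quadOp spin (0 : Fin 2) 1 := by
  set Q := quadOp spin (0 : Fin 2) 1 with hQ
  set M := (3 / 8 : ℂ) • (1 : Matrix (Fin 2 → Fin 2) (Fin 2 → Fin 2) ℂ) - (1 / 2 : ℂ) • Q with hM
  have hQH : Qᴴ = Q := by
    rw [hQ, quadOp, Matrix.conjTranspose_sum]
    refine Finset.sum_congr rfl fun α _ => ?_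
    rw [Matrix.conjTranspose_mul, siteOp_conjTranspose, siteOp_conjTranspose,
      spin_conjTranspose, spin_conjTranspose, (siteOp_commute zero_ne_one _ _).eq]
  have hMH : Mᴴ = M := by
    rw [hM, Matrix.conjTranspose_sub, Matrix.conjTranspose_smul, Matrix.conjTranspose_smul, hQH,
      Matrix.conjTranspose_one]
    simp
  have hQQ : Q * Q = (3 / 16 : ℂ) • 1 - (1 / 2 : ℂ) • Q := quadOp_spin_mul_self
  have hMM : M * M = (3 / 16 : ℂ) • 1 - (1 / 2 : ℂ) • Q := by
    rw [hM]
    simp only [sub_mul, mul_sub, Matrix.smul_mul, Matrix.mul_smul, Matrix.one_mul,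
      Matrix.mul_one, hQQ]
    module
  refine matSqrt_unique ?_ (by rw [hMM, hQH, hQQ])
  -- The quadratic relation gives M = M² + 3/16, which makes positivity evident.
  have h1 : M = Mᴴ * M + (3 / 16 : ℂ) • 1 := by
    rw [hMH, hMM, hM]
    module
  rw [h1]
  refine (Matrix.posSemidef_conjTranspose_mul_self M).add (Matrix.PosSemidef.one.smul ?_)
  rw [Complex.le_def]
  norm_num

lemma linearCorr_spin {N : ℕ} (hN : Even N) {i j : Fin N} (h : i ≠ j) :
    linearCorr (mmis qubitRep N) spin i j = ((-(3 / (4 * ((N : ℝ) - 1))) : ℝ) : ℂ) := by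
  rw [linearCorr_mmis ((mem_mmisSizes_qubitRep_iff N).mpr hN) sum_spin_mul_self (fun α => by
    rw [spin_conjTranspose, totalOp_spin_mul_invSector]) h, div_div]

/-- As |Q| is affine in Q, the exact value follows from the linear correlator. -/
lemma fidelityCorr_spin {N : ℕ} (hN : Even N) {i j : Fin N} (h : i ≠ j) :
    fidelityCorr (mmis qubitRep N) spin i j = 3 / 8 + 3 / (8 * ((N : ℝ) - 1)) := by
  have hl := linearCorr_spin hN h
  rw [linearCorr] at hl
  rw [fidelityCorr_mmis isMultiplet_spin h, ← pairAlg_quadOp h, matAbs_pairAlg,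
    matAbs_quadOp_spin, map_sub, map_smul, map_smul, map_one, pairAlg_quadOp, mul_sub,
    Matrix.mul_smul, Matrix.mul_smul, Matrix.mul_one, Matrix.trace_sub, Matrix.trace_smul,
    Matrix.trace_smul, hl, mmis, maxMixed_trace ((mem_mmisSizes_qubitRep_iff N).mpr hN)]
  have h1 : (3 / 8 : ℂ) • (1 : ℂ) - (1 / 2 : ℂ) • ((-(3 / (4 * ((N : ℝ) - 1))) : ℝ) : ℂ)
      = ((3 / 8 + 3 / (8 * ((N : ℝ) - 1)) : ℝ) : ℂ) := by
    have hN1 : (N : ℝ) - 1 ≠ 0 := by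
      have := one_lt_of_ne h
      have : (1 : ℝ) < N := by exact_mod_cast this
      linarith
    rw [smul_eq_mul, smul_eq_mul, ← Complex.ofReal_one]
    have h2 : (3 / 8 + 3 / (8 * ((N : ℝ) - 1)))
        = 3 / 8 * 1 - 1 / 2 * -(3 / (4 * ((N : ℝ) - 1))) := by
      field_simp
      ring
    rw [h2]
    push_cast
    ring
  rw [h1, Complex.ofReal_re]

lemma detectsSWSSB_spin :
    DetectsSWSSB qubitRep (mmisSizes qubitRep) (mmis qubitRep) spin := by
  refine detectsSWSSB_mmis
    (mmisSizes_infinite (fun g => (Matrix.mem_specialUnitaryGroup_iff.mp g.2).2) two_pos)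
    isMultiplet_spin isCharged_spin sum_spin_mul_self (fun N α => by
      rw [spin_conjTranspose, totalOp_spin_mul_invSector]) (a := 3 / 8) (by norm_num)
    fun N hN i j h => ?_
  rw [fidelityCorr_spin ((mem_mmisSizes_qubitRep_iff N).mp hN) h]
  have : (1 : ℝ) < N := by exact_mod_cast one_lt_of_ne h
  have : 0 ≤ 3 / (8 * ((N : ℝ) - 1)) := div_nonneg (by norm_num) (by linarith)
  linarith

lemma fidelityCorr_spin_tendsto {ε : ℝ} (hε : 0 < ε) :
    ∃ N₀ : ℕ, ∀ N : ℕ, Even N → N₀ ≤ N → ∀ i j : Fin N, i ≠ j →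
      |fidelityCorr (mmis qubitRep N) spin i j - 3 / 8| < ε := by
  obtain ⟨N₀, hN₀⟩ := exists_nat_gt (1 / ε + 1)
  refine ⟨N₀, fun N hN hle i j h => ?_⟩
  rw [fidelityCorr_spin hN h, add_sub_cancel_left]
  have h1 : 1 / ε < (N : ℝ) - 1 := by
    have : (N₀ : ℝ) ≤ N := by exact_mod_cast hle
    linarith
  have h2 : 0 < (N : ℝ) - 1 := (by positivity : (0 : ℝ) < 1 / ε).trans h1
  rw [abs_of_pos (by positivity), div_lt_iff₀ (by positivity)]
  rw [div_lt_iff₀ hε] at h1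
  nlinarith

end Qubits

end SWSSB

end

/-! ### Assembly of the theorem. -/

open SWSSB in
theorem mainTheorem9 :
    -- Maximally mixed states of arbitrary sectors of an arbitrary on-site symmetry
    (∀ (G : Type*) [Group G] (d N m r : ℕ) (U : G →* Matrix.unitaryGroup (Fin d) ℂ)
        (J : G →* Matrix.unitaryGroup (Fin m) ℂ) (O : Fin r → Matrix (Fin d) (Fin d) ℂ),
        IsIrrep J → sector (tensorRep U N) J ≠ ⊥ → IsMultiplet U O →
      (∀ i j : Fin N, i ≠ j →
        (fidelityCorr (sectorState U N J) O i j : ℂ)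
            = (projMatrix (sector (tensorRep U N) J)).trace⁻¹
              * (projMatrix (sector (tensorRep U N) J)
                  * matSqrt (quadOp O i j * (quadOp O i j)ᴴ)).trace ∧
        (fidelityCorr (sectorState U N J) O i j : ℂ)
            = (sectorState U N J * matAbs (quadOp O i j)).trace ∧
        (0 < fidelityCorr (sectorState U N J) O i j ↔
          projMatrix (sector (tensorRep U N) J) * quadOp O i j ≠ 0)) ∧
      (∀ i j k l : Fin N, i ≠ j → k ≠ l →
        fidelityCorr (sectorState U N J) O i j = fidelityCorr (sectorState U N J) O k l)) ∧
    -- MMIS of compact connected semisimple Lie groups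
    (∀ (n : ℕ) (G : Type*) [TopologicalSpace G] [ChartedSpace (EuclideanSpace ℝ (Fin n)) G]
        [Group G] [LieGroup 𝓘(ℝ, EuclideanSpace ℝ (Fin n)) ∞ G] [T2Space G] [CompactSpace G]
        [ConnectedSpace G]
        [LieAlgebra.IsSemisimple ℝ (GroupLieAlgebra 𝓘(ℝ, EuclideanSpace ℝ (Fin n)) G)]
        (d : ℕ) (U : G →* Matrix.unitaryGroup (Fin d) ℂ),
        IsSmoothRep (n := n) U → IsIrrep U → 2 ≤ d →
      HasSWSSB U (mmisSizes U) (mmis U) ∧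
      (∀ X : Module.Basis (Fin n) ℝ (GroupLieAlgebra 𝓘(ℝ, EuclideanSpace ℝ (Fin n)) G),
          IsKillingOrthonormal X →
        DetectsSWSSB U (mmisSizes U) (mmis U) (fun α => generator U (X α)) ∧
        casimirOp X U = (casimirValue X U : ℂ) • 1 ∧
        0 < casimirValue X U ∧
        (∃ a b : ℝ, 0 < a ∧ ∀ N ∈ mmisSizes U, ∀ i j : Fin N, i ≠ j →
          a ≤ fidelityCorr (mmis U N) (fun α => generator U (X α)) i j ∧
          fidelityCorr (mmis U N) (fun α => generator U (X α)) i j ≤ b) ∧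
        (∀ N ∈ mmisSizes U, ∀ i j : Fin N, i ≠ j →
          linearCorr (mmis U N) (fun α => generator U (X α)) i j
            = ((-(casimirValue X U / ((N : ℝ) - 1)) : ℝ) : ℂ)) ∧
        (∀ N ∈ mmisSizes U, ∀ (i : Fin N) (α : Fin n),
          (mmis U N * siteOp i (generator U (X α))).trace = 0) ∧
        (∀ (K : Type) [Fintype K] (m : K → ℕ) (J : ∀ k, G →* Matrix.unitaryGroup (Fin (m k)) ℂ),
            ListsIrreps (tensorRep U 2) m J →
          (∀ k, casimirOp X (J k) = (casimirValue X (J k) : ℂ) • 1) ∧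
          (∀ (N : ℕ) (i j : Fin N), i ≠ j →
            quadOp (fun α => generator U (X α)) i j
              = ∑ k, (((casimirValue X (J k) - 2 * casimirValue X U) / 2 : ℝ) : ℂ)
                  • pairOp i j (projMatrix (sector (tensorRep U 2) (J k)))) ∧
          (∀ N ∈ mmisSizes U, ∀ i j : Fin N, i ≠ j →
            fidelityCorr (mmis U N) (fun α => generator U (X α)) i j
              = ∑ k, |(casimirValue X (J k) - 2 * casimirValue X U) / 2|
                  * ((mult (tensorRep U 2) (J k) : ℝ)
                      * (mult (tensorRep U (N - 2)) (conjRep (J k)) : ℝ)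
                    / (Module.finrank ℂ (invSector (tensorRep U N)) : ℝ)))))) ∧
    -- MMIS of `SU(2)` on qubits
    (HasSWSSB qubitRep (mmisSizes qubitRep) (mmis qubitRep) ∧
      DetectsSWSSB qubitRep (mmisSizes qubitRep) (mmis qubitRep) spin ∧
      (∀ N : ℕ, N ∈ mmisSizes qubitRep ↔ Even N) ∧
      (∀ N : ℕ, Even N → ∀ i j : Fin N, i ≠ j →
        linearCorr (mmis qubitRep N) spin i j = ((-(3 / (4 * ((N : ℝ) - 1))) : ℝ) : ℂ)) ∧
      (∀ ε : ℝ, 0 < ε → ∃ N₀ : ℕ, ∀ N : ℕ, Even N → N₀ ≤ N → ∀ i j : Fin N, i ≠ j →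
        |fidelityCorr (mmis qubitRep N) spin i j - 3 / 8| < ε)) := by
  refine ⟨?_, ?_, ?_⟩
  · intro G _ d N m r U J O hJ hs hO
    refine ⟨fun i j h => ⟨?_, fidelityCorr_sectorState_eq_trace_matAbs U J hO h,
      fidelityCorr_sectorState_pos_iff U J hO hs i j⟩,
      fun i j k l h h' => fidelityCorr_sectorState_congr U J hO h h'⟩
    exact fidelityCorr_sectorState U J hO i j
  · intro n G _ _ _ _ _ _ _ _ d U hU hirr hd
    have h0 := exists_generator_ne_zero hU hirr hd
    have hd0 : 0 < d := by omega
    refine ⟨?_, fun X hX => ?_⟩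
    -- SW-SSB is proved with an orthonormal basis of the image of the Lie algebra, so it does not
    -- presuppose a Killing-orthonormal basis.
    · obtain ⟨r, O, hO, hm, hne⟩ := exists_generator_multiplet hU h0
      exact ⟨r, O, detectsSWSSB_of_generators hU hirr hd0 hO hm hne⟩
    · have hcas := casimirOp_eq_smul_one hU hirr hX
      have hsum := hcas
      rw [casimirOp_eq hU] at hsum
      have hm := isMultiplet_generator hU hX
      have hpos := casimirValue_pos hU hirr hX h0
      have hk : ∀ N α, totalOp N (generator U (X α)) * projMatrix (invSector (tensorRep U N)) = 0 :=
        fun N α => totalOp_generator_mul_invSector hU N (X α)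
      refine ⟨detectsSWSSB_of_generators hU hirr hd0 (fun α => ⟨X α, rfl⟩) hm
        (exists_generator_basis_ne_zero X h0), hcas, hpos,
        exists_fidelityCorr_mmis_bounds hm (fun α => generator_conjTranspose hU (X α)) hpos hsum hk,
        fun N hN i j h => linearCorr_mmis hN hsum (fun α => ?_) h,
        fun N hN i α => trace_mul_siteOp_eq_zero (mmis_submatrix U) (mul_mmis_eq_zero (hk N α)) i,
        fun K _ m J hJ => ?_⟩
      · rw [generator_conjTranspose hU, totalOp_neg, Matrix.neg_mul, hk, neg_zero]
      · classical
        exact ⟨fun k => casimirOp_eq_smul_one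
            (isSmoothRep_of_sector_ne_bot hU (hJ.irrep k) (hJ.occurs k)) (hJ.irrep k) hX,
          fun N i j h => quadOp_eq_sum_pairOp hU hirr hX hJ h,
          fun N _ i j h => fidelityCorr_mmis_eq_sum hU hirr hX hJ h⟩
  · exact ⟨⟨3, spin, detectsSWSSB_spin⟩, detectsSWSSB_spin, mem_mmisSizes_qubitRep_iff,
      fun N hN i j h => linearCorr_spin hN h, fun ε hε => fidelityCorr_spin_tendsto hε⟩
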